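/- Let $S^1\subset\mathbb C$ be the unit circle; homeomorphisms of $S^1$ are composed as maps. A Möbius map of $S^1$ is the restriction of some $z\mapsto\frac{az+b}{\bar b z+\bar a}$ with $|b|<|a|$. Call a pair $(f_1,f_2)$ of Möbius maps of $S^1$ a *Schottky pair of a torus with a hole* if there are four pairwise disjoint non-degenerate closed arcs $N,E,S,W$ in this cyclic (counterclockwise) order with $f_1(S^1\setminus S)\subset N$ and either $f_2(S^1\setminus W)\subset E$ or $f_2(S^1\setminus E)\subset W$. Let $G=\langle f_1,f_2\rangle$ be the generated group, $\Lambda\subset S^1$ its limit set (the set of accumulation points on $S^1$ of the orbit of $0$ in the open disc), and $f=[f_1,f_2]=f_1f_2f_1^{-1}f_2^{-1}$. For a semigroup $H$ of homeomorphisms of $S^1$, $H$ is *forward minimal* if for every $x\in S^1$ the orbit $\{h(x):h\in H\}$ is dense in $S^1$, and *backward minimal* if $H^{-1}=\{h^{-1}:h\in H\}$ is forward minimal; a *forward* (*backward*) *minimal set* of $H$ is an inclusion-minimal nonempty closed set $K$ with $h(K)\subset K$ for all $h\in H$ (respectively all $h\in H^{-1}$). Schottky pairs of a torus with a hole exist,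 and for every such pair $(f_1,f_2)$ the following hold. 1. $\Lambda$ is a Cantor set. 2. There is a connected component $I_0$ of $S^1\setminus\Lambda$ with $f(I_0)=I_0$. For every such $I_0$ there is a smooth vector field $v$ on $S^1$ that has a complete flow on $I_0$ whose time-one map is $f|_{I_0}$. For every continuous vector field $v$ on $I_0$ and every complete flow $(\Phi^t)_{t\in\mathbb R}$ of $v$ on $I_0$ with $\Phi^1=f|_{I_0}$, the map $f_3$ that is the identity outside $I_0$ and equals $\Phi^{-\sqrt2}$ on $I_0$ is a homeomorphism of $S^1$. 3. There is an (orientation-preserving) homeomorphism $f_4$ of $S^1$ with $f_4(\Lambda)\subsetneq\Lambda$. 4. For every choice of $I_0$, $v$, $\Phi$, $f_3$ as in 2 and every homeomorphism $f_4$ of $S^1$ with $f_4(\Lambda)\subsetneq\Lambda$, the semigroup $$G_1=\langle f_1,f_1^{-1},f_2,f_2^{-1},f_3,f_4\rangle_+$$ is backward minimal but not forward minimal; $\Lambda$ is its unique forward minimal set $\mathcal M_+$ and $S^1$ is its unique backward minimal set $\mathcal M_-$, so that $\mathcal M_+=\Lambda\subsetneq\mathcal M_-=S^1$. In particular, there is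 a finitely generated semigroup of homeomorphisms of the circle that is backward minimal but not forward minimal. -/

import Mathlib

open scoped ComplexConjugate ContDiff Pointwise

noncomputable section

/-- The Moebius transformation `z ↦ (a z + b) / (b̄ z + ā)`; for `‖b‖ < ‖a‖` it is an
automorphism of the closed unit disc, and every Moebius automorphism of the disc is of this form. -/
def discMobius (a b z : ℂ) : ℂ := (a * z + b) / (conj b * z + conj a)

/-- `f` is the action on the circle of the disc automorphism with coefficients `a, b`. -/
def IsMobiusWith (a b : ℂ) (f : Circle ≃ₜ Circle) : Prop :=
  ‖b‖ < ‖a‖ ∧ ∀ z : Circle, (f z : ℂ) = discMobius a b z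

/-- Moebius transformations of the circle (preserving the disc). -/
def IsMobius (f : Circle ≃ₜ Circle) : Prop := ∃ a b : ℂ, IsMobiusWith a b f

/-- The closed arc `{e^{iθ} : s ≤ θ ≤ t}`. -/
def circleArc (s t : ℝ) : Set Circle := Circle.exp '' Set.Icc s t

/-- `f₁, f₂` are standard generators of the Schottky group of a torus with a hole: Moebius maps with
four disjoint closed arcs in cyclic order `N, E, S, W` such that `f₁` sends the outside of `S`
into `N` and `f₂` sends the outside of `W` into `E` (or the outside of `E` into `W`). -/
def IsPuncturedTorusSchottky (f₁ f₂ : Circle ≃ₜ Circle) : Prop :=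
  IsMobius f₁ ∧ IsMobius f₂ ∧
  ∃ t : Fin 8 → ℝ, StrictMono t ∧ t 7 < t 0 + 2 * Real.pi ∧
    f₁ '' (circleArc (t 4) (t 5))ᶜ ⊆ circleArc (t 0) (t 1) ∧
    (f₂ '' (circleArc (t 6) (t 7))ᶜ ⊆ circleArc (t 2) (t 3) ∨
      f₂ '' (circleArc (t 2) (t 3))ᶜ ⊆ circleArc (t 6) (t 7))

/-- The orbit of the centre of the disc under the disc automorphisms in `Γ`. -/
def discOrbit (Γ : Subgroup (Circle ≃ₜ Circle)) : Set ℂ :=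
  {w | ∃ g ∈ Γ, ∃ a b : ℂ, IsMobiusWith a b g ∧ w = discMobius a b 0}

/-- The limit set of a group of disc automorphisms: the accumulation points on the circle of an
orbit in the open disc. -/
def limitSet (Γ : Subgroup (Circle ≃ₜ Circle)) : Set Circle :=
  {ξ | AccPt (ξ : ℂ) (Filter.principal (discOrbit Γ))}

/-- Cantor sets in the circle: nonempty, perfect (closed without isolated points) and totally
disconnected; compactness is automatic. -/
def IsCantorSet (C : Set Circle) : Prop :=
  C.Nonempty ∧ Perfect C ∧ IsTotallyDisconnected C

/-- `J` is a connected component of the complement of `C`. -/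
def IsComplementaryInterval (C J : Set Circle) : Prop :=
  ∃ x ∈ Cᶜ, J = connectedComponentIn Cᶜ x

/-- `Φ` is (on `J`) a complete flow on `J` of the vector field `v ∂/∂θ`, with `v` continuous
on `J`. -/
def IsFlowOn (v : Circle → ℝ) (J : Set Circle) (Φ : ℝ → Circle → Circle) : Prop :=
  ContinuousOn v J ∧ ∀ x ∈ J, Φ 0 x = x ∧ (∀ t, Φ t x ∈ J) ∧
    (∀ s t, Φ (s + t) x = Φ s (Φ t x)) ∧
    ∀ t, HasDerivAt (fun s => (Φ s x : ℂ)) ((v (Φ t x) : ℂ) * (Complex.I * (Φ t x : ℂ))) t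

/-- `f` is orientation preserving: it has a continuous increasing lift to the line. -/
def IsOrientationPreserving (f : Circle ≃ₜ Circle) : Prop :=
  ∃ F : ℝ → ℝ, Continuous F ∧ StrictMono F ∧ ∀ t, f (Circle.exp t) = Circle.exp (F t)

/-- Every orbit `{g x : g ∈ S}` is dense in the circle. -/
def HasDenseOrbits (S : Set (Circle ≃ₜ Circle)) : Prop :=
  ∀ x : Circle, Dense {y | ∃ g ∈ S, y = g x}

/-- Forward minimality of a semigroup of circle homeomorphisms. -/
def IsForwardMinimal (G : Subsemigroup (Circle ≃ₜ Circle)) : Prop :=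
  HasDenseOrbits (G : Set (Circle ≃ₜ Circle))

/-- Backward minimality: minimality of the semigroup of inverses. -/
def IsBackwardMinimal (G : Subsemigroup (Circle ≃ₜ Circle)) : Prop :=
  HasDenseOrbits (G : Set (Circle ≃ₜ Circle))⁻¹

/-- `M` is minimal (for inclusion) among the nonempty closed sets mapped into themselves by all
elements of `S`. -/
def IsMinimalSetOf (S : Set (Circle ≃ₜ Circle)) (M : Set Circle) : Prop :=
  Minimal (fun K : Set Circle => K.Nonempty ∧ IsClosed K ∧ ∀ g ∈ S, g '' K ⊆ K) M

/-- `M` is a minimal set of the forward action of the semigroup `G`. -/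
def IsForwardMinimalSet (G : Subsemigroup (Circle ≃ₜ Circle)) (M : Set Circle) : Prop :=
  IsMinimalSetOf (G : Set (Circle ≃ₜ Circle)) M

/-- `M` is a minimal set of the backward action of the semigroup `G`. -/
def IsBackwardMinimalSet (G : Subsemigroup (Circle ≃ₜ Circle)) (M : Set Circle) : Prop :=
  IsMinimalSetOf (G : Set (Circle ≃ₜ Circle))⁻¹ M

/-- The limit set `Λ` of the group generated by `f₁` and `f₂`. -/
def schottkyLimitSet (f₁ f₂ : Circle ≃ₜ Circle) : Set Circle :=
  limitSet (Subgroup.closure {f₁, f₂})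

/-- `I₀` is a complementary interval of `Λ` fixed by the commutator of `f₁` and `f₂`. -/
def IsCommutatorInterval (f₁ f₂ : Circle ≃ₜ Circle) (I₀ : Set Circle) : Prop :=
  IsComplementaryInterval (schottkyLimitSet f₁ f₂) I₀ ∧ (f₁ * f₂ * f₁⁻¹ * f₂⁻¹) '' I₀ = I₀

/-- `Φ` is the flow on `I₀` of the vector field `v`, with the commutator of `f₁` and `f₂` as its
time-one map. -/
def IsCommutatorFlow (f₁ f₂ : Circle ≃ₜ Circle) (I₀ : Set Circle) (v : Circle → ℝ)
    (Φ : ℝ → Circle → Circle) : Prop :=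
  IsFlowOn v I₀ Φ ∧ ∀ x ∈ I₀, Φ 1 x = (f₁ * f₂ * f₁⁻¹ * f₂⁻¹) x

/-- `f₃` is the identity outside `I₀` and the time `-√2` map of the flow `Φ` inside. -/
def IsTimeMinusSqrtTwo (I₀ : Set Circle) (Φ : ℝ → Circle → Circle) (f₃ : Circle ≃ₜ Circle) : Prop :=
  (∀ x ∉ I₀, f₃ x = x) ∧ ∀ x ∈ I₀, f₃ x = Φ (-√2) x

/-- The semigroup `G₁ = ⟨f₁, f₁⁻¹, f₂, f₂⁻¹, f₃, f₄⟩₊`. -/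
def semigroupG₁ (f₁ f₂ f₃ f₄ : Circle ≃ₜ Circle) : Subsemigroup (Circle ≃ₜ Circle) :=
  Subsemigroup.closure {f₁, f₁⁻¹, f₂, f₂⁻¹, f₃, f₄}

end

/-! ### Disc automorphisms acting on the circle -/

noncomputable section

/-! Write Γ for the group generated by `f₁` and `f₂`. Forward, nothing leaves Λ: Γ preserves it,
`f₃` is the identity on it because I₀ lies in a gap of Λ, and `f₄` maps it into itself. A nonempty
closed forward invariant set is in particular Γ-invariant, hence contains Λ. So Λ is the only
forward minimal set, and it is not the circle because it has empty interior.

Backward, every orbit is dense. The Γ-orbit of a point of Λ accumulates at a point of Λ outside `f₄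
'' Λ`, so some element of it lies outside `f₄ '' Λ` and `f₄⁻¹` throws that element out of Λ. The
gaps of Λ form a single Γ-orbit, reflecting the single hole of the torus, so the point can then be
moved into I₀. There the commutator is the time 1 map and `f₃⁻¹` the time √2 map of a flow whose
orbit fills I₀; since the numbers n + m√2 with n an integer and m a natural number are dense, the
orbit is dense in I₀. Translating by Γ gives density in every gap, and the gaps are dense in the
circle.

The limit set is controlled by one identity (`IsCenter.exists_inv`): a disc automorphism taking the
centre near the circle contracts everything outside a small disc. Combined with ping-pong it yields
that Λ is perfect, nowhere dense and contained in every nonempty closed Γ-invariant set. An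
expansion argument (`IsPingPong.exists_apply_mem`) moves every point outside Λ into one of the four
gaps between the Schottky arcs, and `exists_isCommutatorInterval_of_chain` places translates of
these gaps in one component, fixed by the commutator.

The commutator fixes both end points of I₀ and is not the identity, so it has no fixed point inside.
A smooth flow exists because the Moebius maps with two given fixed points form a one-parameter
group. For an arbitrary flow the vector field is only continuous, so uniqueness of solutions is not
used; the group law alone shows in `IsFlowOn.exists_strict_angle` that a single orbit sweeps I₀
monotonically. The map `f₄` is built in `SchottkyArcs.exists_homeomorph_ssubset`: it agrees with
`f₁` on the arc N and is the identity on the other three arcs. -/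

theorem Circle.dist_eq_norm_sub (x y : Circle) : dist x y = ‖(x : ℂ) - y‖ := dist_eq_norm (x : ℂ) y

theorem norm_lt_norm_iff_normSq {a b : ℂ} : ‖b‖ < ‖a‖ ↔ Complex.normSq b < Complex.normSq a := by
  rw [Complex.normSq_eq_norm_sq, Complex.normSq_eq_norm_sq]
  exact (sq_lt_sq₀ (norm_nonneg _) (norm_nonneg _)).symm

theorem discMobius_denom_ne_zero {a b z : ℂ} (h : ‖b‖ < ‖a‖) (hz : ‖z‖ ≤ 1) :
    conj b * z + conj a ≠ 0 := by
  intro h0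
  have h1 : conj a = -(conj b * z) := by linear_combination h0
  have h2 : ‖a‖ = ‖b‖ * ‖z‖ := by
    rw [← Complex.norm_conj a, h1, norm_neg, norm_mul, Complex.norm_conj]
  nlinarith [norm_nonneg b]

theorem ne_zero_of_norm_lt {a b : ℂ} (h : ‖b‖ < ‖a‖) : a ≠ 0 :=
  norm_pos_iff.1 ((norm_nonneg b).trans_lt h)

/-- The coefficients on the left and right are those of a composition, and |a|² − |b|² is a
determinant, hence multiplicative. -/
theorem mobius_mul_norm_lt {a b c d : ℂ} (h : ‖b‖ < ‖a‖) (h' : ‖d‖ < ‖c‖) :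
    ‖a * d + b * conj c‖ < ‖a * c + b * conj d‖ := by
  rw [norm_lt_norm_iff_normSq] at *
  have : Complex.normSq (a * c + b * conj d) - Complex.normSq (a * d + b * conj c) =
      (Complex.normSq a - Complex.normSq b) * (Complex.normSq c - Complex.normSq d) := by
    simp only [Complex.normSq_apply, Complex.add_re, Complex.mul_re, Complex.add_im,
      Complex.mul_im, Complex.conj_re, Complex.conj_im]
    ring
  nlinarith

theorem discMobius_comp {a b c d z : ℂ} (h : ‖b‖ < ‖a‖) (h' : ‖d‖ < ‖c‖) (hz : ‖z‖ ≤ 1) :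
    discMobius (a * c + b * conj d) (a * d + b * conj c) z =
      discMobius a b (discMobius c d z) := by
  have hd := discMobius_denom_ne_zero h' hz
  have hd2 := discMobius_denom_ne_zero (mobius_mul_norm_lt h h') hz
  unfold discMobius
  have e : conj b * ((c * z + d) / (conj d * z + conj c)) + conj a =
      (conj (a * d + b * conj c) * z + conj (a * c + b * conj d)) / (conj d * z + conj c) := by
    rw [eq_div_iff hd, add_mul, mul_assoc, div_mul_cancel₀ _ hd]
    simp only [map_add, map_mul, Complex.conj_conj]
    ring
  have e2 : a * ((c * z + d) / (conj d * z + conj c)) + b =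
      ((a * c + b * conj d) * z + (a * d + b * conj c)) / (conj d * z + conj c) := by
    rw [eq_div_iff hd, add_mul, mul_assoc, div_mul_cancel₀ _ hd]
    ring
  rw [e, e2, div_div_div_cancel_right₀ hd]

theorem discMobius_symm {a b z : ℂ} (h : ‖b‖ < ‖a‖) (hz : ‖z‖ ≤ 1) :
    discMobius (conj a) (-b) (discMobius a b z) = z := by
  have h' : ‖-b‖ < ‖conj a‖ := by simpa using h
  have h0 : Complex.normSq a - Complex.normSq b ≠ 0 :=
    (sub_pos.2 (norm_lt_norm_iff_normSq.1 h)).ne'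
  have h1 : (Complex.normSq a : ℂ) - Complex.normSq b ≠ 0 := by exact_mod_cast h0
  rw [← discMobius_comp h' h hz]
  unfold discMobius
  simp only [map_add, map_mul, Complex.conj_conj, map_neg]
  have : a * conj a = Complex.normSq a := Complex.mul_conj a
  have h2 : b * conj b = Complex.normSq b := Complex.mul_conj b
  rw [div_eq_iff]
  · ring
  · convert h1 using 1
    rw [← this, ← h2]
    ring

/-- On the unit circle the numerator is z times the conjugate of the denominator. -/
theorem norm_discMobius {a b : ℂ} (h : ‖b‖ < ‖a‖) (z : Circle) : ‖discMobius a b z‖ = 1 := by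
  have hd := discMobius_denom_ne_zero h (Circle.norm_coe z).le
  have : a * (z : ℂ) + b = z * conj (conj b * (z : ℂ) + conj a) := by
    have := Complex.mul_conj (z : ℂ)
    simp only [Circle.normSq_coe, Complex.ofReal_one] at this
    simp only [map_add, map_mul, Complex.conj_conj]
    linear_combination (-b) * this
  rw [discMobius, this, norm_div, norm_mul, Complex.norm_conj, Circle.norm_coe, one_mul,
    div_self (norm_ne_zero_iff.2 hd)]

/-- The disc automorphism with coefficients `a, b` as a homeomorphism of the circle. -/
def mobiusCircle (a b : ℂ) (h : ‖b‖ < ‖a‖) : Circle ≃ₜ Circle where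
  toFun z := ⟨discMobius a b z, mem_sphere_zero_iff_norm.2 (norm_discMobius h z)⟩
  invFun z := ⟨discMobius (conj a) (-b) z,
    mem_sphere_zero_iff_norm.2 (norm_discMobius (by simpa using h) z)⟩
  left_inv z := Circle.ext (discMobius_symm h (Circle.norm_coe z).le)
  right_inv z := by
    have := discMobius_symm (a := conj a) (b := -b) (z := z) (by simpa using h)
      (Circle.norm_coe z).le
    rw [Complex.conj_conj, neg_neg] at this
    exact Circle.ext this
  continuous_toFun := by
    refine Continuous.subtype_mk ?_ _
    exact Continuous.div (by fun_prop) (by fun_prop)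
      fun z => discMobius_denom_ne_zero h (Circle.norm_coe z).le
  continuous_invFun := by
    refine Continuous.subtype_mk ?_ _
    exact Continuous.div (by fun_prop) (by fun_prop)
      fun z => discMobius_denom_ne_zero (by simpa using h) (Circle.norm_coe z).le

theorem isMobiusWith_mobiusCircle (a b : ℂ) (h : ‖b‖ < ‖a‖) :
    IsMobiusWith a b (mobiusCircle a b h) := ⟨h, fun _ => rfl⟩

namespace IsMobiusWith

variable {a b c d : ℂ} {f g : Circle ≃ₜ Circle}

theorem one : IsMobiusWith 1 0 1 := ⟨by simp, fun z => by simp [discMobius]⟩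

theorem mul (hf : IsMobiusWith a b f) (hg : IsMobiusWith c d g) :
    IsMobiusWith (a * c + b * conj d) (a * d + b * conj c) (f * g) :=
  ⟨mobius_mul_norm_lt hf.1 hg.1, fun z => by
    rw [discMobius_comp hf.1 hg.1 (Circle.norm_coe z).le, Homeomorph.mul_apply, hf.2, hg.2]⟩

theorem inv (hf : IsMobiusWith a b f) : IsMobiusWith (conj a) (-b) f⁻¹ := by
  refine ⟨by simpa using hf.1, fun z => ?_⟩
  obtain ⟨y, rfl⟩ := f.surjective z
  rw [hf.2, discMobius_symm hf.1 (Circle.norm_coe y).le]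
  simp

theorem norm_denom (hf : IsMobiusWith a b f) (z : Circle) :
    ‖conj b * (z : ℂ) + conj a‖ = ‖a * z + b‖ := by
  have h := Circle.norm_coe (f z)
  have hd := discMobius_denom_ne_zero hf.1 (Circle.norm_coe z).le
  rw [hf.2, discMobius, norm_div, div_eq_one_iff_eq (norm_ne_zero_iff.2 hd)] at h
  exact h.symm

theorem sub_apply (hf : IsMobiusWith a b f) (x y : Circle) :
    (f x : ℂ) - f y = (Complex.normSq a - Complex.normSq b) * (x - y) /
      ((conj b * x + conj a) * (conj b * y + conj a)) := by
  have hx := discMobius_denom_ne_zero hf.1 (Circle.norm_coe x).le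
  have hy := discMobius_denom_ne_zero hf.1 (Circle.norm_coe y).le
  rw [hf.2, hf.2, discMobius, discMobius, ← Complex.mul_conj, ← Complex.mul_conj,
    div_sub_div _ _ hx hy]
  congr 1
  ring

end IsMobiusWith

/-- `w` is the image of the centre of the disc under the disc automorphism extending `g`. -/
def IsCenter (g : Circle ≃ₜ Circle) (w : ℂ) : Prop :=
  ∃ a b : ℂ, IsMobiusWith a b g ∧ w = discMobius a b 0

theorem discMobius_zero (a b : ℂ) : discMobius a b 0 = b / conj a := by simp [discMobius]

theorem IsCenter.norm_lt_one {g : Circle ≃ₜ Circle} {w : ℂ} (h : IsCenter g w) : ‖w‖ < 1 := by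
  obtain ⟨a, b, hg, rfl⟩ := h
  rw [discMobius_zero, norm_div, Complex.norm_conj, div_lt_one ((norm_nonneg b).trans_lt hg.1)]
  exact hg.1

theorem one_sub_norm_center_sq {a b : ℂ} (h : ‖b‖ < ‖a‖) :
    1 - ‖b / conj a‖ ^ 2 = (Complex.normSq a - Complex.normSq b) / ‖a‖ ^ 2 := by
  have : ‖a‖ ≠ 0 := ((norm_nonneg b).trans_lt h).ne'
  rw [norm_div, Complex.norm_conj, Complex.normSq_eq_norm_sq, Complex.normSq_eq_norm_sq]
  field_simp

/-- Here w' is the preimage of the centre of the disc. The product formula is the source of all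
contraction estimates: when |w| is close to 1, either g z is close to w or z is close to w'. -/
theorem IsCenter.exists_inv {g : Circle ≃ₜ Circle} {w : ℂ} (h : IsCenter g w) :
    ∃ w', IsCenter g⁻¹ w' ∧ ‖w'‖ = ‖w‖ ∧
      (∀ z : Circle, ‖(g z : ℂ) - w‖ * ‖(z : ℂ) - w'‖ = 1 - ‖w‖ ^ 2) := by
  obtain ⟨a, b, hg, rfl⟩ := h
  refine ⟨_, ⟨_, _, hg.inv, rfl⟩, ?_, fun z => ?_⟩
  · simp [discMobius_zero]
  · have ha := ne_zero_of_norm_lt hg.1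
    have ha' : conj a ≠ 0 := by simpa using ha
    have hd := discMobius_denom_ne_zero hg.1 (Circle.norm_coe z).le
    rw [discMobius_zero, discMobius_zero, one_sub_norm_center_sq hg.1, Complex.conj_conj]
    have e1 : (g z : ℂ) - b / conj a =
        ((Complex.normSq a - Complex.normSq b : ℝ) : ℂ) * z /
          (conj a * (conj b * z + conj a)) := by
      rw [Complex.ofReal_sub, ← Complex.mul_conj, ← Complex.mul_conj, hg.2, discMobius,
        div_sub_div _ _ hd ha']
      congr 1 <;> ring
    have e2 : (z : ℂ) - -b / a = (a * z + b) / a := by field_simp; ring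
    have hd' : ‖a * (z : ℂ) + b‖ ≠ 0 := by
      rw [← hg.norm_denom]; exact norm_ne_zero_iff.2 hd
    have hn : ‖((Complex.normSq a - Complex.normSq b : ℝ) : ℂ)‖ =
        Complex.normSq a - Complex.normSq b := by
      rw [Complex.norm_real, Real.norm_eq_abs, abs_of_pos]
      exact sub_pos.2 (norm_lt_norm_iff_normSq.1 hg.1)
    rw [e1, e2, norm_div, norm_div, norm_mul, norm_mul, hn, Circle.norm_coe, Complex.norm_conj,
      hg.norm_denom]
    have : ‖a‖ ≠ 0 := norm_ne_zero_iff.2 ha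
    field_simp

/-- In the chord formula `IsMobiusWith.sub_apply` both denominators are at most 2|a|, and (|a|² −
|b|²)/|a|² equals 1 − |w|². Thus a map whose centre stays away from the circle cannot contract
strongly. -/
theorem IsCenter.mul_dist_le {g : Circle ≃ₜ Circle} {w : ℂ} (h : IsCenter g w) (x y : Circle) :
    (1 - ‖w‖ ^ 2) / 4 * dist x y ≤ dist (g x) (g y) := by
  obtain ⟨a, b, hg, rfl⟩ := h
  have ha : 0 < ‖a‖ := (norm_nonneg b).trans_lt hg.1
  have key : ∀ z : Circle, ‖conj b * (z : ℂ) + conj a‖ ≤ 2 * ‖a‖ := fun z => by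
    calc _ ≤ ‖conj b * (z : ℂ)‖ + ‖conj a‖ := norm_add_le _ _
      _ = ‖b‖ + ‖a‖ := by rw [norm_mul, Complex.norm_conj, Complex.norm_conj, Circle.norm_coe,
        mul_one]
      _ ≤ _ := by linarith [hg.1]
  have kpos : ∀ z : Circle, 0 < ‖conj b * (z : ℂ) + conj a‖ := fun z =>
    norm_pos_iff.2 (discMobius_denom_ne_zero hg.1 (Circle.norm_coe z).le)
  have hn : ‖((Complex.normSq a : ℂ) - Complex.normSq b)‖ =
      Complex.normSq a - Complex.normSq b := by
    rw [← Complex.ofReal_sub, Complex.norm_real, Real.norm_eq_abs, abs_of_pos]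
    exact sub_pos.2 (norm_lt_norm_iff_normSq.1 hg.1)
  have hD : 0 < Complex.normSq a - Complex.normSq b :=
    sub_pos.2 (norm_lt_norm_iff_normSq.1 hg.1)
  rw [discMobius_zero, one_sub_norm_center_sq hg.1, Circle.dist_eq_norm_sub,
    Circle.dist_eq_norm_sub, hg.sub_apply x y, norm_div, norm_mul, norm_mul, hn]
  rw [le_div_iff₀ (mul_pos (kpos x) (kpos y))]
  have h2 : ‖conj b * (x : ℂ) + conj a‖ * ‖conj b * (y : ℂ) + conj a‖ ≤
      (2 * ‖a‖) * (2 * ‖a‖) := mul_le_mul (key x) (key y) (norm_nonneg _) (by positivity)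
  calc _ ≤ (Complex.normSq a - Complex.normSq b) / ‖a‖ ^ 2 / 4 * ‖(x : ℂ) - y‖ *
        ((2 * ‖a‖) * (2 * ‖a‖)) := mul_le_mul_of_nonneg_left h2 (by positivity)
    _ = _ := by field_simp; ring

/-- Moebius maps form a subgroup of the homeomorphisms of the circle. -/
def mobiusSubgroup : Subgroup (Circle ≃ₜ Circle) where
  carrier := {f | IsMobius f}
  mul_mem' := fun ⟨_, _, hf⟩ ⟨_, _, hg⟩ => ⟨_, _, hf.mul hg⟩
  one_mem' := ⟨1, 0, IsMobiusWith.one⟩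
  inv_mem' := fun ⟨_, _, hf⟩ => ⟨_, _, hf.inv⟩

theorem IsMobius.exists_isCenter {f : Circle ≃ₜ Circle} (h : IsMobius f) : ∃ w, IsCenter f w :=
  let ⟨a, b, hf⟩ := h
  ⟨_, a, b, hf, rfl⟩

/-- `F` is a continuous increasing lift of `f` to the line. -/
structure IsCircleLift (f : Circle ≃ₜ Circle) (F : ℝ → ℝ) : Prop where
  continuous : Continuous F
  strictMono : StrictMono F
  add_two_pi : ∀ x, F (x + 2 * Real.pi) = F x + 2 * Real.pi
  exp_apply : ∀ x, f (Circle.exp x) = Circle.exp (F x)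

/-- On the circle the map is z · (ū/u) · (a/ā) with u = 1 + (b̄/ā)z. As |b/a| < 1, u stays in the
right half plane, where the principal argument is continuous. -/
theorem IsMobiusWith.exists_lift {a b : ℂ} {f : Circle ≃ₜ Circle} (hf : IsMobiusWith a b f) :
    ∃ F, IsCircleLift f F := by
  have ha := ne_zero_of_norm_lt hf.1
  have ha' : conj a ≠ 0 := by simpa using ha
  have hn : ∀ x : ℝ, ‖(conj b / conj a) * Complex.exp (x * Complex.I)‖ < 1 := fun x => by
    rw [norm_mul, norm_div, Complex.norm_conj, Complex.norm_conj, Complex.norm_exp_ofReal_mul_I,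
      mul_one, div_lt_one (norm_pos_iff.2 ha)]
    exact hf.1
  have hs : ∀ x : ℝ, 1 + (conj b / conj a) * Complex.exp (x * Complex.I) ∈ Complex.slitPlane :=
    fun x => Complex.mem_slitPlane_of_norm_lt_one (hn x)
  have hw : ∀ w : ℂ, w ≠ 0 → conj w / w = Complex.exp (((-2 * w.arg : ℝ) : ℂ) * Complex.I) := by
    intro w hw
    have h1 := Complex.norm_mul_exp_arg_mul_I w
    rw [div_eq_iff hw]
    have h2 : conj w = ‖w‖ * Complex.exp (-(w.arg * Complex.I)) := by
      conv_lhs => rw [← h1]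
      rw [map_mul, Complex.conj_ofReal, ← Complex.exp_conj, map_mul, Complex.conj_ofReal,
        Complex.conj_I, mul_neg]
    rw [h2]
    generalize w.arg = θ, ‖w‖ = r at h1 ⊢
    rw [← h1]
    rw [mul_left_comm, ← Complex.exp_add]
    congr 2
    push_cast
    ring
  -- The factors −2 come from w̄/w = exp(−2i arg w), applied to u and to ā.
  let F : ℝ → ℝ := fun x => x - 2 * Complex.arg (1 + (conj b / conj a) *
    Complex.exp (x * Complex.I)) + (- 2 * Complex.arg (conj a))
  have hc : Continuous F := by
    have : Continuous fun x : ℝ => Complex.arg (1 + (conj b / conj a) *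
        Complex.exp (x * Complex.I)) := by
      rw [continuous_iff_continuousAt]
      intro x
      exact ContinuousAt.comp (f := fun x : ℝ => 1 + (conj b / conj a) *
        Complex.exp (x * Complex.I)) (Complex.continuousAt_arg (hs x)) (by fun_prop)
    fun_prop
  have hp : ∀ x, F (x + 2 * Real.pi) = F x + 2 * Real.pi := fun x => by
    have : Complex.exp (((x + 2 * Real.pi : ℝ) : ℂ) * Complex.I) =
        Complex.exp (x * Complex.I) := by
      rw [← Circle.coe_exp, ← Circle.coe_exp, Circle.exp_add_two_pi]
    simp only [F]
    rw [this]
    ring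
  have he : ∀ x, f (Circle.exp x) = Circle.exp (F x) := fun x => by
    apply Circle.ext
    rw [hf.2, Circle.coe_exp, Circle.coe_exp]
    set z := Complex.exp (x * Complex.I) with hz
    have hzz : z * conj z = 1 := by
      rw [Complex.mul_conj, Complex.normSq_eq_norm_sq, hz, Complex.norm_exp_ofReal_mul_I]; simp
    have hu := Complex.slitPlane_ne_zero (hs x)
    rw [← hz] at hu
    have e1 : discMobius a b z = z * (conj (1 + conj b / conj a * z) / (1 + conj b / conj a * z)) *
        (conj (conj a) / conj a) := by
      have hne : conj a + conj b * z ≠ 0 := by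
        have : conj a + conj b * z = conj a * (1 + conj b / conj a * z) := by field_simp
        rw [this]; exact mul_ne_zero ha' hu
      simp only [discMobius, map_add, map_mul, map_div₀, Complex.conj_conj, map_one]
      have e3 : conj b * z + conj a = conj a * (1 + conj b / conj a * z) := by field_simp; ring
      have e4 : a * z + b = z * (1 + b / a * conj z) * a := by
        field_simp
        linear_combination (-b) * hzz
      rw [e3, e4]
      field_simp
    rw [e1, hw _ hu, hw _ ha', hz, ← Complex.exp_add, ← Complex.exp_add]
    congr 1
    simp only [F]
    push_cast
    ring
  have hi : Function.Injective F := by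
    intro x y hxy
    have : f (Circle.exp x) = f (Circle.exp y) := by rw [he, he, hxy]
    obtain ⟨m, rfl⟩ := Circle.exp_eq_exp.1 (f.injective this)
    have hper : Function.Periodic (fun x => F x - x) (2 * Real.pi) := fun x => by
      simp only [hp]; ring
    have := hper.int_mul m y
    have hxy' : F (y + m * (2 * Real.pi)) = F y := hxy
    linarith
  refine ⟨F, hc, ?_, hp, he⟩
  -- A continuous injective function is monotone, and a decreasing one cannot gain 2π over a period.
  rcases hc.strictMono_of_inj hi with h | h
  · exact h
  · have h1 := h (show (0 : ℝ) < 0 + 2 * Real.pi by positivity)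
    rw [hp] at h1
    linarith [Real.pi_pos]

/-! ### Limit sets and contraction -/

section LimitSet

variable {Γ : Subgroup (Circle ≃ₜ Circle)} {ξ : Circle}

/-- The orbit lies in the open disc, so a point of the circle is never itself in the orbit and
accumulation is the same as adherence. -/
theorem mem_limitSet_iff : ξ ∈ limitSet Γ ↔ (ξ : ℂ) ∈ closure (discOrbit Γ) := by
  have h : discOrbit Γ \ {(ξ : ℂ)} = discOrbit Γ := by
    refine Set.sdiff_singleton_eq_self ?_
    rintro ⟨g, -, a, b, hg, hw⟩
    have := IsCenter.norm_lt_one ⟨a, b, hg, hw⟩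
    rw [Circle.norm_coe] at this
    exact lt_irrefl _ this
  rw [limitSet, Set.mem_ofPred_eq, accPt_principal_iff_clusterPt, h, mem_closure_iff_clusterPt]

theorem isClosed_limitSet : IsClosed (limitSet Γ) := by
  have : limitSet Γ = (fun z : Circle => (z : ℂ)) ⁻¹' closure (discOrbit Γ) :=
    Set.ext fun _ => mem_limitSet_iff
  rw [this]
  exact isClosed_closure.preimage continuous_subtype_val

theorem apply_mem_limitSet (hΓ : Γ ≤ mobiusSubgroup) {g : Circle ≃ₜ Circle} (hg : g ∈ Γ)
    (hξ : ξ ∈ limitSet Γ) : g ξ ∈ limitSet Γ := by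
  rw [mem_limitSet_iff] at *
  obtain ⟨a, b, hab⟩ := hΓ hg
  rw [hab.2]
  refine ContinuousWithinAt.mem_closure (f := discMobius a b) (s := discOrbit Γ) ?_ hξ ?_
  · refine ContinuousAt.continuousWithinAt ?_
    exact ContinuousAt.div (by fun_prop) (by fun_prop)
      (discMobius_denom_ne_zero hab.1 (Circle.norm_coe ξ).le)
  · rintro _ ⟨h, hh, c, d, hcd, rfl⟩
    exact ⟨g * h, Γ.mul_mem hg hh, _, _, hab.mul hcd,
      (discMobius_comp hab.1 hcd.1 (by simp)).symm⟩

theorem apply_mem_limitSet_iff (hΓ : Γ ≤ mobiusSubgroup) {g : Circle ≃ₜ Circle} (hg : g ∈ Γ) :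
    g ξ ∈ limitSet Γ ↔ ξ ∈ limitSet Γ := by
  refine ⟨fun h => ?_, apply_mem_limitSet hΓ hg⟩
  have := apply_mem_limitSet hΓ (Γ.inv_mem hg) h
  simpa using this

theorem exists_contracting_of_mem_limitSet (hξ : ξ ∈ limitSet Γ) {ε δ : ℝ} (hε : 0 < ε)
    (hδ : 0 < δ) :
    ∃ g ∈ Γ, ∃ w' : ℂ, ∀ z : Circle, δ ≤ ‖(z : ℂ) - w'‖ → dist (g z) ξ < ε := by
  rw [mem_limitSet_iff, Metric.mem_closure_iff] at hξ
  -- Since 1 − |w|² ≤ 2(1 − |w|) ≤ 2|ξ − w|, the bound εδ/4 gives |g z − w| < ε/2 by the product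
  -- formula; the bound ε/2 pays for the passage from w to ξ.
  obtain ⟨w, ⟨g, hg, a, b, hab, hw⟩, hd⟩ := hξ (min (ε / 2) (ε * δ / 4))
    (lt_min (by positivity) (by positivity))
  have hc : IsCenter g w := ⟨a, b, hab, hw⟩
  obtain ⟨w', -, -, hz⟩ := hc.exists_inv
  refine ⟨g, hg, w', fun z h => ?_⟩
  rw [dist_eq_norm] at hd
  have h1 : 1 ≤ ‖w‖ + ‖(ξ : ℂ) - w‖ := by
    have := norm_add_le w ((ξ : ℂ) - w)
    rwa [add_sub_cancel, Circle.norm_coe] at this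
  have h2 := hc.norm_lt_one
  have h3 : 1 - ‖w‖ ^ 2 ≤ 2 * (1 - ‖w‖) := by nlinarith [norm_nonneg w]
  have h4 : ‖(g z : ℂ) - w‖ * δ ≤ 1 - ‖w‖ ^ 2 :=
    (mul_le_mul_of_nonneg_left h (norm_nonneg _)).trans_eq (hz z)
  have h5 : ‖(g z : ℂ) - w‖ < ε / 2 := by
    have := hd.trans_le (min_le_right _ _)
    by_contra! hcon
    nlinarith
  have h6 := hd.trans_le (min_le_left _ _)
  rw [Circle.dist_eq_norm_sub]
  calc ‖(g z : ℂ) - ξ‖ = ‖((g z : ℂ) - w) - (ξ - w)‖ := by congr 1; ring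
    _ ≤ _ := norm_sub_le _ _
    _ < ε := by linarith

/-- The contraction fails only near one point w'. Of two distinct points at least one is therefore
always contracted. -/
theorem half_dist_le_or (x y : Circle) (w : ℂ) :
    dist x y / 2 ≤ ‖(x : ℂ) - w‖ ∨ dist x y / 2 ≤ ‖(y : ℂ) - w‖ := by
  by_contra! h
  have := norm_sub_le ((x : ℂ) - w) (y - w)
  rw [sub_sub_sub_cancel_right, ← Circle.dist_eq_norm_sub] at this
  linarith

theorem exists_dist_lt_or_of_mem_limitSet (hξ : ξ ∈ limitSet Γ) {x y : Circle} (hxy : x ≠ y)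
    {ε : ℝ} (hε : 0 < ε) : ∃ g ∈ Γ, dist (g x) ξ < ε ∨ dist (g y) ξ < ε := by
  obtain ⟨g, hg, w', h⟩ := exists_contracting_of_mem_limitSet hξ hε
    (half_pos (dist_pos.2 hxy))
  exact ⟨g, hg, (half_dist_le_or x y w').imp (h x) (h y)⟩

theorem limitSet_subset_of_isClosed {K : Set Circle} (hK : IsClosed K) (hn : K.Nontrivial)
    (hinv : ∀ g ∈ Γ, ∀ x ∈ K, g x ∈ K) : limitSet Γ ⊆ K := by
  intro ξ hξ
  obtain ⟨x, hx, y, hy, hxy⟩ := hn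
  rw [← hK.closure_eq, Metric.mem_closure_iff]
  intro ε hε
  obtain ⟨g, hg, h | h⟩ := exists_dist_lt_or_of_mem_limitSet hξ hxy hε
  · exact ⟨_, hinv g hg x hx, by rwa [dist_comm]⟩
  · exact ⟨_, hinv g hg y hy, by rwa [dist_comm]⟩

/-- An interior point would attract a translate of one of two points outside Λ, and that translate
would lie in Λ. -/
theorem interior_limitSet_eq_empty (hΓ : Γ ≤ mobiusSubgroup) (h : (limitSet Γ)ᶜ.Nontrivial) :
    interior (limitSet Γ) = ∅ := by
  by_contra hne
  obtain ⟨ξ, hξ⟩ := Set.nonempty_iff_ne_empty.2 hne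
  obtain ⟨ε, hε, hb⟩ := Metric.mem_nhds_iff.1 (mem_interior_iff_mem_nhds.1 hξ)
  obtain ⟨x, hx, y, hy, hxy⟩ := h
  obtain ⟨g, hg, h | h⟩ :=
    exists_dist_lt_or_of_mem_limitSet (interior_subset hξ) hxy hε
  · exact hx ((apply_mem_limitSet_iff hΓ hg).1 (hb h))
  · exact hy ((apply_mem_limitSet_iff hΓ hg).1 (hb h))

theorem perfect_limitSet (hΓ : Γ ≤ mobiusSubgroup) {x y z : Circle} (hx : x ∈ limitSet Γ)
    (hy : y ∈ limitSet Γ) (hz : z ∈ limitSet Γ) (hxy : x ≠ y) (hxz : x ≠ z) (hyz : y ≠ z) :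
    Perfect (limitSet Γ) := by
  refine ⟨isClosed_limitSet, fun ξ hξ => ?_⟩
  rw [accPt_iff_nhds]
  intro V hV
  obtain ⟨ε, hε, hb⟩ := Metric.mem_nhds_iff.1 hV
  have hp : 0 < min (dist x y / 2) (min (dist x z / 2) (dist y z / 2)) :=
    lt_min (half_pos (dist_pos.2 hxy))
      (lt_min (half_pos (dist_pos.2 hxz)) (half_pos (dist_pos.2 hyz)))
  obtain ⟨g, hg, w', h⟩ := exists_contracting_of_mem_limitSet hξ hε hp
  -- Among three limit points at least two avoid the exceptional disc. Their images are distinct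
  -- limit points near ξ, so one of them differs from ξ.
  have key : ∀ u v : Circle, u ∈ limitSet Γ → v ∈ limitSet Γ → u ≠ v → dist (g u) ξ < ε →
      dist (g v) ξ < ε → ∃ y ∈ V ∩ limitSet Γ, y ≠ ξ := by
    intro u v hu hv huv h1 h2
    by_cases hc : g u = ξ
    · exact ⟨g v, ⟨hb h2, apply_mem_limitSet hΓ hg hv⟩, fun h => huv (g.injective (hc.trans h.symm))⟩
    · exact ⟨g u, ⟨hb h1, apply_mem_limitSet hΓ hg hu⟩, hc⟩
  have d1 := (half_dist_le_or x y w').imp (fun H => h x ((min_le_left _ _).trans H))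
    (fun H => h y ((min_le_left _ _).trans H))
  have m2 := (min_le_right (dist x y / 2) (min (dist x z / 2) (dist y z / 2)))
  have d2 := (half_dist_le_or x z w').imp
    (fun H => h x ((m2.trans (min_le_left _ _)).trans H))
    (fun H => h z ((m2.trans (min_le_left _ _)).trans H))
  have d3 := (half_dist_le_or y z w').imp
    (fun H => h y ((m2.trans (min_le_right _ _)).trans H))
    (fun H => h z ((m2.trans (min_le_right _ _)).trans H))
  rcases d1 with d1 | d1
  · rcases d3 with d3 | d3
    · exact key x y hx hy hxy d1 d3
    · exact key x z hx hz hxz d1 d3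
  · rcases d2 with d2 | d2
    · exact key x y hx hy hxy d2 d1
    · exact key y z hy hz hyz d1 d2

/-- If all centres stayed away from the circle, the maps would contract distances at most by a
uniform factor. The points g_n u and g_m u, being images under g_n of u and of g_n⁻¹ g_m u, would
then be uniformly separated, which compactness of the circle forbids. -/
theorem exists_center_near_boundary {g : ℕ → Circle ≃ₜ Circle} {w : ℕ → ℂ}
    (hw : ∀ n, IsCenter (g n) (w n)) {u : Circle} {δ : ℝ} (hδ : 0 < δ)
    (h : ∀ n m, n < m → δ ≤ dist u ((g n)⁻¹ (g m u))) {ε : ℝ} (hε : 0 < ε) :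
    ∃ n, 1 - ‖w n‖ ^ 2 < ε := by
  by_contra! hcon
  have hsep : ∀ n m, n < m → ε / 4 * δ ≤ dist (g n u) (g m u) := fun n m hnm => by
    have h1 := (hw n).mul_dist_le u ((g n)⁻¹ (g m u))
    have h2 : g n ((g n)⁻¹ (g m u)) = g m u := by simp
    rw [h2] at h1
    refine le_trans ?_ h1
    have := hcon n
    exact mul_le_mul (by linarith) (h n m hnm) hδ.le (by linarith)
  obtain ⟨a, φ, hφ, ha⟩ := CompactSpace.tendsto_subseq fun n => g n u
  obtain ⟨N, hN⟩ := Filter.eventually_atTop.1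
    (ha.eventually (Metric.ball_mem_nhds a (show 0 < ε / 4 * δ / 2 by positivity)))
  have h1 : dist (g (φ N) u) a < ε / 4 * δ / 2 := hN N le_rfl
  have h2 : dist (g (φ (N + 1)) u) a < ε / 4 * δ / 2 := hN (N + 1) (Nat.le_succ N)
  have h3 := hsep _ _ (hφ (Nat.lt_succ_self N))
  have h4 := dist_triangle_right (g (φ N) u) (g (φ (N + 1)) u) a
  linarith

/-- The norm attains its maximum on the compact closure of the orbit, and this maximum is 1 because
orbit points come arbitrarily close to the circle. -/
theorem limitSet_nonempty {w : ℕ → ℂ} (hw : ∀ n, w n ∈ discOrbit Γ)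
    (h : ∀ ε > 0, ∃ n, 1 - ‖w n‖ ^ 2 < ε) : (limitSet Γ).Nonempty := by
  have hle : ∀ z ∈ discOrbit Γ, ‖z‖ ≤ 1 := by
    rintro z ⟨g, -, hg⟩
    exact (IsCenter.norm_lt_one hg).le
  have hcl : ∀ z ∈ closure (discOrbit Γ), ‖z‖ ≤ 1 :=
    fun z hz => closure_minimal (s := discOrbit Γ) (t := {z | ‖z‖ ≤ 1}) hle
      (isClosed_le continuous_norm continuous_const) hz
  have hcomp : IsCompact (closure (discOrbit Γ)) :=
    Metric.isCompact_of_isClosed_isBounded isClosed_closure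
      ((Metric.isBounded_closedBall (x := (0 : ℂ)) (r := 1)).subset fun z hz => by
        simpa using hcl z hz)
  obtain ⟨z, hz, hmax⟩ := hcomp.exists_isMaxOn ⟨w 0, subset_closure (hw 0)⟩
    continuous_norm.continuousOn
  have h1 : ‖z‖ = 1 := by
    refine le_antisymm (hcl z hz) (le_of_not_gt fun hlt => ?_)
    obtain ⟨n, hn⟩ := h (1 - ‖z‖ ^ 2) (by nlinarith [norm_nonneg z])
    have : ‖w n‖ ≤ ‖z‖ := hmax (subset_closure (hw n))
    nlinarith [norm_nonneg (w n)]
  exact ⟨⟨z, mem_sphere_zero_iff_norm.2 h1⟩, mem_limitSet_iff.2 hz⟩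

end LimitSet

/-! ### Ping-pong for the two generators -/

section PingPong

variable {f₁ f₂ : Circle ≃ₜ Circle}

/-- The four letters `f₁, f₁⁻¹, f₂, f₂⁻¹`: the first index selects the generator, the second the
sign of the exponent. -/
def freeLetter (f₁ f₂ : Circle ≃ₜ Circle) : Bool × Bool → (Circle ≃ₜ Circle)
  | (true, true) => f₁
  | (true, false) => f₁⁻¹
  | (false, true) => f₂
  | (false, false) => f₂⁻¹

/-- The index of the inverse letter. -/
def flipLetter (s : Bool × Bool) : Bool × Bool := (s.1, !s.2)

@[simp] theorem flipLetter_flipLetter (s : Bool × Bool) : flipLetter (flipLetter s) = s := by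
  rcases s with ⟨_ | _, _ | _⟩ <;> rfl

theorem freeLetter_flipLetter (s : Bool × Bool) :
    freeLetter f₁ f₂ (flipLetter s) = (freeLetter f₁ f₂ s)⁻¹ := by
  rcases s with ⟨_ | _, _ | _⟩ <;> simp [flipLetter, freeLetter]

theorem freeLetter_mem (s : Bool × Bool) :
    freeLetter f₁ f₂ s ∈ Subgroup.closure {f₁, f₂} := by
  have h1 : f₁ ∈ Subgroup.closure {f₁, f₂} := Subgroup.subset_closure (by simp)
  have h2 : f₂ ∈ Subgroup.closure {f₁, f₂} := Subgroup.subset_closure (by simp)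
  rcases s with ⟨_ | _, _ | _⟩
  · exact inv_mem h2
  · exact h2
  · exact inv_mem h1
  · exact h1

/-- `g` is represented by a nonempty reduced word with first letter `s`. -/
inductive IsReducedWord (f₁ f₂ : Circle ≃ₜ Circle) : Bool × Bool → (Circle ≃ₜ Circle) → Prop
  | letter (s : Bool × Bool) : IsReducedWord f₁ f₂ s (freeLetter f₁ f₂ s)
  | mul (s t : Bool × Bool) (g : Circle ≃ₜ Circle) (hg : IsReducedWord f₁ f₂ t g)
      (hst : t ≠ flipLetter s) : IsReducedWord f₁ f₂ s (freeLetter f₁ f₂ s * g)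

theorem IsReducedWord.letter_mul (s : Bool × Bool) {g : Circle ≃ₜ Circle}
    (hg : g = 1 ∨ ∃ t, IsReducedWord f₁ f₂ t g) :
    freeLetter f₁ f₂ s * g = 1 ∨ ∃ t, IsReducedWord f₁ f₂ t (freeLetter f₁ f₂ s * g) := by
  rcases hg with rfl | ⟨t, ht⟩
  · exact Or.inr ⟨s, by simpa using IsReducedWord.letter s⟩
  · by_cases hst : t = flipLetter s
    · subst hst
      cases ht with
      | letter => exact Or.inl (by rw [freeLetter_flipLetter, mul_inv_cancel])
      | mul _ t' g' hg' _ =>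
        exact Or.inr ⟨t', by rwa [freeLetter_flipLetter, mul_inv_cancel_left]⟩
    · exact Or.inr ⟨s, .mul s t g ht hst⟩

theorem eq_one_or_isReducedWord {g : Circle ≃ₜ Circle} (hg : g ∈ Subgroup.closure {f₁, f₂}) :
    g = 1 ∨ ∃ t, IsReducedWord f₁ f₂ t g := by
  induction hg using Subgroup.closure_induction_left with
  | one => exact Or.inl rfl
  | mul_left x hx y _ ih =>
    rcases hx with rfl | rfl
    · exact IsReducedWord.letter_mul (true, true) ih
    · exact IsReducedWord.letter_mul (false, true) ih
  | inv_mul_cancel x hx y _ ih =>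
    rcases hx with rfl | rfl
    · exact IsReducedWord.letter_mul (true, false) ih
    · exact IsReducedWord.letter_mul (false, false) ih

/-- Each letter maps the complement of the set of the inverse letter into its own set. -/
structure IsPingPong (f₁ f₂ : Circle ≃ₜ Circle) (X : Bool × Bool → Set Circle) : Prop where
  isClosed : ∀ s, IsClosed (X s)
  notMem : ∀ s t, s ≠ t → ∀ x ∈ X s, x ∉ X t
  maps : ∀ s, ∀ x ∉ X (flipLetter s), freeLetter f₁ f₂ s x ∈ X s
  infinite : (⋃ s, X s)ᶜ.Infinite

namespace IsPingPong

variable {X : Bool × Bool → Set Circle}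

theorem isOpen_compl (h : IsPingPong f₁ f₂ X) : IsOpen (⋃ s, X s)ᶜ :=
  (isClosed_iUnion_of_finite h.isClosed).isOpen_compl

theorem apply_mem_of_isReducedWord (h : IsPingPong f₁ f₂ X) {s : Bool × Bool}
    {g : Circle ≃ₜ Circle} (hg : IsReducedWord f₁ f₂ s g) {u : Circle}
    (hu : u ∈ (⋃ s, X s)ᶜ) : g u ∈ X s := by
  induction hg with
  | letter s => exact h.maps s u fun hh => hu (Set.mem_iUnion_of_mem _ hh)
  | mul s t g _ hst ih => exact h.maps s _ (h.notMem _ _ hst _ ih)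

theorem eq_one_of_apply_notMem (h : IsPingPong f₁ f₂ X) {g : Circle ≃ₜ Circle}
    (hg : g ∈ Subgroup.closure {f₁, f₂}) {u : Circle} (hu : u ∈ (⋃ s, X s)ᶜ)
    (hgu : g u ∈ (⋃ s, X s)ᶜ) : g = 1 := by
  refine (eq_one_or_isReducedWord hg).resolve_right ?_
  rintro ⟨s, hs⟩
  exact hgu (Set.mem_iUnion_of_mem _ (h.apply_mem_of_isReducedWord hs hu))

/-- Outside the four sets lies an open set to which only the identity returns. A limit point ξ there
would attract a translate of one of two points of that open set, closer to ξ than the point itself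
is; so the translating element is not the identity, yet it returns. -/
theorem limitSet_subset (h : IsPingPong f₁ f₂ X) : schottkyLimitSet f₁ f₂ ⊆ ⋃ s, X s := by
  intro ξ hξ
  by_contra hU
  obtain ⟨x, hx, y, hy, hxy⟩ := (h.infinite.sdiff (Set.finite_singleton ξ)).nontrivial
  obtain ⟨ε, hε, hb⟩ := Metric.isOpen_iff.1 h.isOpen_compl ξ hU
  have hx' : 0 < dist x ξ := dist_pos.2 hx.2
  have hy' : 0 < dist y ξ := dist_pos.2 hy.2
  obtain ⟨g, hg, hd | hd⟩ := exists_dist_lt_or_of_mem_limitSet hξ hxy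
    (lt_min hε (lt_min hx' hy'))
  · have := h.eq_one_of_apply_notMem hg hx.1 (hb (hd.trans_le (min_le_left _ _)))
    subst this
    exact absurd (hd.trans_le ((min_le_right _ _).trans (min_le_left _ _))) (lt_irrefl _)
  · have := h.eq_one_of_apply_notMem hg hy.1 (hb (hd.trans_le (min_le_left _ _)))
    subst this
    exact absurd (hd.trans_le ((min_le_right _ _).trans (min_le_right _ _))) (lt_irrefl _)

theorem exists_infDist (h : IsPingPong f₁ f₂ X) :
    ∃ u ∈ (⋃ s, X s)ᶜ, ∃ δ > 0, ∀ y ∈ ⋃ s, X s, δ ≤ dist u y := by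
  obtain ⟨u, hu⟩ := h.infinite.nonempty
  obtain ⟨δ, hδ, hb⟩ := Metric.isOpen_iff.1 h.isOpen_compl u hu
  refine ⟨u, hu, δ, hδ, fun y hy => le_of_not_gt fun hlt => ?_⟩
  exact hb (show y ∈ Metric.ball u δ by rwa [Metric.mem_ball, dist_comm]) hy

theorem closure_le (h₁ : IsMobius f₁) (h₂ : IsMobius f₂) :
    Subgroup.closure {f₁, f₂} ≤ mobiusSubgroup := by
  rw [Subgroup.closure_le]
  rintro _ (rfl | rfl)
  · exact h₁
  · exact h₂

/-- The positive powers of `f₁` send a base point into a set at positive distance from it, which is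
the separation needed in `exists_center_near_boundary`. -/
theorem nonempty_limitSet (h : IsPingPong f₁ f₂ X) (h₁ : IsMobius f₁) :
    (schottkyLimitSet f₁ f₂).Nonempty := by
  obtain ⟨u, hu, δ, hδ, hd⟩ := h.exists_infDist
  have hf : f₁ ∈ Subgroup.closure {f₁, f₂} := Subgroup.subset_closure (by simp)
  have hpow : ∀ k : ℕ, (f₁ ^ (k + 1)) u ∈ X (true, true) := by
    intro k
    induction k with
    | zero => simpa [freeLetter] using h.maps (true, true) u fun hh => hu (Set.mem_iUnion_of_mem _ hh)
    | succ k ih =>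
      rw [pow_succ', Homeomorph.mul_apply]
      exact h.maps (true, true) _ (h.notMem _ _ (by decide) _ ih)
  have hc : ∀ n : ℕ, ∃ w, IsCenter (f₁ ^ n) w := fun n =>
    IsMobius.exists_isCenter (mobiusSubgroup.pow_mem h₁ n)
  choose w hw using hc
  refine limitSet_nonempty (w := w) (fun n => ⟨f₁ ^ n, pow_mem hf n, hw n⟩) fun ε hε => ?_
  refine exists_center_near_boundary (u := u) hw hδ (fun n m hnm => ?_) hε
  obtain ⟨k, rfl⟩ := Nat.exists_eq_add_of_lt hnm
  have : (f₁ ^ n)⁻¹ ((f₁ ^ (n + k + 1)) u) = (f₁ ^ (k + 1)) u := by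
    rw [← Homeomorph.mul_apply, add_assoc, pow_add, inv_mul_cancel_left]
  rw [this]
  exact hd _ (Set.mem_iUnion_of_mem _ (hpow k))

theorem exists_mem_limitSet (h : IsPingPong f₁ f₂ X) (h₁ : IsMobius f₁) (h₂ : IsMobius f₂) :
    ∀ s, ∃ x ∈ X s, x ∈ schottkyLimitSet f₁ f₂ := by
  have hΓ := closure_le h₁ h₂
  have step : ∀ s t, t ≠ flipLetter s → (∃ x ∈ X t, x ∈ schottkyLimitSet f₁ f₂) →
      ∃ x ∈ X s, x ∈ schottkyLimitSet f₁ f₂ := fun s t hst ⟨x, hx, hxL⟩ =>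
    ⟨_, h.maps s x (h.notMem _ _ hst _ hx), apply_mem_limitSet hΓ (freeLetter_mem s) hxL⟩
  obtain ⟨ξ, hξ⟩ := h.nonempty_limitSet h₁
  obtain ⟨t, ht⟩ := Set.mem_iUnion.1 (h.limitSet_subset hξ)
  intro s
  have ht' : ∃ x ∈ X t, x ∈ schottkyLimitSet f₁ f₂ := ⟨ξ, ht, hξ⟩
  by_cases hst : t = flipLetter s
  · have h1 : (!t.1, t.2) ≠ flipLetter s := by
      rw [← hst]; intro hh; simpa using congrArg Prod.fst hh
    refine step s _ h1 (step _ t ?_ ht')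
    intro hh
    simpa [flipLetter] using congrArg Prod.fst hh
  · exact step s t hst ht'

theorem perfect_limitSet (h : IsPingPong f₁ f₂ X) (h₁ : IsMobius f₁) (h₂ : IsMobius f₂) :
    Perfect (schottkyLimitSet f₁ f₂) := by
  obtain ⟨x, hx, hxL⟩ := h.exists_mem_limitSet h₁ h₂ (true, true)
  obtain ⟨y, hy, hyL⟩ := h.exists_mem_limitSet h₁ h₂ (true, false)
  obtain ⟨z, hz, hzL⟩ := h.exists_mem_limitSet h₁ h₂ (false, true)
  refine _root_.perfect_limitSet (closure_le h₁ h₂) hxL hyL hzL ?_ ?_ ?_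
  · rintro rfl; exact h.notMem _ _ (by decide) _ hx hy
  · rintro rfl; exact h.notMem _ _ (by decide) _ hx hz
  · rintro rfl; exact h.notMem _ _ (by decide) _ hy hz

theorem interior_limitSet (h : IsPingPong f₁ f₂ X) (h₁ : IsMobius f₁) (h₂ : IsMobius f₂) :
    interior (schottkyLimitSet f₁ f₂) = ∅ :=
  interior_limitSet_eq_empty (closure_le h₁ h₂)
    (h.infinite.nontrivial.mono (Set.compl_subset_compl.2 h.limitSet_subset))

/-- A closed nonempty set invariant under the group contains the limit set. -/
theorem limitSet_subset_of_invariant (h : IsPingPong f₁ f₂ X) {K : Set Circle}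
    (hK : IsClosed K) (hn : K.Nonempty)
    (hinv : ∀ g ∈ Subgroup.closure {f₁, f₂}, ∀ x ∈ K, g x ∈ K) :
    schottkyLimitSet f₁ f₂ ⊆ K := by
  refine limitSet_subset_of_isClosed hK ?_ hinv
  by_contra hs
  obtain ⟨x, hx⟩ := hn
  -- A one-point invariant set would be fixed by both generators. A fixed point of a letter lies in
  -- the set of that letter or of its inverse, and these pairs are disjoint for the two generators.
  have hfix : ∀ s, freeLetter f₁ f₂ s x = x := fun s =>
    (Set.not_nontrivial_iff.1 hs) (hinv _ (freeLetter_mem s) x hx) hx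
  have hall : ∀ s, x ∈ X s ∨ x ∈ X (flipLetter s) := fun s => by
    by_cases hc : x ∈ X (flipLetter s)
    · exact Or.inr hc
    · exact Or.inl (hfix s ▸ h.maps s x hc)
  rcases hall (true, true) with h1 | h1 <;> rcases hall (false, true) with h2 | h2 <;>
    exact h.notMem _ _ (by decide) _ h1 h2

theorem commutator_ne_one (h : IsPingPong f₁ f₂ X) : f₁ * f₂ * f₁⁻¹ * f₂⁻¹ ≠ 1 := by
  intro hone
  obtain ⟨u, hu⟩ := h.infinite.nonempty
  have h1 := h.maps (false, false) u fun hh => hu (Set.mem_iUnion_of_mem _ hh)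
  have h2 := h.maps (true, false) _ (h.notMem _ _ (by decide) _ h1)
  have h3 := h.maps (false, true) _ (h.notMem _ _ (by decide) _ h2)
  have h4 := h.maps (true, true) _ (h.notMem _ _ (by decide) _ h3)
  have h5 : (f₁ * f₂ * f₁⁻¹ * f₂⁻¹) u ∈ X (true, true) := h4
  rw [hone] at h5
  exact hu (Set.mem_iUnion_of_mem _ h5)

end IsPingPong

/-! ### Itineraries: coding points by reduced words -/

/-- The group element spelled by the first `n` letters of the itinerary of `y`, for a choice `σ` of
a letter at each point. -/
def itineraryWord (f₁ f₂ : Circle ≃ₜ Circle) (σ : Circle → Bool × Bool) :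
    ℕ → Circle → (Circle ≃ₜ Circle)
  | 0, _ => 1
  | n + 1, y => freeLetter f₁ f₂ (σ y) *
      itineraryWord f₁ f₂ σ n ((freeLetter f₁ f₂ (σ y))⁻¹ y)

/-- The point reached after `n` steps of the itinerary of `y`. -/
def itineraryPoint (f₁ f₂ : Circle ≃ₜ Circle) (σ : Circle → Bool × Bool) (n : ℕ) (y : Circle) :
    Circle :=
  (fun y => (freeLetter f₁ f₂ (σ y))⁻¹ y)^[n] y

section Itinerary

variable {σ : Circle → Bool × Bool}

theorem itineraryPoint_succ (n : ℕ) (y : Circle) : itineraryPoint f₁ f₂ σ (n + 1) y =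
    itineraryPoint f₁ f₂ σ n ((freeLetter f₁ f₂ (σ y))⁻¹ y) := by
  rw [itineraryPoint, Function.iterate_succ_apply, itineraryPoint]

theorem itineraryPoint_succ' (n : ℕ) (y : Circle) : itineraryPoint f₁ f₂ σ (n + 1) y =
    (freeLetter f₁ f₂ (σ (itineraryPoint f₁ f₂ σ n y)))⁻¹ (itineraryPoint f₁ f₂ σ n y) := by
  rw [itineraryPoint, Function.iterate_succ_apply']
  rfl

theorem itineraryWord_mem (n : ℕ) (y : Circle) :
    itineraryWord f₁ f₂ σ n y ∈ Subgroup.closure {f₁, f₂} := by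
  induction n generalizing y with
  | zero => exact one_mem _
  | succ n ih => exact mul_mem (freeLetter_mem _) (ih _)

theorem itineraryWord_add (n k : ℕ) (y : Circle) : itineraryWord f₁ f₂ σ (n + k) y =
    itineraryWord f₁ f₂ σ n y * itineraryWord f₁ f₂ σ k (itineraryPoint f₁ f₂ σ n y) := by
  induction n generalizing y with
  | zero => simp [itineraryWord, itineraryPoint]
  | succ n ih =>
    rw [Nat.add_right_comm, itineraryWord, ih, itineraryWord, itineraryPoint_succ, mul_assoc]

theorem itineraryWord_apply_point (n : ℕ) (y : Circle) :
    itineraryWord f₁ f₂ σ n y (itineraryPoint f₁ f₂ σ n y) = y := by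
  induction n generalizing y with
  | zero => simp [itineraryWord, itineraryPoint]
  | succ n ih =>
    rw [itineraryWord, itineraryPoint_succ, Homeomorph.mul_apply, ih]
    simp

theorem itineraryWord_inv_apply (n : ℕ) (y : Circle) :
    (itineraryWord f₁ f₂ σ n y)⁻¹ y = itineraryPoint f₁ f₂ σ n y := by
  rw [Homeomorph.inv_apply, Homeomorph.symm_apply_eq, itineraryWord_apply_point]

variable {X : Bool × Bool → Set Circle} {C : Set Circle}

theorem itineraryPoint_itineraryPoint (m n : ℕ) (y : Circle) :
    itineraryPoint f₁ f₂ σ m (itineraryPoint f₁ f₂ σ n y) = itineraryPoint f₁ f₂ σ (m + n) y :=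
  (Function.iterate_add_apply _ m n y).symm

/-- The itinerary spells a reduced word: after stripping a letter the point lies outside the set of
the inverse letter, whereas the next letter is chosen so that the point lies in its set. -/
theorem letter_ne_flipLetter
    (hσ : ∀ y ∉ C, y ∈ X (σ y) ∧ (freeLetter f₁ f₂ (σ y))⁻¹ y ∉ X (flipLetter (σ y)))
    {y : Circle} (hy : ∀ n, itineraryPoint f₁ f₂ σ n y ∉ C) (n : ℕ) :
    σ (itineraryPoint f₁ f₂ σ (n + 1) y) ≠ flipLetter (σ (itineraryPoint f₁ f₂ σ n y)) := by
  intro hcon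
  have h1 := (hσ _ (hy (n + 1))).1
  rw [hcon] at h1
  have h2 := (hσ _ (hy n)).2
  rw [← itineraryPoint_succ'] at h2
  exact h2 h1

theorem itineraryWord_apply_mem (h : IsPingPong f₁ f₂ X)
    (hσ : ∀ y ∉ C, y ∈ X (σ y) ∧ (freeLetter f₁ f₂ (σ y))⁻¹ y ∉ X (flipLetter (σ y)))
    {y : Circle} (hy : ∀ n, itineraryPoint f₁ f₂ σ n y ∉ C) (n : ℕ) {u : Circle}
    (hu : u ∈ (⋃ s, X s)ᶜ) : itineraryWord f₁ f₂ σ (n + 1) y u ∈ X (σ y) := by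
  induction n generalizing y with
  | zero =>
    simpa [itineraryWord] using h.maps (σ y) u fun hh => hu (Set.mem_iUnion_of_mem _ hh)
  | succ n ih =>
    rw [itineraryWord, Homeomorph.mul_apply]
    have h1 := ih (y := (freeLetter f₁ f₂ (σ y))⁻¹ y) fun n => by
      rw [← itineraryPoint_succ]; exact hy (n + 1)
    exact h.maps _ _ (h.notMem _ _ (letter_ne_flipLetter hσ hy 0) _ h1)

/-- The inverse of the word begins with the inverse of its last letter, and ping-pong places the
image in the corresponding set. -/
theorem itineraryWord_inv_apply_mem (h : IsPingPong f₁ f₂ X)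
    (hσ : ∀ y ∉ C, y ∈ X (σ y) ∧ (freeLetter f₁ f₂ (σ y))⁻¹ y ∉ X (flipLetter (σ y)))
    {y : Circle} (hy : ∀ n, itineraryPoint f₁ f₂ σ n y ∉ C) (n : ℕ) {u : Circle}
    (hu : u ∈ (⋃ s, X s)ᶜ) : (itineraryWord f₁ f₂ σ (n + 1) y)⁻¹ u ∈
      X (flipLetter (σ (itineraryPoint f₁ f₂ σ n y))) := by
  have hw : ∀ n, itineraryWord f₁ f₂ σ (n + 1) y = itineraryWord f₁ f₂ σ n y *
      freeLetter f₁ f₂ (σ (itineraryPoint f₁ f₂ σ n y)) := fun n => by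
    rw [itineraryWord_add n 1]; simp [itineraryWord]
  induction n with
  | zero =>
    rw [hw, mul_inv_rev, Homeomorph.mul_apply, ← freeLetter_flipLetter]
    refine h.maps _ _ fun hh => hu (Set.mem_iUnion_of_mem
      (flipLetter (flipLetter (σ (itineraryPoint f₁ f₂ σ 0 y)))) ?_)
    simpa [itineraryWord] using hh
  | succ n ih =>
    rw [hw, mul_inv_rev, Homeomorph.mul_apply, ← freeLetter_flipLetter]
    refine h.maps _ _ (h.notMem _ _ ?_ _ ih)
    rw [flipLetter_flipLetter]
    exact (letter_ne_flipLetter hσ hy n).symm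

end Itinerary

theorem IsPingPong.exists_pos_le_dist {X : Bool × Bool → Set Circle} (h : IsPingPong f₁ f₂ X) :
    ∃ d > 0, ∀ s t, s ≠ t → ∀ x ∈ X s, ∀ y ∈ X t, d ≤ dist x y := by
  have h1 : ∀ p : (Bool × Bool) × (Bool × Bool), ∃ d > 0, p.1 ≠ p.2 →
      ∀ x ∈ X p.1, ∀ y ∈ X p.2, d ≤ dist x y := fun p => by
    by_cases hp : p.1 = p.2
    · exact ⟨1, one_pos, fun hh => absurd hp hh⟩
    · obtain ⟨r, hr, hd⟩ := Metric.exists_pos_forall_lt_edist (h.isClosed p.1).isCompact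
        (h.isClosed p.2) (Set.disjoint_left.2 (h.notMem _ _ hp))
      refine ⟨r, hr, fun _ x hx y hy => ?_⟩
      have := hd x hx y hy
      rw [edist_nndist, ENNReal.coe_lt_coe] at this
      exact_mod_cast this.le
  choose d hd hdd using h1
  obtain ⟨p, hp⟩ := Finite.exists_min d
  exact ⟨d p, hd p, fun s t hst x hx y hy => (hp (s, t)).trans (hdd (s, t) hst x hx y hy)⟩

/-- If every point outside `C` can be expanded by a letter, then every point outside the limit set
has a group translate in `C`. -/
theorem IsPingPong.exists_apply_mem {X : Bool × Bool → Set Circle} (h : IsPingPong f₁ f₂ X)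
    (h₁ : IsMobius f₁) (h₂ : IsMobius f₂) {C : Set Circle}
    (hC : ∀ y ∉ C, ∃ s, y ∈ X s ∧ (freeLetter f₁ f₂ s)⁻¹ y ∉ X (flipLetter s))
    {x : Circle} (hx : x ∉ schottkyLimitSet f₁ f₂) :
    ∃ g ∈ Subgroup.closure {f₁, f₂}, g x ∈ C := by
  -- If no translate of x meets `C`, the itinerary of x never stops. The centres of its initial
  -- words then converge along a subsequence to x, making x a limit point.
  by_contra! hcon
  apply hx
  have hσ' : ∀ y, ∃ s, y ∉ C → y ∈ X s ∧ (freeLetter f₁ f₂ s)⁻¹ y ∉ X (flipLetter s) := fun y => by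
    by_cases hy : y ∈ C
    · exact ⟨(true, true), fun hh => absurd hy hh⟩
    · obtain ⟨s, hs⟩ := hC y hy
      exact ⟨s, fun _ => hs⟩
  choose σ hσ using hσ'
  have hy : ∀ n, itineraryPoint f₁ f₂ σ n x ∉ C := fun n => by
    rw [← itineraryWord_inv_apply]
    exact hcon _ (inv_mem (itineraryWord_mem n x))
  set P := fun n => itineraryPoint f₁ f₂ σ n x with hP
  set g := fun n => itineraryWord f₁ f₂ σ (n + 1) x with hg
  have hc : ∀ n, ∃ w, IsCenter (g n) w := fun n =>
    IsMobius.exists_isCenter (closure_le h₁ h₂ (itineraryWord_mem (n + 1) x))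
  choose w hw using hc
  obtain ⟨u, hu, δ, hδ, hd⟩ := h.exists_infDist
  obtain ⟨a, ha, b, hb, hab⟩ := h.infinite.nontrivial
  obtain ⟨d, hd0, hdd⟩ := h.exists_pos_le_dist
  have hdist : 0 < dist a b := dist_pos.2 hab
  refine mem_limitSet_iff.2 (Metric.mem_closure_iff.2 fun ε hε => ?_)
  obtain ⟨n, hn⟩ := exists_center_near_boundary (u := u) hw hδ (fun n m hnm => by
    obtain ⟨k, rfl⟩ := Nat.exists_eq_add_of_lt hnm
    refine hd _ (Set.mem_iUnion_of_mem (σ (P (n + 1))) ?_)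
    have : (g n)⁻¹ (g (n + k + 1) u) = itineraryWord f₁ f₂ σ (k + 1) (P (n + 1)) u := by
      rw [← Homeomorph.mul_apply]
      simp only [hg]
      rw [show n + k + 1 + 1 = (n + 1) + (k + 1) by ring, itineraryWord_add (n + 1), inv_mul_cancel_left]
    rw [this]
    refine itineraryWord_apply_mem h hσ (fun m => ?_) k hu
    rw [itineraryPoint_itineraryPoint]
    exact hy _) (lt_min (show 0 < d / 2 * (dist a b / 2) by positivity)
      (show 0 < d / 2 * ε by positivity))
  refine ⟨w n, ⟨g n, itineraryWord_mem _ _, hw n⟩, ?_⟩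
  obtain ⟨w', -, -, hz⟩ := (hw n).exists_inv
  have hgx : g n (P (n + 1)) = x := itineraryWord_apply_point _ _
  -- The inverse centre w' is located through an image under `(g n)⁻¹` of a or of b, whichever is
  -- far from w_n. The reached point `P (n + 1)` lies in the set of another letter, hence away from
  -- w', so the product formula forces x to be near w_n.
  have key : ∃ v ∈ X (flipLetter (σ (P n))), ‖(v : ℂ) - w'‖ < d / 2 := by
    have hv : ∀ v ∈ (⋃ s, X s)ᶜ, dist a b / 2 ≤ ‖(v : ℂ) - w n‖ →
        ‖(((g n)⁻¹ v : Circle) : ℂ) - w'‖ < d / 2 := fun v _ hle => by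
      have h1 := hz ((g n)⁻¹ v)
      rw [show g n ((g n)⁻¹ v) = v by simp] at h1
      have h2 := hn.trans_le (min_le_left _ _)
      by_contra! hc
      nlinarith
    rcases half_dist_le_or a b (w n) with hh | hh
    · exact ⟨_, itineraryWord_inv_apply_mem h hσ hy n ha, hv a ha hh⟩
    · exact ⟨_, itineraryWord_inv_apply_mem h hσ hy n hb, hv b hb hh⟩
  obtain ⟨v, hv, hvd⟩ := key
  have h3 : d ≤ dist (P (n + 1)) v :=
    hdd _ _ (letter_ne_flipLetter hσ hy n) _ (hσ _ (hy (n + 1))).1 _ hv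
  have h4 : d / 2 ≤ ‖(P (n + 1) : ℂ) - w'‖ := by
    have := norm_sub_le ((P (n + 1) : ℂ) - w') (v - w')
    rw [sub_sub_sub_cancel_right, ← Circle.dist_eq_norm_sub] at this
    linarith
  have h5 := hz (P (n + 1))
  rw [hgx] at h5
  have h6 := hn.trans_le (min_le_right _ _)
  rw [dist_eq_norm]
  by_contra! hcon
  nlinarith [norm_nonneg ((x : ℂ) - w n)]

end PingPong

/-! ### Angles, lifts and the Schottky arcs -/

theorem Circle.eq_of_exp_eq_exp {x y : ℝ} (h : Circle.exp x = Circle.exp y)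
    (h1 : x - y < 2 * Real.pi) (h2 : y - x < 2 * Real.pi) : x = y := by
  obtain ⟨m, rfl⟩ := Circle.exp_eq_exp.1 h
  have hp := Real.pi_pos
  have h3 : (m : ℝ) < 1 := by nlinarith
  have h4 : (-1 : ℝ) < m := by nlinarith
  have h5 : m < 1 := by exact_mod_cast h3
  have h6 : -1 < m := by exact_mod_cast h4
  have : m = 0 := by omega
  simp [this]

theorem Circle.exists_mem_Ico_exp_eq (c : ℝ) (z : Circle) :
    ∃ x ∈ Set.Ico c (c + 2 * Real.pi), Circle.exp x = z := by
  obtain ⟨y, rfl⟩ := Circle.exp_surjective z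
  refine ⟨toIcoMod Real.two_pi_pos c y, toIcoMod_mem_Ico _ _ _, ?_⟩
  rw [toIcoMod, zsmul_eq_mul]
  exact Circle.exp_eq_exp.2 ⟨-toIcoDiv Real.two_pi_pos c y, by push_cast; ring⟩

theorem Circle.exp_mem_image_iff {c x : ℝ} {A : Set ℝ} (hx : x ∈ Set.Ico c (c + 2 * Real.pi))
    (hA : A ⊆ Set.Ico c (c + 2 * Real.pi)) :
    Circle.exp x ∈ Circle.exp '' A ↔ x ∈ A :=
  (Circle.exp_injOn_Ico (by linarith)).mem_image_iff hA hx

theorem Circle.isOpen_exp_image {A : Set ℝ} (hA : IsOpen A) : IsOpen (Circle.exp '' A) :=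
  isLocalHomeomorph_circleExp.isOpenMap _ hA

theorem isClosed_circleArc (a b : ℝ) : IsClosed (circleArc a b) :=
  (isCompact_Icc.image Circle.exp.continuous).isClosed

namespace IsCircleLift

variable {f : Circle ≃ₜ Circle} {F : ℝ → ℝ} {a b c d : ℝ} {z : Circle}

theorem add_int (h : IsCircleLift f F) (k : ℤ) :
    IsCircleLift f fun x => F x + k * (2 * Real.pi) where
  continuous := h.continuous.add continuous_const
  strictMono := fun x y hxy => by simpa using h.strictMono hxy
  add_two_pi := fun x => by rw [h.add_two_pi]; ring
  exp_apply := fun x => by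
    rw [h.exp_apply]
    exact (Circle.exp_eq_exp.2 ⟨k, rfl⟩).symm

theorem apply_mem (h : IsCircleLift f F) (hc : F b = c) (hd : F (a + 2 * Real.pi) = d)
    (hz : z ∉ circleArc a b) : f z ∈ Circle.exp '' Set.Ioo c d := by
  obtain ⟨x, hx, rfl⟩ := Circle.exists_mem_Ico_exp_eq a z
  have hbx : b < x := lt_of_not_ge fun hle => hz ⟨x, ⟨hx.1, hle⟩, rfl⟩
  exact ⟨F x, ⟨hc ▸ h.strictMono hbx, hd ▸ h.strictMono hx.2⟩, (h.exp_apply x).symm⟩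

theorem symm_apply_mem (h : IsCircleLift f F) (hc : F b = c) (hd : F (a + 2 * Real.pi) = d)
    (hab : b < a + 2 * Real.pi) (hz : z ∉ circleArc c d) :
    f⁻¹ z ∈ Circle.exp '' Set.Ioo a b := by
  obtain ⟨y, rfl⟩ := f.surjective z
  obtain ⟨x, hx, rfl⟩ := Circle.exists_mem_Ico_exp_eq a y
  have hb : x < b := lt_of_not_ge fun hle => hz ⟨F x, ⟨hc ▸ h.strictMono.monotone hle,
    hd ▸ (h.strictMono hx.2).le⟩, (h.exp_apply x).symm⟩
  have ha : x ≠ a := by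
    rintro rfl
    refine hz ⟨F (x + 2 * Real.pi), ⟨?_, hd.le⟩, ?_⟩
    · exact hc ▸ (h.strictMono hab).le
    · rw [h.add_two_pi, Circle.exp_add_two_pi, h.exp_apply]
  exact ⟨x, ⟨lt_of_le_of_ne hx.1 ha.symm, hb⟩, by simp⟩

theorem apply_notMem (h : IsCircleLift f F) (hc : F b = c) (hd : F (a + 2 * Real.pi) = d)
    {x : ℝ} (hx : x ∈ Set.Ioo a b) : f (Circle.exp x) ∉ circleArc c d := by
  rintro ⟨y, hy, hxy⟩
  rw [h.add_two_pi] at hd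
  rw [h.exp_apply] at hxy
  have h1 := h.strictMono hx.1
  have h2 := h.strictMono hx.2
  have := Circle.eq_of_exp_eq_exp hxy (by linarith [hy.2]) (by linarith [hy.1, Real.pi_pos])
  linarith [hy.1]

theorem symm_apply_notMem (h : IsCircleLift f F) (hc : F b = c) (hd : F (a + 2 * Real.pi) = d)
    {x : ℝ} (hx : x ∈ Set.Ioo c d) : f⁻¹ (Circle.exp x) ∉ circleArc a b := by
  rintro ⟨y, hy, hxy⟩
  have h0 : f (Circle.exp y) = Circle.exp x := by rw [hxy]; simp
  rw [h.exp_apply] at h0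
  rw [h.add_two_pi] at hd
  have h1 := h.strictMono.monotone hy.1
  have h2 := h.strictMono.monotone hy.2
  rw [← Circle.exp_add_two_pi] at h0
  have := Circle.eq_of_exp_eq_exp h0 (by linarith [hx.1])
    (by linarith [hx.2, Real.pi_pos])
  linarith [hx.2]

end IsCircleLift

/-- Once a lift is shifted so that `F b` lies in `[c, d]`, connectedness keeps the rest of the image
in that interval: to leave it upwards, F would have to take a value strictly between d and c + 2π.
-/
theorem IsMobius.exists_lift_mem {f : Circle ≃ₜ Circle} (hf : IsMobius f) {a b c d : ℝ}
    (hab : b < a + 2 * Real.pi) (hcd : d < c + 2 * Real.pi)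
    (h : f '' (circleArc a b)ᶜ ⊆ circleArc c d) :
    ∃ F, IsCircleLift f F ∧ c ≤ F b ∧ F (a + 2 * Real.pi) ≤ d := by
  obtain ⟨u, v, huv⟩ := hf
  obtain ⟨F, hF⟩ := huv.exists_lift
  -- With b < a the removed arc is empty and the whole circle would be mapped into the arc from c to
  -- d, which misses the point opposite its midpoint.
  by_cases hle : b < a
  · have : circleArc a b = ∅ := by simp [circleArc, Set.Icc_eq_empty (not_le.2 hle)]
    rw [this, Set.compl_empty, Set.image_univ, f.range_coe] at h
    obtain ⟨y, hy, hyz⟩ := h (Set.mem_univ (Circle.exp ((d + c) / 2 + Real.pi)))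
    have := Circle.eq_of_exp_eq_exp hyz (by linarith [hy.1, hy.2]) (by linarith [hy.1, hy.2])
    linarith [hy.1, hy.2]
  push Not at hle
  have hmem : ∀ x ∈ Set.Icc b (a + 2 * Real.pi), Circle.exp (F x) ∈ circleArc c d := by
    have hcl : IsClosed {x | Circle.exp (F x) ∈ circleArc c d} :=
      (isClosed_circleArc c d).preimage (Circle.exp.continuous.comp hF.continuous)
    rw [← closure_Ioo hab.ne]
    refine closure_minimal (fun x hx => ?_) hcl
    show Circle.exp (F x) ∈ circleArc c d
    rw [← hF.exp_apply]
    refine h ⟨_, ?_, rfl⟩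
    rintro ⟨y, hy, hyx⟩
    have := Circle.eq_of_exp_eq_exp hyx (by linarith [hy.2, hx.1, Real.pi_pos])
      (by linarith [hy.1, hx.2])
    linarith [hy.2, hx.1]
  obtain ⟨y, hy, hyb⟩ := hmem b ⟨le_rfl, hab.le⟩
  obtain ⟨k, rfl⟩ := Circle.exp_eq_exp.1 hyb
  refine ⟨_, hF.add_int k, hy.1, le_of_not_gt fun hlt => ?_⟩
  obtain ⟨x, hx, hxv⟩ := intermediate_value_Icc hab.le (hF.add_int k).continuous.continuousOn
    (show min (F (a + 2 * Real.pi) + k * (2 * Real.pi)) ((d + (c + 2 * Real.pi)) / 2) ∈ _ from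
      ⟨le_min (by linarith [hy.2]) (by linarith [hy.2]), min_le_left _ _⟩)
  obtain ⟨y', hy', hyx⟩ := hmem x hx
  have h1 : d < F x + k * (2 * Real.pi) := by
    have : F x + k * (2 * Real.pi) = _ := hxv
    rw [this]; exact lt_min hlt (by linarith)
  have h2 : F x + k * (2 * Real.pi) < c + 2 * Real.pi := by
    have : F x + k * (2 * Real.pi) = _ := hxv
    rw [this]; exact (min_le_right _ _).trans_lt (by linarith)
  rw [show Circle.exp (F x) = Circle.exp (F x + k * (2 * Real.pi)) from
    (Circle.exp_eq_exp.2 ⟨k, rfl⟩).symm] at hyx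
  have := Circle.eq_of_exp_eq_exp hyx (by linarith [hy'.2, Real.pi_pos]) (by linarith [hy'.1])
  linarith [hy'.2]

/-- Four arcs `N = [n₀, n₁]`, `E = [e₀, e₁]`, `S = [s₀, s₁]`, `W = [w₀, w₁]` in cyclic order such
that `f₁` maps the closure of the complement of `S` onto `N` and `f₂` maps the closure of the
complement of `W` onto `E`. -/
structure SchottkyArcs (f₁ f₂ : Circle ≃ₜ Circle) where
  (F₁ F₂ : ℝ → ℝ)
  (n₀ n₁ e₀ e₁ s₀ s₁ w₀ w₁ : ℝ)
  lift₁ : IsCircleLift f₁ F₁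
  lift₂ : IsCircleLift f₂ F₂
  lt_n : n₀ < n₁
  lt_ne : n₁ < e₀
  lt_e : e₀ < e₁
  lt_es : e₁ < s₀
  lt_s : s₀ < s₁
  lt_sw : s₁ < w₀
  lt_w : w₀ < w₁
  lt_wn : w₁ < n₀ + 2 * Real.pi
  map_s₁ : F₁ s₁ = n₀
  map_s₀ : F₁ (s₀ + 2 * Real.pi) = n₁
  map_w₁ : F₂ w₁ = e₀
  map_w₀ : F₂ (w₀ + 2 * Real.pi) = e₁

namespace SchottkyArcs

variable {f₁ f₂ : Circle ≃ₜ Circle}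

/-- The arcs N and E are replaced by the exact images of the closed complementary arcs of S and W.
They only shrink, so the cyclic order persists, and the inclusions become equalities of end points.
-/
theorem nonempty_of_arcs (h₁ : IsMobius f₁) (h₂ : IsMobius f₂) {t : Fin 8 → ℝ} (ht : StrictMono t)
    (h7 : t 7 < t 0 + 2 * Real.pi)
    (hN : f₁ '' (circleArc (t 4) (t 5))ᶜ ⊆ circleArc (t 0) (t 1))
    (hE : f₂ '' (circleArc (t 6) (t 7))ᶜ ⊆ circleArc (t 2) (t 3)) :
    Nonempty (SchottkyArcs f₁ f₂) := by
  have t01 : t 0 < t 1 := ht (by decide)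
  have t12 : t 1 < t 2 := ht (by decide)
  have t23 : t 2 < t 3 := ht (by decide)
  have t34 : t 3 < t 4 := ht (by decide)
  have t45 : t 4 < t 5 := ht (by decide)
  have t56 : t 5 < t 6 := ht (by decide)
  have t67 : t 6 < t 7 := ht (by decide)
  obtain ⟨F₁, hF₁, h10, h11⟩ := h₁.exists_lift_mem (by linarith) (by linarith) hN
  obtain ⟨F₂, hF₂, h20, h21⟩ := h₂.exists_lift_mem (by linarith) (by linarith) hE
  have m1 : F₁ (t 5) < F₁ (t 4 + 2 * Real.pi) := hF₁.strictMono (by linarith)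
  have m2 : F₂ (t 7) < F₂ (t 6 + 2 * Real.pi) := hF₂.strictMono (by linarith)
  exact ⟨⟨F₁, F₂, F₁ (t 5), F₁ (t 4 + 2 * Real.pi), F₂ (t 7), F₂ (t 6 + 2 * Real.pi), t 4, t 5,
    t 6, t 7, hF₁, hF₂, m1, by linarith, m2, by linarith, t45, t56, t67, by linarith, rfl, rfl,
    rfl, rfl⟩⟩

variable (A : SchottkyArcs f₁ f₂)

/-- The arcs indexed by the letters. -/
def arc : Bool × Bool → Set Circle
  | (true, true) => circleArc A.n₀ A.n₁
  | (true, false) => circleArc A.s₀ A.s₁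
  | (false, true) => circleArc A.e₀ A.e₁
  | (false, false) => circleArc A.w₀ A.w₁

theorem exp_mem_arc {x : ℝ} (hx : x ∈ Set.Ico A.n₀ (A.n₀ + 2 * Real.pi)) (s : Bool × Bool) :
    Circle.exp x ∈ A.arc s ↔ match s with
      | (true, true) => x ∈ Set.Icc A.n₀ A.n₁
      | (true, false) => x ∈ Set.Icc A.s₀ A.s₁
      | (false, true) => x ∈ Set.Icc A.e₀ A.e₁
      | (false, false) => x ∈ Set.Icc A.w₀ A.w₁ := by
  have h1 := A.lt_n
  have h2 := A.lt_ne
  have h3 := A.lt_e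
  have h4 := A.lt_es
  have h5 := A.lt_s
  have h6 := A.lt_sw
  have h7 := A.lt_w
  have h8 := A.lt_wn
  rcases s with ⟨_ | _, _ | _⟩ <;>
    exact Circle.exp_mem_image_iff hx fun y hy => ⟨by linarith [hy.1], by linarith [hy.2]⟩

theorem exp_notMem_iUnion_arc {x : ℝ} (hx : x ∈ Set.Ioo A.n₁ A.e₀ ∪ Set.Ioo A.e₁ A.s₀ ∪
    Set.Ioo A.s₁ A.w₀ ∪ Set.Ioo A.w₁ (A.n₀ + 2 * Real.pi)) : Circle.exp x ∈ (⋃ s, A.arc s)ᶜ := by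
  have h1 := A.lt_n
  have h2 := A.lt_ne
  have h3 := A.lt_e
  have h4 := A.lt_es
  have h5 := A.lt_s
  have h6 := A.lt_sw
  have h7 := A.lt_w
  have h8 := A.lt_wn
  have hm : x ∈ Set.Ico A.n₀ (A.n₀ + 2 * Real.pi) := by
    rcases hx with ((hx | hx) | hx) | hx <;> exact ⟨by linarith [hx.1], by linarith [hx.2]⟩
  simp only [Set.mem_compl_iff, Set.mem_iUnion, not_exists]
  intro s
  rw [A.exp_mem_arc hm]
  rcases s with ⟨_ | _, _ | _⟩ <;> rintro ⟨h9, h10⟩ <;>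
    rcases hx with ((⟨h11, h12⟩ | ⟨h11, h12⟩) | ⟨h11, h12⟩) | ⟨h11, h12⟩ <;> linarith

theorem isPingPong : IsPingPong f₁ f₂ A.arc where
  isClosed s := by rcases s with ⟨_ | _, _ | _⟩ <;> exact isClosed_circleArc _ _
  notMem s t hst z hs ht := by
    have h1 := A.lt_n
    have h2 := A.lt_ne
    have h3 := A.lt_e
    have h4 := A.lt_es
    have h5 := A.lt_s
    have h6 := A.lt_sw
    have h7 := A.lt_w
    obtain ⟨x, hx, rfl⟩ := Circle.exists_mem_Ico_exp_eq A.n₀ z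
    rw [A.exp_mem_arc hx] at hs ht
    rcases s with ⟨_ | _, _ | _⟩ <;> rcases t with ⟨_ | _, _ | _⟩ <;>
      first
      | exact hst rfl
      | (obtain ⟨h9, h10⟩ := hs; obtain ⟨h11, h12⟩ := ht; linarith)
  maps s z hz := by
    have h6 := A.lt_sw
    have h7 := A.lt_w
    have h8 := A.lt_wn
    have h1 : A.n₀ < A.s₀ := by linarith [A.lt_n, A.lt_ne, A.lt_e, A.lt_es]
    rcases s with ⟨_ | _, _ | _⟩
    · exact Set.image_mono Set.Ioo_subset_Icc_self
        (A.lift₂.symm_apply_mem A.map_w₁ A.map_w₀ (by linarith [A.lt_s]) hz)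
    · exact Set.image_mono Set.Ioo_subset_Icc_self (A.lift₂.apply_mem A.map_w₁ A.map_w₀ hz)
    · exact Set.image_mono Set.Ioo_subset_Icc_self
        (A.lift₁.symm_apply_mem A.map_s₁ A.map_s₀ (by linarith) hz)
    · exact Set.image_mono Set.Ioo_subset_Icc_self (A.lift₁.apply_mem A.map_s₁ A.map_s₀ hz)
  infinite := by
    have h : (Circle.exp '' Set.Ioo A.n₁ A.e₀).Infinite := by
      refine (Set.Ioo_infinite A.lt_ne).image (Circle.exp_injOn_Ico (a := A.n₁) (b := A.e₀) ?_ |>.mono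
        Set.Ioo_subset_Ico_self)
      linarith [A.lt_n, A.lt_e, A.lt_es, A.lt_s, A.lt_sw, A.lt_w, A.lt_wn]
    refine h.mono ?_
    rintro _ ⟨x, hx, rfl⟩
    exact A.exp_notMem_iUnion_arc (Or.inl (Or.inl (Or.inl hx)))

/-- The union of the four closed gaps between consecutive arcs. -/
def gaps : Set Circle :=
  circleArc A.n₁ A.e₀ ∪ circleArc A.e₁ A.s₀ ∪ circleArc A.s₁ A.w₀ ∪
    circleArc A.w₁ (A.n₀ + 2 * Real.pi)

/-- The gaps are closed, so the point is interior to one of the arcs; the inverse letter carries the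
interior of that arc outside the closed arc of the inverse letter. -/
theorem exists_letter_of_notMem_gaps {z : Circle} (hz : z ∉ A.gaps) :
    ∃ s, z ∈ A.arc s ∧ (freeLetter f₁ f₂ s)⁻¹ z ∉ A.arc (flipLetter s) := by
  obtain ⟨x, hx, rfl⟩ := Circle.exists_mem_Ico_exp_eq A.n₀ z
  simp only [gaps, Set.mem_union, not_or] at hz
  obtain ⟨⟨⟨h1, h2⟩, h3⟩, h4⟩ := hz
  have g1 : ¬(A.n₁ ≤ x ∧ x ≤ A.e₀) := fun h => h1 ⟨x, h, rfl⟩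
  have g2 : ¬(A.e₁ ≤ x ∧ x ≤ A.s₀) := fun h => h2 ⟨x, h, rfl⟩
  have g3 : ¬(A.s₁ ≤ x ∧ x ≤ A.w₀) := fun h => h3 ⟨x, h, rfl⟩
  have g4 : x < A.w₁ := lt_of_not_ge fun h => h4 ⟨x, ⟨h, hx.2.le⟩, rfl⟩
  have g5 : A.n₀ < x := lt_of_le_of_ne hx.1 fun h => h4 ⟨A.n₀ + 2 * Real.pi,
    ⟨A.lt_wn.le, le_rfl⟩, by rw [Circle.exp_add_two_pi, h]⟩
  by_cases c1 : x < A.n₁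
  · exact ⟨(true, true), ⟨x, ⟨g5.le, c1.le⟩, rfl⟩,
      A.lift₁.symm_apply_notMem A.map_s₁ A.map_s₀ ⟨g5, c1⟩⟩
  have d1 : A.e₀ < x := lt_of_not_ge fun h => g1 ⟨not_lt.1 c1, h⟩
  by_cases c2 : x < A.e₁
  · exact ⟨(false, true), ⟨x, ⟨d1.le, c2.le⟩, rfl⟩,
      A.lift₂.symm_apply_notMem A.map_w₁ A.map_w₀ ⟨d1, c2⟩⟩
  have d2 : A.s₀ < x := lt_of_not_ge fun h => g2 ⟨not_lt.1 c2, h⟩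
  by_cases c3 : x < A.s₁
  · exact ⟨(true, false), ⟨x, ⟨d2.le, c3.le⟩, rfl⟩, by
      show (f₁⁻¹)⁻¹ (Circle.exp x) ∉ circleArc A.n₀ A.n₁
      rw [inv_inv]
      exact A.lift₁.apply_notMem A.map_s₁ A.map_s₀ ⟨d2, c3⟩⟩
  have d3 : A.w₀ < x := lt_of_not_ge fun h => g3 ⟨not_lt.1 c3, h⟩
  exact ⟨(false, false), ⟨x, ⟨d3.le, g4.le⟩, rfl⟩, by
    show (f₂⁻¹)⁻¹ (Circle.exp x) ∉ circleArc A.e₀ A.e₁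
    rw [inv_inv]
    exact A.lift₂.apply_notMem A.map_w₁ A.map_w₀ ⟨d3, g4⟩⟩

theorem exp_notMem_limitSet {x : ℝ} (hx : x ∈ Set.Ioo A.n₁ A.e₀ ∪ Set.Ioo A.e₁ A.s₀ ∪
    Set.Ioo A.s₁ A.w₀ ∪ Set.Ioo A.w₁ (A.n₀ + 2 * Real.pi)) :
    Circle.exp x ∉ schottkyLimitSet f₁ f₂ :=
  fun h => A.exp_notMem_iUnion_arc hx (A.isPingPong.limitSet_subset h)

/-- Enlarging S and W shrinks the complements, hence moves the ends of N and E inwards. The old ends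
of N and E thus fall into open gaps of the new configuration. -/
theorem exists_thicker : ∃ B : SchottkyArcs f₁ f₂, A.n₀ < B.n₀ ∧ B.n₁ < A.n₁ ∧ A.e₀ < B.e₀ ∧
    B.e₁ < A.e₁ ∧ A.e₁ < B.s₀ ∧ B.w₁ < A.n₀ + 2 * Real.pi := by
  have h1 := A.lt_n
  have h2 := A.lt_ne
  have h3 := A.lt_e
  have h4 := A.lt_es
  have h5 := A.lt_s
  have h6 := A.lt_sw
  have h7 := A.lt_w
  have h8 := A.lt_wn
  -- The gap between S and W is approached from both sides, so only half of its length is available.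
  obtain ⟨ε, h0, he⟩ := exists_between (lt_min (sub_pos.2 h4)
    (lt_min (half_pos (sub_pos.2 h6)) (sub_pos.2 h8)))
  have e1 := he.trans_le (min_le_left _ _)
  have e2 := he.trans_le ((min_le_right _ _).trans (min_le_left _ _))
  have e3 := he.trans_le ((min_le_right _ _).trans (min_le_right _ _))
  have l1 : A.n₀ < A.F₁ (A.s₁ + ε) := A.map_s₁ ▸ A.lift₁.strictMono (by linarith)
  have l2 : A.F₁ (A.s₀ - ε + 2 * Real.pi) < A.n₁ := A.map_s₀ ▸ A.lift₁.strictMono (by linarith)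
  have l3 : A.e₀ < A.F₂ (A.w₁ + ε) := A.map_w₁ ▸ A.lift₂.strictMono (by linarith)
  have l4 : A.F₂ (A.w₀ - ε + 2 * Real.pi) < A.e₁ := A.map_w₀ ▸ A.lift₂.strictMono (by linarith)
  have l5 : A.F₁ (A.s₁ + ε) < A.F₁ (A.s₀ - ε + 2 * Real.pi) := A.lift₁.strictMono (by linarith)
  have l6 : A.F₂ (A.w₁ + ε) < A.F₂ (A.w₀ - ε + 2 * Real.pi) := A.lift₂.strictMono (by linarith)
  exact ⟨⟨A.F₁, A.F₂, _, _, _, _, A.s₀ - ε, A.s₁ + ε, A.w₀ - ε, A.w₁ + ε, A.lift₁, A.lift₂, l5,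
    by linarith, l6, by linarith, by linarith, by linarith, by linarith, by linarith, rfl, rfl,
    rfl, rfl⟩, l1, l2, l3, l4, by show _ < A.s₀ - ε; linarith,
    by show A.w₁ + ε < _; linarith⟩

theorem apply_exp_s₀ : f₁ (Circle.exp A.s₀) = Circle.exp A.n₁ := by
  rw [← Circle.exp_add_two_pi, A.lift₁.exp_apply, A.map_s₀]

theorem apply_exp_s₁ : f₁ (Circle.exp A.s₁) = Circle.exp A.n₀ := by
  rw [A.lift₁.exp_apply, A.map_s₁]

theorem apply_exp_w₀ : f₂ (Circle.exp A.w₀) = Circle.exp A.e₁ := by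
  rw [← Circle.exp_add_two_pi, A.lift₂.exp_apply, A.map_w₀]

theorem apply_exp_w₁ : f₂ (Circle.exp A.w₁) = Circle.exp A.e₀ := by
  rw [A.lift₂.exp_apply, A.map_w₁]

/-- Open gaps avoid Λ by ping-pong. The ends of N and E avoid it by ping-pong for the thickened
arcs, and those of S and W because the generators map them to ends of N and E. -/
theorem gaps_subset (h₁ : IsMobius f₁) (h₂ : IsMobius f₂) :
    A.gaps ⊆ (schottkyLimitSet f₁ f₂)ᶜ := by
  obtain ⟨B, b1, b2, b3, b4, b5, b6⟩ := A.exists_thicker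
  have hΓ := IsPingPong.closure_le h₁ h₂
  have m1 : f₁ ∈ Subgroup.closure {f₁, f₂} := Subgroup.subset_closure (by simp)
  have m2 : f₂ ∈ Subgroup.closure {f₁, f₂} := Subgroup.subset_closure (by simp)
  have h1 := A.lt_n
  have h2 := A.lt_ne
  have h3 := A.lt_e
  have h4 := A.lt_es
  have h8 := A.lt_wn
  have hn : ∀ x, A.n₁ ≤ x → x ≤ A.e₀ → Circle.exp x ∉ schottkyLimitSet f₁ f₂ := fun x hx hx' =>
    B.exp_notMem_limitSet (Or.inl (Or.inl (Or.inl ⟨by linarith, by linarith⟩)))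
  have hs₀ : Circle.exp A.s₀ ∉ schottkyLimitSet f₁ f₂ := by
    rw [schottkyLimitSet, ← apply_mem_limitSet_iff hΓ m1, A.apply_exp_s₀]
    exact hn _ le_rfl h2.le
  have hw₁ : Circle.exp A.w₁ ∉ schottkyLimitSet f₁ f₂ := by
    rw [schottkyLimitSet, ← apply_mem_limitSet_iff hΓ m2, A.apply_exp_w₁]
    exact hn _ h2.le le_rfl
  have he₁ : Circle.exp A.e₁ ∉ schottkyLimitSet f₁ f₂ :=
    B.exp_notMem_limitSet (Or.inl (Or.inl (Or.inr ⟨b4, b5⟩)))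
  have hn₀ : Circle.exp (A.n₀ + 2 * Real.pi) ∉ schottkyLimitSet f₁ f₂ :=
    B.exp_notMem_limitSet (Or.inr ⟨b6, by linarith⟩)
  have hw₀ : Circle.exp A.w₀ ∉ schottkyLimitSet f₁ f₂ := by
    rwa [schottkyLimitSet, ← apply_mem_limitSet_iff hΓ m2, A.apply_exp_w₀]
  have hs₁ : Circle.exp A.s₁ ∉ schottkyLimitSet f₁ f₂ := by
    rw [schottkyLimitSet, ← apply_mem_limitSet_iff hΓ m1, A.apply_exp_s₁]
    rwa [Circle.exp_add_two_pi] at hn₀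
  rintro _ (((⟨x, hx, rfl⟩ | ⟨x, hx, rfl⟩) | ⟨x, hx, rfl⟩) | ⟨x, hx, rfl⟩)
  · exact hn x hx.1 hx.2
  · rcases hx.1.eq_or_lt with rfl | h
    · exact he₁
    rcases hx.2.eq_or_lt with rfl | h'
    · exact hs₀
    exact A.exp_notMem_limitSet (Or.inl (Or.inl (Or.inr ⟨h, h'⟩)))
  · rcases hx.1.eq_or_lt with rfl | h
    · exact hs₁
    rcases hx.2.eq_or_lt with rfl | h'
    · exact hw₀
    exact A.exp_notMem_limitSet (Or.inl (Or.inr ⟨h, h'⟩))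
  · rcases hx.1.eq_or_lt with rfl | h
    · exact hw₁
    rcases hx.2.eq_or_lt with rfl | h'
    · exact hn₀
    exact A.exp_notMem_limitSet (Or.inr ⟨h, h'⟩)

end SchottkyArcs

/-! ### Connected subsets of the circle and complementary arcs -/

section Arcs

/-- Two points cut the circle into two disjoint open arcs, and a connected set avoiding both points
cannot meet both arcs. -/
theorem Circle.isPreconnected_subset_arc {μ ν : ℝ} (hν : ν ≤ μ + 2 * Real.pi)
    {t : Set Circle} (ht : IsPreconnected t) (h1 : Circle.exp μ ∉ t) (h2 : Circle.exp ν ∉ t)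
    (hne : (t ∩ Circle.exp '' Set.Ioo μ ν).Nonempty) : t ⊆ Circle.exp '' Set.Ioo μ ν := by
  refine IsPreconnected.subset_left_of_subset_union (Circle.isOpen_exp_image isOpen_Ioo)
    (Circle.isOpen_exp_image (isOpen_Ioo (a := ν) (b := μ + 2 * Real.pi))) ?_ ?_ hne ht
  · rw [Set.disjoint_left]
    rintro _ ⟨x, hx, rfl⟩ ⟨y, hy, hxy⟩
    have := Circle.eq_of_exp_eq_exp hxy (by linarith [hx.1, hy.2])
      (by linarith [hx.2, hy.1, Real.pi_pos])
    linarith [hx.2, hy.1]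
  · intro z hz
    obtain ⟨x, hx, rfl⟩ := Circle.exists_mem_Ico_exp_eq μ z
    have hxμ : μ < x := lt_of_le_of_ne hx.1 (by rintro rfl; exact h1 hz)
    rcases lt_trichotomy x ν with h | rfl | h
    · exact Or.inl ⟨x, ⟨hxμ, h⟩, rfl⟩
    · exact absurd hz h2
    · exact Or.inr ⟨x, ⟨h, hx.2⟩, rfl⟩

/-- Two distinct points of C are separated by a point outside C on each of the two arcs joining
them. -/
theorem Circle.isTotallyDisconnected_of_interior_eq_empty {C : Set Circle}
    (hC : interior C = ∅) : IsTotallyDisconnected C := by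
  have hex : ∀ a b : ℝ, a < b → ∃ x ∈ Set.Ioo a b, Circle.exp x ∉ C := fun a b hab => by
    by_contra! hcon
    have hsub : Circle.exp '' Set.Ioo a b ⊆ interior C :=
      interior_maximal (by rintro _ ⟨x, hx, rfl⟩; exact hcon x hx)
        (Circle.isOpen_exp_image isOpen_Ioo)
    rw [hC] at hsub
    exact hsub ⟨(a + b) / 2, ⟨by linarith, by linarith⟩, rfl⟩
  intro t htC ht x hx y hy
  by_contra hxy
  obtain ⟨α, rfl⟩ := Circle.exp_surjective x
  obtain ⟨β, hβ, rfl⟩ := Circle.exists_mem_Ico_exp_eq α y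
  have hαβ : α < β := lt_of_le_of_ne hβ.1 (by rintro rfl; exact hxy rfl)
  obtain ⟨μ, hμ, hμC⟩ := hex α β hαβ
  obtain ⟨ν, hν, hνC⟩ := hex β (α + 2 * Real.pi) hβ.2
  obtain ⟨z, hz, hzx⟩ := Circle.isPreconnected_subset_arc (μ := μ) (ν := ν)
    (by linarith [hμ.1, hν.2]) ht (fun h => hμC (htC h)) (fun h => hνC (htC h))
    ⟨_, hy, β, ⟨hμ.2, hν.1⟩, rfl⟩ hx
  have := Circle.eq_of_exp_eq_exp hzx (by linarith [hz.2, hν.2])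
    (by linarith [hz.1, hμ.1, Real.pi_pos])
  linarith [hz.1, hμ.1]

/-- Components of the complement of a closed subset of the circle with at least two points are open
arcs with end points in the set. -/
theorem IsComplementaryInterval.exists_arc {C J : Set Circle} (hC : IsClosed C)
    (hn : C.Nontrivial) (hJ : IsComplementaryInterval C J) :
    ∃ α β : ℝ, α < β ∧ β < α + 2 * Real.pi ∧ Circle.exp α ∈ C ∧ Circle.exp β ∈ C ∧
      J = Circle.exp '' Set.Ioo α β := by
  obtain ⟨x, hx, rfl⟩ := hJ
  obtain ⟨θ, rfl⟩ := Circle.exp_surjective x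
  have hcl : IsClosed (Circle.exp ⁻¹' C) := hC.preimage Circle.exp.continuous
  obtain ⟨c, hc⟩ := hn.nonempty
  obtain ⟨η, hη, hηc⟩ := Circle.exists_mem_Ico_exp_eq (θ - 2 * Real.pi) c
  -- The end points are the nearest lifted points of `C` below and above θ.
  have hS : (Circle.exp ⁻¹' C ∩ Set.Iic θ).Nonempty :=
    ⟨η, by rw [Set.mem_preimage, hηc]; exact hc, by have := hη.2; simp at this; exact this.le⟩
  have hT : (Circle.exp ⁻¹' C ∩ Set.Ici θ).Nonempty :=
    ⟨η + 2 * Real.pi, by rw [Set.mem_preimage, Circle.exp_add_two_pi, hηc]; exact hc,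
      by have := hη.1; simp at this ⊢; linarith⟩
  have bS : BddAbove (Circle.exp ⁻¹' C ∩ Set.Iic θ) := ⟨θ, fun y hy => hy.2⟩
  have bT : BddBelow (Circle.exp ⁻¹' C ∩ Set.Ici θ) := ⟨θ, fun y hy => hy.2⟩
  have hα := (hcl.inter isClosed_Iic).csSup_mem hS bS
  have hβ := (hcl.inter isClosed_Ici).csInf_mem hT bT
  have hα' : ∀ y ∈ Circle.exp ⁻¹' C ∩ Set.Iic θ, y ≤ sSup (Circle.exp ⁻¹' C ∩ Set.Iic θ) :=
    fun y hy => le_csSup bS hy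
  have hβ' : ∀ y ∈ Circle.exp ⁻¹' C ∩ Set.Ici θ, sInf (Circle.exp ⁻¹' C ∩ Set.Ici θ) ≤ y :=
    fun y hy => csInf_le bT hy
  generalize sSup (Circle.exp ⁻¹' C ∩ Set.Iic θ) = α at hα hα'
  generalize sInf (Circle.exp ⁻¹' C ∩ Set.Ici θ) = β at hβ hβ'
  have hαθ : α < θ := lt_of_le_of_ne hα.2 (by rintro rfl; exact hx hα.1)
  have hθβ : θ < β := lt_of_le_of_ne hβ.2 (by rintro rfl; exact hx hβ.1)
  have hfree : ∀ y ∈ Set.Ioo α β, Circle.exp y ∉ C := fun y hy hyC => by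
    rcases le_total y θ with h | h
    · linarith [hα' y ⟨hyC, h⟩, hy.1]
    · linarith [hβ' y ⟨hyC, h⟩, hy.2]
  -- A second point of `C` is needed here: the complement of one point would give β = α + 2π.
  have hlt : β < α + 2 * Real.pi := by
    obtain ⟨d, hd, hne⟩ := hn.exists_ne (Circle.exp α)
    obtain ⟨δ, hδ, rfl⟩ := Circle.exists_mem_Ico_exp_eq α d
    have h1 : α < δ := lt_of_le_of_ne hδ.1 (by rintro rfl; exact hne rfl)
    have h2 : β ≤ δ := le_of_not_gt fun h => hfree δ ⟨h1, h⟩ hd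
    linarith [hδ.2]
  refine ⟨α, β, hαθ.trans hθβ, hlt, hα.1, hβ.1, Set.Subset.antisymm ?_ ?_⟩
  · refine Circle.isPreconnected_subset_arc hlt.le isPreconnected_connectedComponentIn
      (fun h => connectedComponentIn_subset _ _ h hα.1)
      (fun h => connectedComponentIn_subset _ _ h hβ.1)
      ⟨_, mem_connectedComponentIn hx, θ, ⟨hαθ, hθβ⟩, rfl⟩
  · refine IsPreconnected.subset_connectedComponentIn
      (isPreconnected_Ioo.image _ Circle.exp.continuous.continuousOn) ⟨θ, ⟨hαθ, hθβ⟩, rfl⟩ ?_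
    rintro _ ⟨y, hy, rfl⟩
    exact hfree y hy

end Arcs

/-! ### Circle homeomorphisms from maps of the line -/

section LiftedHomeomorphisms

/-- `Complex.arg` serves as a discontinuous section of the exponential. Periodicity makes the
composite independent of the section, and continuity then descends along the quotient map. -/
theorem OrderIso.exists_circle_homeomorph (e : ℝ ≃o ℝ)
    (he : ∀ x, e (x + 2 * Real.pi) = e x + 2 * Real.pi) :
    ∃ h : Circle ≃ₜ Circle, ∀ x, h (Circle.exp x) = Circle.exp (e x) := by
  have key : ∀ e : ℝ ≃o ℝ, (∀ x, e (x + 2 * Real.pi) = e x + 2 * Real.pi) →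
      ∀ x, Circle.exp (e (Complex.arg (Circle.exp x))) = Circle.exp (e x) := fun e he x => by
    obtain ⟨k, hk⟩ := Circle.exp_eq_exp.1 (Circle.exp_arg (Circle.exp x))
    have hper : Function.Periodic (fun x => e x - x) (2 * Real.pi) := fun x => by
      simp only [he]; ring
    have h1 : e (x + k * (2 * Real.pi)) - (x + k * (2 * Real.pi)) = e x - x := hper.int_mul k x
    rw [hk]
    exact Circle.exp_eq_exp.2 ⟨k, by linarith⟩
  have he' : ∀ x, e.symm (x + 2 * Real.pi) = e.symm x + 2 * Real.pi := fun x => by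
    rw [OrderIso.symm_apply_eq, he, e.apply_symm_apply]
  have hq : Topology.IsQuotientMap Circle.exp :=
    isLocalHomeomorph_circleExp.isOpenMap.isQuotientMap Circle.exp.continuous
      Circle.exp_surjective
  have hcont : ∀ e : ℝ ≃o ℝ, (∀ x, e (x + 2 * Real.pi) = e x + 2 * Real.pi) →
      Continuous fun z : Circle => Circle.exp (e (Complex.arg z)) := fun e he => by
    rw [hq.continuous_iff]
    refine (Circle.exp.continuous.comp e.continuous).congr fun x => (key e he x).symm
  refine ⟨⟨⟨fun z => Circle.exp (e (Complex.arg z)), fun z => Circle.exp (e.symm (Complex.arg z)),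
    fun z => ?_, fun z => ?_⟩, hcont e he, hcont e.symm he'⟩, key e he⟩
  · simp only
    rw [key e.symm he', e.symm_apply_apply, Circle.exp_arg]
  · simp only
    rw [key e he, e.apply_symm_apply, Circle.exp_arg]

/-- An increasing bijection of a period interval onto itself induces a homeomorphism of the
circle. -/
theorem exists_circle_homeomorph_of_strictMonoOn {a : ℝ} {φ : ℝ → ℝ}
    (hmono : StrictMonoOn φ (Set.Icc a (a + 2 * Real.pi))) (ha : φ a = a)
    (hb : φ (a + 2 * Real.pi) = a + 2 * Real.pi)
    (hsurj : Set.SurjOn φ (Set.Icc a (a + 2 * Real.pi)) (Set.Icc a (a + 2 * Real.pi))) :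
    ∃ h : Circle ≃ₜ Circle, IsOrientationPreserving h ∧
      ∀ x ∈ Set.Icc a (a + 2 * Real.pi), h (Circle.exp x) = Circle.exp (φ x) := by
  have hp := Real.two_pi_pos
  set m := toIcoMod hp a with hm
  have hmem : ∀ x, m x ∈ Set.Ico a (a + 2 * Real.pi) := fun x => toIcoMod_mem_Ico hp a x
  have hdiv : ∀ x, x - m x = toIcoDiv hp a x * (2 * Real.pi) := fun x => by
    rw [hm, self_sub_toIcoMod, zsmul_eq_mul]
  have hφ : ∀ x, φ (m x) ∈ Set.Ico a (a + 2 * Real.pi) := fun x => by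
    have h1 := hmem x
    have h2 := hmono ⟨h1.1, h1.2.le⟩ (Set.right_mem_Icc.2 (by linarith)) h1.2
    have h3 := hmono.monotoneOn (Set.left_mem_Icc.2 (by linarith)) ⟨h1.1, h1.2.le⟩ h1.1
    exact ⟨by linarith, by linarith⟩
  -- This is the extension of φ commuting with the translation by 2π; m reduces x to the base
  -- period.
  let H : ℝ → ℝ := fun x => φ (m x) + (x - m x)
  have hH : StrictMono H := fun x y hxy => by
    have hx := hmem x
    have hy := hmem y
    have hdx := hdiv x
    have hdy := hdiv y
    have hφx := hφ x
    have hφy := hφ y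
    simp only [H]
    rcases lt_trichotomy (toIcoDiv hp a x) (toIcoDiv hp a y) with h | h | h
    · have h' : (toIcoDiv hp a x : ℝ) + 1 ≤ toIcoDiv hp a y := by exact_mod_cast h
      nlinarith [hφx.2, hφy.1]
    · rw [h] at hdx
      have := hmono ⟨hx.1, hx.2.le⟩ ⟨hy.1, hy.2.le⟩ (show m x < m y by linarith)
      linarith
    · have h' : (toIcoDiv hp a y : ℝ) + 1 ≤ toIcoDiv hp a x := by exact_mod_cast h
      nlinarith [hx.1, hy.2]
  have hHp : ∀ x, H (x + 2 * Real.pi) = H x + 2 * Real.pi := fun x => by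
    simp only [H]
    rw [hm, toIcoMod_add_right]
    ring
  have hHper : ∀ x (k : ℤ), H (x + k * (2 * Real.pi)) = H x + k * (2 * Real.pi) := fun x k => by
    have hper : Function.Periodic (fun x => H x - x) (2 * Real.pi) := fun x => by
      simp only [hHp]; ring
    have : H (x + k * (2 * Real.pi)) - (x + k * (2 * Real.pi)) = H x - x := hper.int_mul k x
    linarith
  have hHφ : ∀ x ∈ Set.Icc a (a + 2 * Real.pi), H x = φ x := fun x hx => by
    rcases hx.2.eq_or_lt with rfl | h
    · rw [hHp, hb]
      have : m a = a := toIcoMod_apply_left hp a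
      simp [H, this, ha]
    · have : m x = x := (toIcoMod_eq_self hp).2 ⟨hx.1, h⟩
      simp [H, this]
  have hHs : Function.Surjective H := fun y => by
    obtain ⟨x, hx, hxy⟩ := hsurj ⟨(hmem y).1, (hmem y).2.le⟩
    refine ⟨x + toIcoDiv hp a y * (2 * Real.pi), ?_⟩
    rw [hHper, hHφ x hx, hxy, ← hdiv]
    ring
  let e : ℝ ≃o ℝ := hH.orderIsoOfSurjective H hHs
  obtain ⟨h, hh⟩ := e.exists_circle_homeomorph hHp
  exact ⟨h, ⟨H, e.continuous, hH, hh⟩, fun x hx => by rw [hh, ← hHφ x hx]; rfl⟩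

theorem exists_strictMono_affine {a b c d : ℝ} (hab : a < b) (hcd : c < d) :
    ∃ L : ℝ → ℝ, Continuous L ∧ StrictMono L ∧ L a = c ∧ L b = d := by
  have h1 : 0 < b - a := sub_pos.2 hab
  have h2 : 0 < (d - c) / (b - a) := div_pos (sub_pos.2 hcd) h1
  refine ⟨fun x => c + (d - c) / (b - a) * (x - a), by fun_prop, fun x y hxy => ?_, by simp, ?_⟩
  · have := mul_lt_mul_of_pos_left (sub_lt_sub_right hxy a) h2
    simpa using this
  · field_simp
    ring

theorem StrictMono.ite_le {f g : ℝ → ℝ} {c : ℝ} (hf : StrictMono f) (hg : StrictMono g)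
    (hc : f c = g c) : StrictMono fun x => if x ≤ c then f x else g x := fun x y hxy => by
  by_cases hy : y ≤ c
  · simpa [hy, hxy.le.trans hy] using hf hxy
  · by_cases hx : x ≤ c
    · simp only [hx, hy, if_true, if_false]
      exact (hf.monotone hx).trans_lt (hc ▸ hg (not_le.1 hy))
    · simpa [hx, hy] using hg hxy

end LiftedHomeomorphisms

/-! ### A homeomorphism shrinking the limit set -/

namespace SchottkyArcs

variable {f₁ f₂ : Circle ≃ₜ Circle}

/-- Take `f₁` on N, which it maps into itself, the identity on E, S and W, and affine interpolation
on the two gaps next to N. The image of Λ misses the limit points `f₁ η` with η in W: they lie in N,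
but are not images of points of N. -/
theorem exists_homeomorph_ssubset (A : SchottkyArcs f₁ f₂) (h₁ : IsMobius f₁) (h₂ : IsMobius f₂) :
    ∃ f₄ : Circle ≃ₜ Circle, IsOrientationPreserving f₄ ∧
      f₄ '' schottkyLimitSet f₁ f₂ ⊂ schottkyLimitSet f₁ f₂ := by
  have l1 := A.lt_n
  have l2 := A.lt_ne
  have l3 := A.lt_e
  have l4 := A.lt_es
  have l5 := A.lt_s
  have l6 := A.lt_sw
  have l7 := A.lt_w
  have l8 := A.lt_wn
  have hF0 : A.n₀ < A.F₁ (A.n₀ + 2 * Real.pi) :=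
    A.map_s₁.symm.trans_lt (A.lift₁.strictMono (by linarith))
  have hF1 : A.F₁ (A.n₁ + 2 * Real.pi) < A.n₁ :=
    (A.lift₁.strictMono (by linarith)).trans_eq A.map_s₀
  -- The interpolations `L₁` and `L₂` cover the gaps before and after N. The whole map is written on
  -- the period starting at `e₀`, so N appears shifted by 2π.
  obtain ⟨L₁, hL₁c, hL₁m, hL₁a, hL₁b⟩ := exists_strictMono_affine l8
    (show A.w₁ < A.F₁ (A.n₀ + 2 * Real.pi) + 2 * Real.pi by linarith)
  obtain ⟨L₂, hL₂c, hL₂m, hL₂a, hL₂b⟩ := exists_strictMono_affine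
    (show A.n₁ + 2 * Real.pi < A.e₀ + 2 * Real.pi by linarith)
    (show A.F₁ (A.n₁ + 2 * Real.pi) + 2 * Real.pi < A.e₀ + 2 * Real.pi by linarith)
  have hF₁m : StrictMono fun x => A.F₁ x + 2 * Real.pi := fun x y hxy => by
    simpa using A.lift₁.strictMono hxy
  have hF₁c : Continuous fun x => A.F₁ x + 2 * Real.pi :=
    A.lift₁.continuous.add continuous_const
  let φ₁ : ℝ → ℝ := fun x => if x ≤ A.n₁ + 2 * Real.pi then A.F₁ x + 2 * Real.pi else L₂ x
  have h1m : StrictMono φ₁ := hF₁m.ite_le hL₂m hL₂a.symm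
  have h1c : Continuous φ₁ := hF₁c.if_le hL₂c continuous_id continuous_const
    fun x (hx : x = _) => by rw [hx, hL₂a]
  have h1a : L₁ (A.n₀ + 2 * Real.pi) = φ₁ (A.n₀ + 2 * Real.pi) := by
    rw [hL₁b]; simp only [φ₁]; rw [if_pos (by linarith)]
  let φ₂ : ℝ → ℝ := fun x => if x ≤ A.n₀ + 2 * Real.pi then L₁ x else φ₁ x
  have h2m : StrictMono φ₂ := hL₁m.ite_le h1m h1a
  have h2c : Continuous φ₂ := hL₁c.if_le h1c continuous_id continuous_const
    fun x (hx : x = _) => by rw [hx, h1a]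
  have h2a : id A.w₁ = φ₂ A.w₁ := by simp only [φ₂]; rw [if_pos l8.le, hL₁a, id]
  let φ₃ : ℝ → ℝ := fun x => if x ≤ A.w₁ then id x else φ₂ x
  have h3m : StrictMono φ₃ := strictMono_id.ite_le h2m h2a
  have h3c : Continuous φ₃ := continuous_id.if_le h2c continuous_id continuous_const
    fun x (hx : x = _) => by rw [hx, h2a]
  have hstart : ∀ x ≤ A.w₁, φ₃ x = x := fun x hx => by simp only [φ₃]; rw [if_pos hx, id]
  have hend : φ₃ (A.e₀ + 2 * Real.pi) = A.e₀ + 2 * Real.pi := by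
    simp only [φ₃, φ₂, φ₁]
    rw [if_neg (by linarith), if_neg (by linarith), if_neg (by linarith), hL₂b]
  have hN : ∀ x ∈ Set.Icc (A.n₀ + 2 * Real.pi) (A.n₁ + 2 * Real.pi),
      φ₃ x = A.F₁ x + 2 * Real.pi := fun x hx => by
    rcases hx.1.eq_or_lt with rfl | h
    · simp only [φ₃, φ₂]
      rw [if_neg (by linarith), if_pos le_rfl, hL₁b]
    · simp only [φ₃, φ₂, φ₁]
      rw [if_neg (by linarith), if_neg (by linarith), if_pos hx.2]
  have hs : φ₃ A.e₀ = A.e₀ := hstart _ (by linarith)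
  obtain ⟨f₄, hor, hf₄⟩ := exists_circle_homeomorph_of_strictMonoOn (a := A.e₀)
    (h3m.strictMonoOn _) hs hend (by
      have := intermediate_value_Icc (show A.e₀ ≤ A.e₀ + 2 * Real.pi by linarith [Real.pi_pos])
        h3c.continuousOn
      rwa [hs, hend] at this)
  have hfN : ∀ z ∈ A.arc (true, true), f₄ z = f₁ z := by
    rintro _ ⟨x, hx, rfl⟩
    rw [← Circle.exp_add_two_pi, hf₄ _ ⟨by linarith [hx.1], by linarith [hx.2]⟩,
      hN _ ⟨by linarith [hx.1], by linarith [hx.2]⟩, Circle.exp_add_two_pi, A.lift₁.exp_apply]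
  have hid : ∀ s ≠ (true, true), ∀ z ∈ A.arc s, f₄ z = z := by
    have : ∀ x, A.e₀ ≤ x → x ≤ A.w₁ → f₄ (Circle.exp x) = Circle.exp x := fun x h h' => by
      rw [hf₄ x ⟨h, by linarith⟩, hstart x h']
    rintro ⟨_ | _, _ | _⟩ hs
    · rintro _ ⟨x, hx, rfl⟩; exact this x (by linarith [hx.1]) (by linarith [hx.2])
    · rintro _ ⟨x, hx, rfl⟩; exact this x (by linarith [hx.1]) (by linarith [hx.2])
    · rintro _ ⟨x, hx, rfl⟩; exact this x (by linarith [hx.1]) (by linarith [hx.2])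
    · exact absurd rfl hs
  have hP := A.isPingPong
  have hΓ := IsPingPong.closure_le h₁ h₂
  have hf₁N : ∀ z ∈ A.arc (true, true), f₁ z ∈ A.arc (true, true) := fun z hz =>
    hP.maps (true, true) z (hP.notMem _ _ (by decide) _ hz)
  refine ⟨f₄, hor, ?_, fun hsub => ?_⟩
  · rintro _ ⟨z, hz, rfl⟩
    obtain ⟨s, hs⟩ := Set.mem_iUnion.1 (hP.limitSet_subset hz)
    by_cases h : s = (true, true)
    · subst h
      rw [hfN z hs]
      exact apply_mem_limitSet hΓ (freeLetter_mem (true, true)) hz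
    · rwa [hid s h z hs]
  -- A preimage of `f₁ η` in N would be η itself, by injectivity; a preimage in another arc would be
  -- fixed and hence lie in N. Both contradict disjointness of the arcs.
  · obtain ⟨η, hη, hηL⟩ := hP.exists_mem_limitSet h₁ h₂ (false, false)
    have h1 : f₁ η ∈ A.arc (true, true) :=
      hP.maps (true, true) η (hP.notMem _ _ (by decide) _ hη)
    obtain ⟨ζ, hζ, hζη⟩ := hsub (apply_mem_limitSet hΓ (freeLetter_mem (true, true)) hηL)
    replace hζη : f₄ ζ = f₁ η := hζη
    obtain ⟨s, hs⟩ := Set.mem_iUnion.1 (hP.limitSet_subset hζ)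
    by_cases h : s = (true, true)
    · subst h
      rw [hfN ζ hs] at hζη
      rw [f₁.injective hζη] at hs
      exact hP.notMem _ _ (by decide) _ hs hη
    · rw [hid s h ζ hs] at hζη
      rw [hζη] at hs
      exact hP.notMem _ _ h _ hs h1

end SchottkyArcs

/-! ### The complementary intervals form one orbit -/

theorem image_connectedComponentIn_compl_limitSet {Γ : Subgroup (Circle ≃ₜ Circle)}
    (hΓ : Γ ≤ mobiusSubgroup) {g : Circle ≃ₜ Circle} (hg : g ∈ Γ) {x : Circle}
    (hx : x ∉ limitSet Γ) : g '' connectedComponentIn (limitSet Γ)ᶜ x =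
      connectedComponentIn (limitSet Γ)ᶜ (g x) := by
  have himg : g '' (limitSet Γ)ᶜ = (limitSet Γ)ᶜ := by
    ext y
    obtain ⟨y, rfl⟩ := g.surjective y
    rw [g.injective.mem_set_image]
    exact (not_congr (apply_mem_limitSet_iff hΓ hg)).symm
  rw [Homeomorph.image_connectedComponentIn _ hx, himg]

/-- A chain of four connected subsets of the complement of the limit set whose translates meet
each other produces a complementary interval that is invariant under the commutator. -/
theorem exists_isCommutatorInterval_of_chain {f₁ f₂ : Circle ≃ₜ Circle} (h₁ : IsMobius f₁)
    (h₂ : IsMobius f₂) {A B C D : Set Circle} {a₀ a₁ b₀ b₁ c₀ c₁ d₀ d₁ : Circle}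
    (hA : IsPreconnected A) (hB : IsPreconnected B) (hC : IsPreconnected C) (hD : IsPreconnected D)
    (hsub : A ∪ B ∪ C ∪ D ⊆ (schottkyLimitSet f₁ f₂)ᶜ)
    (ha₀ : a₀ ∈ A) (ha₁ : a₁ ∈ A) (hb₀ : b₀ ∈ B) (hb₁ : b₁ ∈ B) (hc₀ : c₀ ∈ C) (hc₁ : c₁ ∈ C)
    (hd₀ : d₀ ∈ D) (hd₁ : d₁ ∈ D) (e₁ : f₂ a₀ = d₁) (e₂ : f₁ b₀ = a₁) (e₃ : f₂ b₁ = c₀)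
    (e₄ : f₁ c₁ = d₀)
    (hcov : ∀ x ∉ schottkyLimitSet f₁ f₂, ∃ g ∈ Subgroup.closure {f₁, f₂}, g x ∈ A ∪ B ∪ C ∪ D) :
    ∃ J, IsCommutatorInterval f₁ f₂ J ∧
      ∀ x ∉ schottkyLimitSet f₁ f₂, ∃ g ∈ Subgroup.closure {f₁, f₂}, g x ∈ J := by
  set Γ := Subgroup.closure {f₁, f₂} with hΓdef
  have hΓ : Γ ≤ mobiusSubgroup := IsPingPong.closure_le h₁ h₂
  have m1 : f₁ ∈ Γ := Subgroup.subset_closure (by simp)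
  have m2 : f₂ ∈ Γ := Subgroup.subset_closure (by simp)
  have hL : ∀ g ∈ Γ, ∀ x, g x ∈ (schottkyLimitSet f₁ f₂)ᶜ ↔ x ∈ (schottkyLimitSet f₁ f₂)ᶜ :=
    fun g hg x => not_congr (apply_mem_limitSet_iff hΓ hg)
  have mf : f₁ * f₂ * f₁⁻¹ * f₂⁻¹ ∈ Γ :=
    mul_mem (mul_mem (mul_mem m1 m2) (inv_mem m1)) (inv_mem m2)
  have m3 : f₁ * f₂ * f₁⁻¹ ∈ Γ := mul_mem (mul_mem m1 m2) (inv_mem m1)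
  have m4 : f₁ * f₂ ∈ Γ := mul_mem m1 m2
  have i₁ : f₂⁻¹ d₁ = a₀ := by rw [← e₁]; simp
  have i₂ : f₁⁻¹ a₁ = b₀ := by rw [← e₂]; simp
  -- Consecutive translates in this chain share a point, so T is connected. It runs from `d₁` to the
  -- image of `d₁` under the commutator, because `f₂⁻¹ d₁ = a₀`; hence both lie in the same
  -- component. As T contains a translate of each of the four sets, that component meets the orbit
  -- of every point outside Λ.
  let T : Set Circle := D ∪ (f₁ '' C ∪ ((f₁ * f₂) '' B ∪ (f₁ * f₂ * f₁⁻¹) '' A))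
  have im : ∀ (g : Circle ≃ₜ Circle) {S : Set Circle}, IsPreconnected S →
      IsPreconnected (g '' S) := fun g S hS => hS.image _ g.continuous.continuousOn
  have hT : IsPreconnected T := by
    refine IsPreconnected.union d₀ hd₀ (Or.inl ⟨c₁, hc₁, e₄⟩) hD ?_
    refine IsPreconnected.union (f₁ c₀) ⟨c₀, hc₀, rfl⟩ (Or.inl ⟨b₁, hb₁, ?_⟩) (im _ hC) ?_
    · rw [Homeomorph.mul_apply, e₃]
    refine IsPreconnected.union ((f₁ * f₂) b₀) ⟨b₀, hb₀, rfl⟩ ⟨a₁, ha₁, ?_⟩ (im _ hB) (im _ hA)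
    rw [Homeomorph.mul_apply, i₂]
  have hTL : T ⊆ (schottkyLimitSet f₁ f₂)ᶜ := by
    rintro x (hx | ⟨y, hy, rfl⟩ | ⟨y, hy, rfl⟩ | ⟨y, hy, rfl⟩)
    · exact hsub (Or.inr hx)
    · exact (hL _ m1 _).2 (hsub (Or.inl (Or.inr hy)))
    · exact (hL _ m4 _).2 (hsub (Or.inl (Or.inl (Or.inr hy))))
    · exact (hL _ m3 _).2 (hsub (Or.inl (Or.inl (Or.inl hy))))
  have hTJ : T ⊆ connectedComponentIn (schottkyLimitSet f₁ f₂)ᶜ d₁ :=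
    hT.subset_connectedComponentIn (Or.inl hd₁) hTL
  have hd₁L : d₁ ∈ (schottkyLimitSet f₁ f₂)ᶜ := hTL (Or.inl hd₁)
  refine ⟨connectedComponentIn (schottkyLimitSet f₁ f₂)ᶜ d₁, ⟨⟨d₁, hd₁L, rfl⟩, ?_⟩, ?_⟩
  · refine (image_connectedComponentIn_compl_limitSet hΓ mf hd₁L).trans ?_
    refine (connectedComponentIn_eq (hTJ (Or.inr (Or.inr (Or.inr ⟨a₀, ha₀, ?_⟩))))).symm
    rw [Homeomorph.mul_apply (f₁ * f₂ * f₁⁻¹) f₂⁻¹, i₁]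
  · intro x hx
    obtain ⟨g, hg, ((h | h) | h) | h⟩ := hcov x hx
    · exact ⟨_, mul_mem m3 hg, hTJ (Or.inr (Or.inr (Or.inr ⟨_, h, rfl⟩)))⟩
    · exact ⟨_, mul_mem m4 hg, hTJ (Or.inr (Or.inr (Or.inl ⟨_, h, rfl⟩)))⟩
    · exact ⟨_, mul_mem m1 hg, hTJ (Or.inr (Or.inl ⟨_, h, rfl⟩))⟩
    · exact ⟨_, hg, hTJ (Or.inl h)⟩

theorem closure_pair_inv_right (f₁ f₂ : Circle ≃ₜ Circle) :
    Subgroup.closure {f₁, f₂⁻¹} = Subgroup.closure {f₁, f₂} := by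
  refine le_antisymm ((Subgroup.closure_le _).2 ?_) ((Subgroup.closure_le _).2 ?_)
  · rintro _ (rfl | rfl)
    · exact Subgroup.subset_closure (by simp)
    · exact inv_mem (Subgroup.subset_closure (by simp))
  · rintro x (hx | hx)
    · exact Subgroup.subset_closure (by simp [hx])
    · rw [hx, ← inv_inv f₂]
      exact inv_mem (Subgroup.subset_closure (by simp))

theorem schottkyLimitSet_inv_right (f₁ f₂ : Circle ≃ₜ Circle) :
    schottkyLimitSet f₁ f₂⁻¹ = schottkyLimitSet f₁ f₂ := by
  rw [schottkyLimitSet, schottkyLimitSet, closure_pair_inv_right]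

theorem IsMobius.inv {f : Circle ≃ₜ Circle} (h : IsMobius f) : IsMobius f⁻¹ :=
  mobiusSubgroup.inv_mem h

theorem isPreconnected_circleArc (a b : ℝ) : IsPreconnected (circleArc a b) :=
  isPreconnected_Icc.image _ Circle.exp.continuous.continuousOn

theorem left_mem_circleArc {a b : ℝ} (h : a ≤ b) : Circle.exp a ∈ circleArc a b :=
  ⟨a, Set.left_mem_Icc.2 h, rfl⟩

theorem right_mem_circleArc {a b : ℝ} (h : a ≤ b) : Circle.exp b ∈ circleArc a b :=
  ⟨b, Set.right_mem_Icc.2 h, rfl⟩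

namespace IsPuncturedTorusSchottky

variable {f₁ f₂ : Circle ≃ₜ Circle}

/-- By taking complements, mapping the outside of E into W is the same as having the inverse map the
outside of W into E. Replacing `f₂` by its inverse changes neither the group nor Λ. -/
theorem schottkyArcs (h : IsPuncturedTorusSchottky f₁ f₂) :
    Nonempty (SchottkyArcs f₁ f₂) ∨ Nonempty (SchottkyArcs f₁ f₂⁻¹) := by
  obtain ⟨h₁, h₂, t, ht, h7, hN, hE | hE⟩ := h
  · exact Or.inl (SchottkyArcs.nonempty_of_arcs h₁ h₂ ht h7 hN hE)
  · refine Or.inr (SchottkyArcs.nonempty_of_arcs h₁ h₂.inv ht h7 hN ?_)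
    rintro _ ⟨z, hz, rfl⟩
    by_contra hcon
    exact hz (hE ⟨_, hcon, by simp⟩)

theorem closure_le (h : IsPuncturedTorusSchottky f₁ f₂) :
    Subgroup.closure {f₁, f₂} ≤ mobiusSubgroup := IsPingPong.closure_le h.1 h.2.1

theorem isCantorSet (h : IsPuncturedTorusSchottky f₁ f₂) :
    IsCantorSet (schottkyLimitSet f₁ f₂) := by
  obtain ⟨⟨A⟩⟩ | ⟨⟨A⟩⟩ := h.schottkyArcs
  · exact ⟨A.isPingPong.nonempty_limitSet h.1, A.isPingPong.perfect_limitSet h.1 h.2.1,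
      Circle.isTotallyDisconnected_of_interior_eq_empty (A.isPingPong.interior_limitSet h.1 h.2.1)⟩
  · rw [← schottkyLimitSet_inv_right]
    exact ⟨A.isPingPong.nonempty_limitSet h.1, A.isPingPong.perfect_limitSet h.1 h.2.1.inv,
      Circle.isTotallyDisconnected_of_interior_eq_empty
        (A.isPingPong.interior_limitSet h.1 h.2.1.inv)⟩

theorem interior_limitSet (h : IsPuncturedTorusSchottky f₁ f₂) :
    interior (schottkyLimitSet f₁ f₂) = ∅ := by
  obtain ⟨⟨A⟩⟩ | ⟨⟨A⟩⟩ := h.schottkyArcs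
  · exact A.isPingPong.interior_limitSet h.1 h.2.1
  · rw [← schottkyLimitSet_inv_right]
    exact A.isPingPong.interior_limitSet h.1 h.2.1.inv

theorem limitSet_nontrivial (h : IsPuncturedTorusSchottky f₁ f₂) :
    (schottkyLimitSet f₁ f₂).Nontrivial := by
  obtain ⟨⟨x, hx⟩, hp, -⟩ := h.isCantorSet
  obtain ⟨y, hy, hyx⟩ := accPt_iff_nhds.1 (hp.2 x hx) Set.univ Filter.univ_mem
  exact ⟨x, hx, y, hy.2, hyx.symm⟩

theorem limitSet_subset_of_invariant (h : IsPuncturedTorusSchottky f₁ f₂) {K : Set Circle}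
    (hK : IsClosed K) (hn : K.Nonempty)
    (hinv : ∀ g ∈ Subgroup.closure {f₁, f₂}, ∀ x ∈ K, g x ∈ K) :
    schottkyLimitSet f₁ f₂ ⊆ K := by
  obtain ⟨⟨A⟩⟩ | ⟨⟨A⟩⟩ := h.schottkyArcs
  · exact A.isPingPong.limitSet_subset_of_invariant hK hn hinv
  · rw [← schottkyLimitSet_inv_right]
    rw [← closure_pair_inv_right] at hinv
    exact A.isPingPong.limitSet_subset_of_invariant hK hn hinv

theorem commutator_ne_one (h : IsPuncturedTorusSchottky f₁ f₂) :
    f₁ * f₂ * f₁⁻¹ * f₂⁻¹ ≠ 1 := by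
  obtain ⟨⟨A⟩⟩ | ⟨⟨A⟩⟩ := h.schottkyArcs
  · exact A.isPingPong.commutator_ne_one
  · intro hone
    refine A.isPingPong.commutator_ne_one ?_
    rw [← commutatorElement_def, commutatorElement_eq_one_iff_commute] at hone ⊢
    exact hone.inv_right

theorem exists_homeomorph_ssubset (h : IsPuncturedTorusSchottky f₁ f₂) :
    ∃ f₄ : Circle ≃ₜ Circle, IsOrientationPreserving f₄ ∧
      f₄ '' schottkyLimitSet f₁ f₂ ⊂ schottkyLimitSet f₁ f₂ := by
  obtain ⟨⟨A⟩⟩ | ⟨⟨A⟩⟩ := h.schottkyArcs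
  · exact A.exists_homeomorph_ssubset h.1 h.2.1
  · rw [← schottkyLimitSet_inv_right]
    exact A.exists_homeomorph_ssubset h.1 h.2.1.inv

theorem exists_isCommutatorInterval (h : IsPuncturedTorusSchottky f₁ f₂) :
    ∃ J, IsCommutatorInterval f₁ f₂ J ∧
      ∀ x ∉ schottkyLimitSet f₁ f₂, ∃ g ∈ Subgroup.closure {f₁, f₂}, g x ∈ J := by
  obtain ⟨⟨A⟩⟩ | ⟨⟨A⟩⟩ := h.schottkyArcs
  · have hgaps : circleArc A.w₁ (A.n₀ + 2 * Real.pi) ∪ circleArc A.s₁ A.w₀ ∪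
        circleArc A.e₁ A.s₀ ∪ circleArc A.n₁ A.e₀ = A.gaps := by
      ext; simp only [SchottkyArcs.gaps, Set.mem_union]; tauto
    refine exists_isCommutatorInterval_of_chain h.1 h.2.1
      (isPreconnected_circleArc A.w₁ (A.n₀ + 2 * Real.pi)) (isPreconnected_circleArc A.s₁ A.w₀)
      (isPreconnected_circleArc A.e₁ A.s₀) (isPreconnected_circleArc A.n₁ A.e₀)
      (hgaps ▸ A.gaps_subset h.1 h.2.1)
      (left_mem_circleArc A.lt_wn.le) (right_mem_circleArc A.lt_wn.le)
      (left_mem_circleArc A.lt_sw.le) (right_mem_circleArc A.lt_sw.le)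
      (left_mem_circleArc A.lt_es.le) (right_mem_circleArc A.lt_es.le)
      (left_mem_circleArc A.lt_ne.le) (right_mem_circleArc A.lt_ne.le)
      A.apply_exp_w₁ ?_ A.apply_exp_w₀ A.apply_exp_s₀ fun x hx => ?_
    · rw [A.apply_exp_s₁, Circle.exp_add_two_pi]
    · rw [hgaps]
      exact A.isPingPong.exists_apply_mem h.1 h.2.1
        (fun y hy => A.exists_letter_of_notMem_gaps hy) hx
  -- With `f₂` inverted, the chain of gaps is traversed in the opposite order, with left and right
  -- ends exchanged.
  · have hgaps : circleArc A.n₁ A.e₀ ∪ circleArc A.e₁ A.s₀ ∪ circleArc A.s₁ A.w₀ ∪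
        circleArc A.w₁ (A.n₀ + 2 * Real.pi) = A.gaps := rfl
    have hsub := A.gaps_subset h.1 h.2.1.inv
    rw [schottkyLimitSet_inv_right] at hsub
    have sw : ∀ {x y : Circle}, f₂⁻¹ x = y → f₂ y = x := by
      rintro x _ rfl
      simp
    refine exists_isCommutatorInterval_of_chain h.1 h.2.1
      (isPreconnected_circleArc A.n₁ A.e₀) (isPreconnected_circleArc A.e₁ A.s₀)
      (isPreconnected_circleArc A.s₁ A.w₀) (isPreconnected_circleArc A.w₁ (A.n₀ + 2 * Real.pi))
      hsub
      (right_mem_circleArc A.lt_ne.le) (left_mem_circleArc A.lt_ne.le)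
      (right_mem_circleArc A.lt_es.le) (left_mem_circleArc A.lt_es.le)
      (right_mem_circleArc A.lt_sw.le) (left_mem_circleArc A.lt_sw.le)
      (right_mem_circleArc A.lt_wn.le) (left_mem_circleArc A.lt_wn.le)
      (sw A.apply_exp_w₁) A.apply_exp_s₀ (sw A.apply_exp_w₀) ?_ fun x hx => ?_
    · rw [A.apply_exp_s₁, Circle.exp_add_two_pi]
    · rw [hgaps, ← closure_pair_inv_right]
      rw [← schottkyLimitSet_inv_right] at hx
      exact A.isPingPong.exists_apply_mem h.1 h.2.1.inv
        (fun y hy => A.exists_letter_of_notMem_gaps hy) hx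

end IsPuncturedTorusSchottky

/-! ### Maps preserving an arc -/

theorem exp_left_notMem_arc {α β : ℝ} (hβ : β < α + 2 * Real.pi) :
    Circle.exp α ∉ Circle.exp '' Set.Ioo α β := by
  rintro ⟨y, hy, hyx⟩
  have := Circle.eq_of_exp_eq_exp hyx (by linarith [hy.2]) (by linarith [hy.1, Real.pi_pos])
  linarith [hy.1]

theorem exp_right_notMem_arc {α β : ℝ} (hβ : β < α + 2 * Real.pi) :
    Circle.exp β ∉ Circle.exp '' Set.Ioo α β := by
  rintro ⟨y, hy, hyx⟩
  have := Circle.eq_of_exp_eq_exp hyx (by linarith [hy.2, Real.pi_pos]) (by linarith [hy.1])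
  linarith [hy.2]

/-- A lift of a map preserving an arc can be normalized to fix the end points of the arc. -/
theorem IsCircleLift.exists_fixing {f : Circle ≃ₜ Circle} {F : ℝ → ℝ} (hF : IsCircleLift f F)
    {α β : ℝ} (hαβ : α < β) (hβ : β < α + 2 * Real.pi)
    (hJ : f '' (Circle.exp '' Set.Ioo α β) = Circle.exp '' Set.Ioo α β) :
    ∃ F', IsCircleLift f F' ∧ F' α = α ∧ F' β = β := by
  have hmem : ∀ z, f z ∈ Circle.exp '' Set.Ioo α β ↔ z ∈ Circle.exp '' Set.Ioo α β := fun z => by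
    conv_lhs => rw [← hJ]
    exact f.injective.mem_set_image
  have hm : (α + β) / 2 ∈ Set.Ioo α β := ⟨by linarith, by linarith⟩
  obtain ⟨y, hy, hyx⟩ := (hmem (Circle.exp ((α + β) / 2))).2 ⟨_, hm, rfl⟩
  rw [hF.exp_apply] at hyx
  obtain ⟨k, rfl⟩ := Circle.exp_eq_exp.1 hyx
  obtain ⟨G, hG, hy⟩ : ∃ G, IsCircleLift f G ∧ G ((α + β) / 2) ∈ Set.Ioo α β :=
    ⟨_, hF.add_int k, hy⟩
  refine ⟨G, hG, ?_⟩
  -- The lift cannot cross α or β on the open interval, and the midpoint stays inside, so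
  -- connectedness confines it to the closed interval. End points are not sent into the open arc,
  -- which leaves them fixed since the lift is increasing.
  have hne : ∀ x ∈ Set.Ioo α β, G x ≠ α ∧ G x ≠ β := fun x hx => by
    have : Circle.exp (G x) ∈ Circle.exp '' Set.Ioo α β := by
      rw [← hG.exp_apply]; exact (hmem _).2 ⟨x, hx, rfl⟩
    exact ⟨fun h => exp_left_notMem_arc hβ (h ▸ this), fun h => exp_right_notMem_arc hβ (h ▸ this)⟩
  have hmaps : ∀ x ∈ Set.Ioo α β, G x ∈ Set.Icc α β := fun x hx => by
    have hpre := (isPreconnected_Ioo (a := α) (b := β)).image G hG.continuous.continuousOn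
    constructor
    · by_contra! hlt
      obtain ⟨x', hx', h⟩ := hpre.Icc_subset ⟨x, hx, rfl⟩ ⟨_, hm, rfl⟩ ⟨hlt.le, hy.1.le⟩
      exact (hne x' hx').1 h
    · by_contra! hlt
      obtain ⟨x', hx', h⟩ := hpre.Icc_subset ⟨_, hm, rfl⟩ ⟨x, hx, rfl⟩ ⟨hy.2.le, hlt.le⟩
      exact (hne x' hx').2 h
  have hcl : ∀ x ∈ Set.Icc α β, G x ∈ Set.Icc α β := fun x hx => by
    rw [← closure_Ioo hαβ.ne] at hx
    exact closure_minimal (t := G ⁻¹' Set.Icc α β) hmaps (isClosed_Icc.preimage hG.continuous) hx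
  have hα := hcl α ⟨le_rfl, hαβ.le⟩
  have hb := hcl β ⟨hαβ.le, le_rfl⟩
  have hlt := hG.strictMono hαβ
  have hα' : Circle.exp (G α) ∉ Circle.exp '' Set.Ioo α β := by
    rw [← hG.exp_apply, hmem]; exact exp_left_notMem_arc hβ
  have hb' : Circle.exp (G β) ∉ Circle.exp '' Set.Ioo α β := by
    rw [← hG.exp_apply, hmem]; exact exp_right_notMem_arc hβ
  constructor
  · by_contra hc
    exact hα' ⟨G α, ⟨lt_of_le_of_ne hα.1 (Ne.symm hc), by linarith [hb.2]⟩, rfl⟩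
  · by_contra hc
    exact hb' ⟨G β, ⟨by linarith [hα.1], lt_of_le_of_ne hb.2 hc⟩, rfl⟩

/-! ### Moebius flows with two fixed points -/

section HyperbolicPencil

/-- A Moebius map with two fixed points on the circle multiplies their cross ratio coordinate by a
positive number. -/
theorem IsMobius.exists_multiplier {f : Circle ≃ₜ Circle} (hf : IsMobius f) {p q : Circle}
    (hpq : p ≠ q) (hp : f p = p) (hq : f q = q) : ∃ l : ℝ, 0 < l ∧
      ∀ z : Circle, ((f z : ℂ) - p) * (z - q) = l * (z - p) * (f z - q) := by
  obtain ⟨a, b, hab⟩ := hf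
  have hne : ∀ z : Circle, conj b * (z : ℂ) + conj a ≠ 0 := fun z =>
    discMobius_denom_ne_zero hab.1 (Circle.norm_coe z).le
  have hzz : ∀ z : Circle, (z : ℂ) * conj (z : ℂ) = 1 := fun z => by
    rw [Complex.mul_conj, Circle.normSq_coe, Complex.ofReal_one]
  -- The numerator being z times the conjugate denominator, a fixed point makes the denominator
  -- real.
  have hreal : ∀ z : Circle, f z = z → ∃ r : ℝ, conj b * (z : ℂ) + conj a = r := fun z hz => by
    have h1 := hab.2 z
    rw [hz, discMobius, eq_div_iff (hne z)] at h1
    refine Complex.conj_eq_iff_real.1 ?_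
    simp only [map_add, map_mul, Complex.conj_conj]
    linear_combination (-(conj (z : ℂ))) * h1 - (a - (conj b * (z : ℂ) + conj a)) * hzz z
  obtain ⟨r, hr⟩ := hreal p hp
  obtain ⟨s, hs⟩ := hreal q hq
  have hr0 : (r : ℂ) ≠ 0 := hr ▸ hne p
  have hs0 : (s : ℂ) ≠ 0 := hs ▸ hne q
  have hpq' : (p : ℂ) - q ≠ 0 := sub_ne_zero.2 fun h => hpq (Circle.ext h)
  -- The chord formula at the pair (p, q) yields this identity, so r and s have the same sign and
  -- the multiplier s/r is positive.
  have hD : r * s = Complex.normSq a - Complex.normSq b := by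
    have := hab.sub_apply p q
    rw [hp, hq, hr, hs, eq_div_iff (mul_ne_zero hr0 hs0), mul_comm] at this
    have := mul_right_cancel₀ hpq' this
    exact_mod_cast this
  have hpos : 0 < r * s := hD ▸ sub_pos.2 (norm_lt_norm_iff_normSq.1 hab.1)
  refine ⟨s / r, ?_, fun z => ?_⟩
  · rcases mul_pos_iff.1 hpos with ⟨h1, h2⟩ | ⟨h1, h2⟩
    · exact div_pos h2 h1
    · exact div_pos_of_neg_of_neg h2 h1
  · have e1 := hab.sub_apply z p
    have e2 := hab.sub_apply z q
    rw [hp, hr] at e1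
    rw [hq, hs] at e2
    have hz := hne z
    rw [e1, e2]
    push_cast
    field_simp

/-- A third fixed point forces the multiplier to be 1, and then the cross ratio coordinate of every
point is unchanged. -/
theorem IsMobius.eq_one_of_apply_eq {f : Circle ≃ₜ Circle} (hf : IsMobius f) {p q z : Circle}
    (hpq : p ≠ q) (hp : f p = p) (hq : f q = q) (hzp : z ≠ p) (hzq : z ≠ q) (hz : f z = z) :
    f = 1 := by
  obtain ⟨l, -, hl⟩ := hf.exists_multiplier hpq hp hq
  have hpq' : (p : ℂ) - q ≠ 0 := sub_ne_zero.2 fun h => hpq (Circle.ext h)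
  have hzp' : (z : ℂ) - p ≠ 0 := sub_ne_zero.2 fun h => hzp (Circle.ext h)
  have hzq' : (z : ℂ) - q ≠ 0 := sub_ne_zero.2 fun h => hzq (Circle.ext h)
  have h1 := hl z
  rw [hz] at h1
  have hl1 : (l : ℂ) = 1 := by
    have := mul_ne_zero hzp' hzq'
    refine mul_right_cancel₀ this ?_
    linear_combination -h1
  ext y
  have h2 := hl y
  rw [hl1] at h2
  have h3 : (f y : ℂ) = y := by
    refine mul_left_cancel₀ hpq' ?_
    linear_combination h2
  simpa using h3

/-- The point whose cross ratio coordinate with respect to `p, q` is `k` times that of `z`. -/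
def pencilPoint (p q z : ℂ) (k : ℝ) : ℂ :=
  ((p - k * q) * z + (k - 1) * (p * q)) / ((1 - k) * z + (k * p - q))

variable {p q : Circle} {k l : ℝ}

/-- A zero would require |kp − q| = |k − 1|, but |kp − q|² = (k − 1)² + k|p − q|². -/
theorem pencilPoint_denom_ne_zero (hpq : p ≠ q) (hk : 0 < k) (z : Circle) :
    (1 - k) * (z : ℂ) + (k * p - q) ≠ 0 := by
  intro h0
  have h1 : (k : ℂ) * p - q = (k - 1) * z := by linear_combination h0
  have h2 : Complex.normSq ((k : ℂ) * p - q) = (k - 1) ^ 2 := by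
    rw [h1, map_mul, Circle.normSq_coe, mul_one, ← Complex.ofReal_one, ← Complex.ofReal_sub,
      Complex.normSq_ofReal, sq]
  have h3 : Complex.normSq ((k : ℂ) * p - q) =
      (k - 1) ^ 2 + k * Complex.normSq ((p : ℂ) - q) := by
    have hp := Circle.normSq_coe p
    have hq := Circle.normSq_coe q
    rw [Complex.normSq_apply] at hp hq
    simp only [Complex.normSq_apply, Complex.sub_re, Complex.mul_re, Complex.sub_im,
      Complex.mul_im, Complex.ofReal_re, Complex.ofReal_im]
    linear_combination (k ^ 2 - k) * hp + (1 - k) * hq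
  have h4 : 0 < Complex.normSq ((p : ℂ) - q) :=
    Complex.normSq_pos.2 (sub_ne_zero.2 fun h => hpq (Circle.ext h))
  have := mul_pos hk h4
  linarith

theorem norm_pencilPoint (hpq : p ≠ q) (hk : 0 < k) (z : Circle) : ‖pencilPoint p q z k‖ = 1 := by
  have hd := pencilPoint_denom_ne_zero hpq hk z
  have hzz : ∀ z : Circle, (z : ℂ) * conj (z : ℂ) = 1 := fun z => by
    rw [Complex.mul_conj, Circle.normSq_coe, Complex.ofReal_one]
  have : ((p : ℂ) - k * q) * (z : ℂ) + (k - 1) * (p * q) =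
      -(z * p * q) * conj ((1 - k) * (z : ℂ) + (k * p - q)) := by
    simp only [map_add, map_mul, map_sub, map_one, Complex.conj_ofReal]
    linear_combination ((1 - k) * p * q) * hzz z + (k * z * q) * hzz p - (z * p) * hzz q
  rw [pencilPoint, this, norm_div, norm_mul, norm_neg, norm_mul, norm_mul, Circle.norm_coe,
    Circle.norm_coe, Circle.norm_coe, Complex.norm_conj, one_mul, one_mul, one_mul,
    div_self (norm_ne_zero_iff.2 hd)]

theorem pencilPoint_sub_left (hpq : p ≠ q) (hk : 0 < k) (z : Circle) :
    pencilPoint p q z k - p = k * (p - q) * (z - p) / ((1 - k) * (z : ℂ) + (k * p - q)) := by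
  have hd := pencilPoint_denom_ne_zero hpq hk z
  rw [pencilPoint, div_sub' hd]
  congr 1
  ring

theorem pencilPoint_sub_right (hpq : p ≠ q) (hk : 0 < k) (z : Circle) :
    pencilPoint p q z k - q = (p - q) * (z - q) / ((1 - k) * (z : ℂ) + (k * p - q)) := by
  have hd := pencilPoint_denom_ne_zero hpq hk z
  rw [pencilPoint, div_sub' hd]
  congr 1
  ring

/-- The form free of denominators makes composition visible: multipliers multiply. -/
theorem eq_pencilPoint_iff (hpq : p ≠ q) (hk : 0 < k) (z : Circle) {w : ℂ} :
    w = pencilPoint p q z k ↔ (w - p) * (z - q) = k * (z - p) * (w - q) := by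
  have hd := pencilPoint_denom_ne_zero hpq hk z
  rw [pencilPoint, eq_div_iff hd]
  constructor <;> intro h <;> linear_combination h

/-- The flow of Moebius maps fixing `p` and `q` with multiplier `exp (c * t)`. -/
def pencilFlow (p q : Circle) (hpq : p ≠ q) (c t : ℝ) (z : Circle) : Circle :=
  ⟨pencilPoint p q z (Real.exp (c * t)),
    mem_sphere_zero_iff_norm.2 (norm_pencilPoint hpq (Real.exp_pos _) z)⟩

theorem coe_pencilFlow (hpq : p ≠ q) (c t : ℝ) (z : Circle) :
    (pencilFlow p q hpq c t z : ℂ) = pencilPoint p q z (Real.exp (c * t)) := rfl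

theorem pencilFlow_zero (hpq : p ≠ q) (c : ℝ) (z : Circle) : pencilFlow p q hpq c 0 z = z := by
  apply Circle.ext
  rw [coe_pencilFlow]
  symm
  rw [eq_pencilPoint_iff hpq (Real.exp_pos _)]
  simp only [mul_zero, Real.exp_zero, Complex.ofReal_one]
  ring

theorem pencilFlow_ne_left (hpq : p ≠ q) (c t : ℝ) {z : Circle} (hz : z ≠ p) :
    pencilFlow p q hpq c t z ≠ p := by
  intro h
  have h1 := pencilPoint_sub_left hpq (Real.exp_pos (c * t)) z
  rw [← coe_pencilFlow hpq, h, sub_self, eq_comm,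
    div_eq_zero_iff, or_iff_left (pencilPoint_denom_ne_zero hpq (Real.exp_pos _) z), mul_eq_zero,
    mul_eq_zero] at h1
  rcases h1 with (h1 | h1) | h1
  · exact (Real.exp_pos _).ne' (by exact_mod_cast h1)
  · exact hpq (Circle.ext (sub_eq_zero.1 h1))
  · exact hz (Circle.ext (sub_eq_zero.1 h1))

theorem pencilFlow_ne_right (hpq : p ≠ q) (c t : ℝ) {z : Circle} (hz : z ≠ q) :
    pencilFlow p q hpq c t z ≠ q := by
  intro h
  have h1 := pencilPoint_sub_right hpq (Real.exp_pos (c * t)) z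
  rw [← coe_pencilFlow hpq, h, sub_self, eq_comm,
    div_eq_zero_iff, or_iff_left (pencilPoint_denom_ne_zero hpq (Real.exp_pos _) z),
    mul_eq_zero] at h1
  rcases h1 with h1 | h1
  · exact hpq (Circle.ext (sub_eq_zero.1 h1))
  · exact hz (Circle.ext (sub_eq_zero.1 h1))

theorem pencilFlow_add (hpq : p ≠ q) (c s t : ℝ) {z : Circle} (hz : z ≠ q) :
    pencilFlow p q hpq c (s + t) z = pencilFlow p q hpq c s (pencilFlow p q hpq c t z) := by
  apply Circle.ext
  rw [coe_pencilFlow _ _ (s + t)]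
  symm
  rw [eq_pencilPoint_iff hpq (Real.exp_pos _)]
  have h1 := (eq_pencilPoint_iff hpq (Real.exp_pos (c * t)) z).1 (coe_pencilFlow hpq c t z)
  have h2 := (eq_pencilPoint_iff hpq (Real.exp_pos (c * s)) (pencilFlow p q hpq c t z)).1
    (coe_pencilFlow hpq c s _)
  have h3 : (pencilFlow p q hpq c t z : ℂ) - q ≠ 0 :=
    sub_ne_zero.2 fun h => pencilFlow_ne_right hpq c t hz (Circle.ext h)
  refine mul_right_cancel₀ h3 ?_
  rw [mul_add, Real.exp_add]
  push_cast at h1 h2 ⊢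
  generalize (pencilFlow p q hpq c t z : ℂ) = w at *
  generalize Complex.exp (c * t) = k at *
  generalize Complex.exp (c * s) = l at *
  generalize (pencilFlow p q hpq c s (pencilFlow p q hpq c t z) : ℂ) = y at *
  linear_combination (z - q : ℂ) * h2 + l * (y - q) * h1

/-- The vector field generating `pencilFlow`. -/
def pencilField (p q : Circle) (c : ℝ) (z : Circle) : ℝ :=
  ((c : ℂ) * (z - p) * (z - q) / (p - q) * (-Complex.I) * ((z⁻¹ : Circle) : ℂ)).re

/-- Conjugation is inversion on the circle, and the complex expression is invariant under it; the
real part in the definition discards nothing. -/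
theorem coe_pencilField (hpq : p ≠ q) (c : ℝ) (z : Circle) : (pencilField p q c z : ℂ) =
    (c : ℂ) * (z - p) * (z - q) / (p - q) * (-Complex.I) * ((z⁻¹ : Circle) : ℂ) := by
  have hpq' : (p : ℂ) - q ≠ 0 := sub_ne_zero.2 fun h => hpq (Circle.ext h)
  have hpq'' : (q : ℂ) - p ≠ 0 := sub_ne_zero.2 fun h => hpq (Circle.ext h.symm)
  have hc : ∀ w : Circle, conj (w : ℂ) = (w : ℂ)⁻¹ := fun w => by
    rw [← Circle.coe_inv_eq_conj, Circle.coe_inv]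
  rw [pencilField, ← Complex.conj_eq_iff_re]
  simp only [map_mul, map_div₀, map_sub, map_neg, Complex.conj_I, Complex.conj_ofReal,
    Circle.coe_inv, map_inv₀, hc, inv_inv]
  have h1 := z.coe_ne_zero
  have h2 := p.coe_ne_zero
  have h3 := q.coe_ne_zero
  have h4 : ((p : ℂ)⁻¹ - (q : ℂ)⁻¹) = (q - p) / (p * q) := by field_simp
  rw [h4]
  field_simp
  ring

/-- The cross ratio (w − p)/(w − q) grows like exp(ct), which amounts to w' = c(w − p)(w − q)/(p −
q). -/
theorem hasDerivAt_pencilFlow (hpq : p ≠ q) (c t : ℝ) (z : Circle) :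
    HasDerivAt (fun s => (pencilFlow p q hpq c s z : ℂ))
      ((pencilField p q c (pencilFlow p q hpq c t z) : ℂ) *
        (Complex.I * (pencilFlow p q hpq c t z : ℂ))) t := by
  have hd := pencilPoint_denom_ne_zero hpq (Real.exp_pos (c * t)) z
  have hk : HasDerivAt (fun s : ℝ => ((Real.exp (c * s) : ℝ) : ℂ))
      ((Real.exp (c * t) * c : ℝ) : ℂ) t := by
    have h := ((hasDerivAt_id t).const_mul c).exp
    rw [mul_one] at h
    exact h.ofReal_comp
  have hN := ((hk.mul_const (q : ℂ)).const_sub (p : ℂ)).mul_const (z : ℂ) |>.add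
    ((hk.sub_const (1 : ℂ)).mul_const ((p : ℂ) * q))
  have hD := ((hk.const_sub (1 : ℂ)).mul_const (z : ℂ)).add ((hk.mul_const (p : ℂ)).sub_const (q : ℂ))
  have h := hN.div hD hd
  refine h.congr_deriv ?_
  have hw := (pencilFlow p q hpq c t z).coe_ne_zero
  have e : (pencilField p q c (pencilFlow p q hpq c t z) : ℂ) *
      (Complex.I * (pencilFlow p q hpq c t z : ℂ)) =
      c * (pencilFlow p q hpq c t z - p) * (pencilFlow p q hpq c t z - q) / (p - q) := by
    rw [coe_pencilField hpq, Circle.coe_inv]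
    have := Complex.I_mul_I
    field_simp
    rw [Complex.I_sq]
    ring
  have hpq' : (p : ℂ) - q ≠ 0 := sub_ne_zero.2 fun h => hpq (Circle.ext h)
  rw [e, coe_pencilFlow, pencilPoint_sub_left hpq (Real.exp_pos _),
    pencilPoint_sub_right hpq (Real.exp_pos _)]
  push_cast at hd ⊢
  field_simp
  simp only [Pi.add_apply]
  ring

theorem contDiff_pencilField (p q : Circle) (c : ℝ) :
    ContDiff ℝ ∞ fun θ : ℝ => pencilField p q c (Circle.exp θ) := by
  have h1 : ContDiff ℝ ∞ fun θ : ℝ => Complex.exp (θ * Complex.I) :=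
    (Complex.ofRealCLM.contDiff.mul contDiff_const).cexp
  have h2 : ContDiff ℝ ∞ fun θ : ℝ => Complex.exp ((-θ : ℝ) * Complex.I) :=
    ((Complex.ofRealCLM.contDiff.comp contDiff_neg).mul contDiff_const).cexp
  have h3 : ContDiff ℝ ∞ fun θ : ℝ => (c : ℂ) * (Complex.exp (θ * Complex.I) - p) *
      (Complex.exp (θ * Complex.I) - q) / (p - q) * (-Complex.I) *
      Complex.exp ((-θ : ℝ) * Complex.I) :=
    ((((contDiff_const.mul (h1.sub contDiff_const)).mul (h1.sub contDiff_const)).div_const _).mul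
      contDiff_const).mul h2
  convert Complex.reCLM.contDiff.comp h3 using 1
  funext θ
  rw [pencilField, ← Circle.exp_neg]
  rfl

theorem continuous_pencilField (p q : Circle) (c : ℝ) : Continuous (pencilField p q c) := by
  unfold pencilField
  fun_prop

end HyperbolicPencil

/-- A Moebius map preserving an arc and fixing its end points is the time-one map of a smooth
flow on the arc. -/
theorem IsMobius.exists_isFlowOn {f : Circle ≃ₜ Circle} (hf : IsMobius f) {α β : ℝ}
    (hαβ : α < β) (hβ : β < α + 2 * Real.pi) (hα : f (Circle.exp α) = Circle.exp α)
    (hβf : f (Circle.exp β) = Circle.exp β) :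
    ∃ (v : Circle → ℝ) (Φ : ℝ → Circle → Circle),
      ContDiff ℝ ∞ (fun θ : ℝ => v (Circle.exp θ)) ∧ IsFlowOn v (Circle.exp '' Set.Ioo α β) Φ ∧
        ∀ x ∈ Circle.exp '' Set.Ioo α β, Φ 1 x = f x := by
  have hpq : Circle.exp α ≠ Circle.exp β := fun h => by
    have := Circle.eq_of_exp_eq_exp h (by linarith [Real.pi_pos]) (by linarith)
    linarith
  obtain ⟨l, hl0, hl⟩ := hf.exists_multiplier hpq hα hβf
  have hne : ∀ x ∈ Circle.exp '' Set.Ioo α β, x ≠ Circle.exp α ∧ x ≠ Circle.exp β :=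
    fun x hx => ⟨fun h => exp_left_notMem_arc hβ (h ▸ hx),
      fun h => exp_right_notMem_arc hβ (h ▸ hx)⟩
  -- The rate is log l, so that the time-one map has multiplier l.
  set Φ := pencilFlow (Circle.exp α) (Circle.exp β) hpq (Real.log l) with hΦ
  have hder : ∀ t z, HasDerivAt (fun s => (Φ s z : ℂ)) _ t :=
    fun t z => hasDerivAt_pencilFlow hpq (Real.log l) t z
  refine ⟨pencilField (Circle.exp α) (Circle.exp β) (Real.log l), Φ, contDiff_pencilField _ _ _,
    ⟨(continuous_pencilField _ _ _).continuousOn, fun x hx => ⟨pencilFlow_zero _ _ _, fun t => ?_,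
      fun s t => pencilFlow_add _ _ _ _ (hne x hx).2, fun t => hder t x⟩⟩, fun x hx => ?_⟩
  · have hcont : Continuous fun s => Φ s x := by
      refine Topology.IsInducing.subtypeVal.continuous_iff.2 ?_
      exact continuous_iff_continuousAt.2 fun t => (hder t x).continuousAt
    refine Circle.isPreconnected_subset_arc hβ.le (isPreconnected_range hcont) ?_ ?_ ?_ ⟨t, rfl⟩
    · rintro ⟨s, hs⟩
      exact pencilFlow_ne_left hpq _ _ (hne x hx).1 hs
    · rintro ⟨s, hs⟩
      exact pencilFlow_ne_right hpq _ _ (hne x hx).2 hs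
    · exact ⟨x, ⟨0, pencilFlow_zero _ _ _⟩, hx⟩
  · apply Circle.ext
    symm
    rw [hΦ, coe_pencilFlow, mul_one, Real.exp_log hl0, eq_pencilPoint_iff hpq hl0]
    exact hl x

/-! ### Arbitrary flows on an arc -/

section FlowsOnArcs

variable {f : Circle ≃ₜ Circle} {F : ℝ → ℝ} {α β : ℝ} {v : Circle → ℝ} {Φ : ℝ → Circle → Circle}

theorem IsFlowOn.continuous {J : Set Circle} (hΦ : IsFlowOn v J Φ) {x : Circle} (hx : x ∈ J) :
    Continuous fun t => Φ t x :=
  Topology.IsInducing.subtypeVal.continuous_iff.2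
    (continuous_iff_continuousAt.2 fun t => ((hΦ.2 x hx).2.2.2 t).continuousAt)

/-- Angle coordinate on an arc of length less than `2π`. -/
theorem IsFlowOn.exists_angle (hβ : β < α + 2 * Real.pi)
    (hΦ : IsFlowOn v (Circle.exp '' Set.Ioo α β) Φ) {x : Circle}
    (hx : x ∈ Circle.exp '' Set.Ioo α β) :
    ∃ θ : ℝ → ℝ, Continuous θ ∧ ∀ t, θ t ∈ Set.Ioo α β ∧ Circle.exp (θ t) = Φ t x := by
  -- Rotating the midpoint of the arc to 1 moves the arc into the slit plane, where the argument is
  -- continuous.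
  set m := (α + β) / 2 with hm
  have key : ∀ t, ∃ y ∈ Set.Ioo α β, Circle.exp y = Φ t x ∧
      Complex.arg ((Φ t x / Circle.exp m : Circle) : ℂ) = y - m := fun t => by
    obtain ⟨y, hy, hyx⟩ := (hΦ.2 x hx).2.1 t
    refine ⟨y, hy, hyx, ?_⟩
    rw [← hyx, ← Circle.exp_sub]
    exact Circle.arg_exp (by linarith [hy.1]) (by linarith [hy.2])
  refine ⟨fun t => m + Complex.arg ((Φ t x / Circle.exp m : Circle) : ℂ), ?_, fun t => ?_⟩
  · rw [continuous_iff_continuousAt]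
    intro t
    refine continuousAt_const.add ?_
    have h1 : ContinuousAt (fun t => ((Φ t x / Circle.exp m : Circle) : ℂ)) t :=
      (continuous_subtype_val.comp ((hΦ.continuous hx).div_const _)).continuousAt
    refine ContinuousAt.comp (f := fun t => ((Φ t x / Circle.exp m : Circle) : ℂ))
      (Complex.continuousAt_arg ?_) h1
    rw [Complex.mem_slitPlane_iff_arg]
    obtain ⟨y, hy, -, hyx⟩ := key t
    rw [hyx]
    exact ⟨by linarith [hy.2] |> ne_of_lt, Circle.coe_ne_zero _⟩
  · obtain ⟨y, hy, hyx, h⟩ := key t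
    simp only [h, add_sub_cancel]
    exact ⟨hy, hyx⟩

/-- A flow on an arc whose time-one map has no fixed points in the arc consists of a single
orbit, and the angle along this orbit is strictly monotone in time. -/
theorem IsFlowOn.exists_strict_angle (hβ : β < α + 2 * Real.pi)
    (hF : IsCircleLift f F) (hFα : F α = α) (hFβ : F β = β)
    (hfix : ∀ x ∈ Circle.exp '' Set.Ioo α β, f x ≠ x)
    (hΦ : IsFlowOn v (Circle.exp '' Set.Ioo α β) Φ)
    (h1 : ∀ x ∈ Circle.exp '' Set.Ioo α β, Φ 1 x = f x) {x : Circle}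
    (hx : x ∈ Circle.exp '' Set.Ioo α β) :
    ∃ θ : ℝ → ℝ, Continuous θ ∧ (StrictMono θ ∨ StrictAnti θ) ∧ Set.range θ = Set.Ioo α β ∧
      ∀ t, Circle.exp (θ t) = Φ t x := by
  obtain ⟨θ, hθ, hmem⟩ := hΦ.exists_angle hβ hx
  have hαβ : α < β := (hmem 0).1.1.trans (hmem 0).1.2
  have hinj : ∀ y ∈ Set.Ioo α β, ∀ z ∈ Set.Ioo α β, Circle.exp y = Circle.exp z → y = z :=
    fun y hy z hz h => Circle.eq_of_exp_eq_exp h (by linarith [hy.2, hz.1])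
      (by linarith [hy.1, hz.2])
  have hshift : ∀ t, F (θ t) = θ (1 + t) := fun t => by
    have hm := (hmem t).1
    refine hinj _ ⟨hFα ▸ hF.strictMono hm.1, ?_⟩ _ (hmem _).1 ?_
    · rw [← hFβ]; exact hF.strictMono hm.2
    · rw [← hF.exp_apply, (hmem t).2, (hmem _).2, (hΦ.2 x hx).2.2.1,
        h1 _ ((hΦ.2 x hx).2.1 t)]
  have hfixF : ∀ y ∈ Set.Ioo α β, F y ≠ y := fun y hy h =>
    hfix _ ⟨y, hy, rfl⟩ (by rw [hF.exp_apply, h])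
  have hbdd : BddAbove (Set.range θ) := ⟨β, by rintro _ ⟨t, rfl⟩; exact (hmem t).1.2.le⟩
  have hbdd' : BddBelow (Set.range θ) := ⟨α, by rintro _ ⟨t, rfl⟩; exact (hmem t).1.1.le⟩
  -- The range of θ is carried onto itself by F, which shifts time by 1. Its supremum is thus fixed
  -- by F, and F has no fixed point strictly inside.
  have hsup : sSup (Set.range θ) = β := by
    set σ := sSup (Set.range θ)
    have hle : ∀ t, θ t ≤ σ := fun t => le_csSup hbdd ⟨t, rfl⟩
    have hσβ : σ ≤ β := csSup_le (Set.range_nonempty θ)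
      (by rintro _ ⟨t, rfl⟩; exact (hmem t).1.2.le)
    by_contra hne
    have hσ : σ ∈ Set.Ioo α β := ⟨(hmem 0).1.1.trans_le (hle 0), lt_of_le_of_ne hσβ hne⟩
    refine hfixF σ hσ (le_antisymm ?_ ?_)
    · have hcl : σ ∈ closure (Set.range θ) := csSup_mem_closure (Set.range_nonempty θ) hbdd
      refine closure_minimal (t := F ⁻¹' Set.Iic σ) ?_ (isClosed_Iic.preimage hF.continuous) hcl
      rintro _ ⟨t, rfl⟩
      exact (hshift t).trans_le (hle _)
    · refine csSup_le (Set.range_nonempty θ) ?_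
      rintro _ ⟨t, rfl⟩
      have := hshift (t - 1)
      rw [add_sub_cancel] at this
      rw [← this]
      exact hF.strictMono.monotone (hle _)
  have hinf : sInf (Set.range θ) = α := by
    set σ := sInf (Set.range θ)
    have hle : ∀ t, σ ≤ θ t := fun t => csInf_le hbdd' ⟨t, rfl⟩
    have hσα : α ≤ σ := le_csInf (Set.range_nonempty θ)
      (by rintro _ ⟨t, rfl⟩; exact (hmem t).1.1.le)
    by_contra hne
    have hσ : σ ∈ Set.Ioo α β := ⟨lt_of_le_of_ne hσα (Ne.symm hne), (hle 0).trans_lt (hmem 0).1.2⟩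
    refine hfixF σ hσ (le_antisymm ?_ ?_)
    · refine le_csInf (Set.range_nonempty θ) ?_
      rintro _ ⟨t, rfl⟩
      have := hshift (t - 1)
      rw [add_sub_cancel] at this
      rw [← this]
      exact hF.strictMono.monotone (hle _)
    · have hcl : σ ∈ closure (Set.range θ) := csInf_mem_closure (Set.range_nonempty θ) hbdd'
      refine closure_minimal (t := F ⁻¹' Set.Ici σ) ?_ (isClosed_Ici.preimage hF.continuous) hcl
      rintro _ ⟨t, rfl⟩
      exact (hle _).trans_eq (hshift t).symm
  have hrange : Set.range θ = Set.Ioo α β := by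
    refine Set.Subset.antisymm (by rintro _ ⟨t, rfl⟩; exact (hmem t).1) fun y hy => ?_
    obtain ⟨_, ⟨s, rfl⟩, hs⟩ := exists_lt_of_lt_csSup (Set.range_nonempty θ)
      (show y < sSup (Set.range θ) by rw [hsup]; exact hy.2)
    obtain ⟨_, ⟨t, rfl⟩, ht⟩ := exists_lt_of_csInf_lt (Set.range_nonempty θ)
      (show sInf (Set.range θ) < y by rw [hinf]; exact hy.1)
    exact mem_range_of_exists_le_of_exists_ge hθ ⟨t, ht.le⟩ ⟨s, hs.le⟩
  -- By the group law a repeated value makes θ periodic. Its range would then be compact, contrary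
  -- to being an open interval.
  have hper : ∀ s t, s < t → θ s ≠ θ t := fun s t hst h => by
    have hP : Function.Periodic θ (t - s) := fun u => by
      refine hinj _ (hmem _).1 _ (hmem _).1 ?_
      rw [(hmem _).2, (hmem _).2, show u + (t - s) = (u - s) + t by ring, (hΦ.2 x hx).2.2.1,
        ← (hmem t).2, ← h, (hmem s).2, ← (hΦ.2 x hx).2.2.1, sub_add_cancel]
    have hcomp : IsCompact (Set.range θ) := by
      rw [← hP.image_Icc (sub_pos.2 hst) 0]
      exact isCompact_Icc.image hθ
    rw [hrange] at hcomp
    have := hcomp.isClosed.closure_eq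
    rw [closure_Ioo hαβ.ne] at this
    exact lt_irrefl α (this ▸ Set.left_mem_Icc.2 hαβ.le : α ∈ Set.Ioo α β).1
  refine ⟨θ, hθ, hθ.strictMono_of_inj fun s t h => ?_, hrange, fun t => (hmem t).2⟩
  rcases lt_trichotomy s t with hst | hst | hst
  · exact absurd h (hper s t hst)
  · exact hst
  · exact absurd h.symm (hper t s hst)

/-- The time-`r` map of such a flow, extended by the identity, is a homeomorphism. -/
theorem IsFlowOn.exists_homeomorph (hβ : β < α + 2 * Real.pi) (hαβ : α < β)
    (hF : IsCircleLift f F) (hFα : F α = α) (hFβ : F β = β)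
    (hfix : ∀ x ∈ Circle.exp '' Set.Ioo α β, f x ≠ x)
    (hΦ : IsFlowOn v (Circle.exp '' Set.Ioo α β) Φ)
    (h1 : ∀ x ∈ Circle.exp '' Set.Ioo α β, Φ 1 x = f x) (r : ℝ) :
    ∃ h : Circle ≃ₜ Circle, (∀ x ∉ Circle.exp '' Set.Ioo α β, h x = x) ∧
      ∀ x ∈ Circle.exp '' Set.Ioo α β, h x = Φ r x := by
  have hx : Circle.exp ((α + β) / 2) ∈ Circle.exp '' Set.Ioo α β :=
    ⟨_, ⟨by linarith, by linarith⟩, rfl⟩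
  obtain ⟨θ, -, hmono, hrange, hexp⟩ := hΦ.exists_strict_angle hβ hF hFα hFβ hfix h1 hx
  have hmem : ∀ t, θ t ∈ Set.Ioo α β := fun t => hrange ▸ Set.mem_range_self t
  have hinv : ∀ y, ∃ t, y ∈ Set.Ioo α β → θ t = y := fun y => by
    by_cases hy : y ∈ Set.Ioo α β
    · rw [← hrange] at hy
      obtain ⟨t, ht⟩ := hy
      exact ⟨t, fun _ => ht⟩
    · exact ⟨0, fun h => absurd h hy⟩
  choose τ hτ using hinv
  classical
  -- In the time coordinate this is the translation by r, which preserves order whether θ increases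
  -- or decreases.
  let φ : ℝ → ℝ := fun y => if y ∈ Set.Ioo α β then θ (τ y + r) else y
  have hin : ∀ y ∈ Set.Ioo α β, φ y = θ (τ y + r) := fun y hy => if_pos hy
  have hout : ∀ y, y ∉ Set.Ioo α β → φ y = y := fun y hy => if_neg hy
  have hα : φ α = α := hout _ fun h => lt_irrefl _ h.1
  have hend : φ (α + 2 * Real.pi) = α + 2 * Real.pi := hout _ fun h => by linarith [h.2]
  have hφ : StrictMonoOn φ (Set.Icc α (α + 2 * Real.pi)) := fun y hy z hz hyz => by
    by_cases hy' : y ∈ Set.Ioo α β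
    · rw [hin y hy']
      by_cases hz' : z ∈ Set.Ioo α β
      · rw [hin z hz']
        rw [← hτ y hy', ← hτ z hz'] at hyz
        rcases hmono with hm | hm
        · exact hm (by linarith [hm.lt_iff_lt.1 hyz])
        · exact hm (by linarith [hm.lt_iff_gt.1 hyz])
      · rw [hout z hz']
        have : β ≤ z := le_of_not_gt fun h => hz' ⟨hy'.1.trans hyz, h⟩
        exact (hmem _).2.trans_le this
    · rw [hout y hy']
      by_cases hz' : z ∈ Set.Ioo α β
      · rw [hin z hz']
        have : y ≤ α := le_of_not_gt fun h => hy' ⟨h, hyz.trans hz'.2⟩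
        exact this.trans_lt (hmem _).1
      · rwa [hout z hz']
  have hsurj : Set.SurjOn φ (Set.Icc α (α + 2 * Real.pi)) (Set.Icc α (α + 2 * Real.pi)) :=
    fun y hy => by
      by_cases hy' : y ∈ Set.Ioo α β
      · have hm := hmem (τ y - r)
        refine ⟨θ (τ y - r), ⟨hm.1.le, by linarith [hm.2]⟩, ?_⟩
        rw [hin _ hm]
        have hθi : Function.Injective θ := hmono.elim (·.injective) (·.injective)
        rw [hθi (hτ _ hm), sub_add_cancel, hτ y hy']
      · exact ⟨y, hy, hout y hy'⟩
  obtain ⟨h, -, hh⟩ := exists_circle_homeomorph_of_strictMonoOn hφ hα hend hsurj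
  refine ⟨h, fun z hz => ?_, ?_⟩
  · obtain ⟨y, hy, rfl⟩ := Circle.exists_mem_Ico_exp_eq α z
    rw [hh y ⟨hy.1, hy.2.le⟩, hout y fun hy' => hz ⟨y, hy', rfl⟩]
  · rintro _ ⟨y, hy, rfl⟩
    rw [hh y ⟨hy.1.le, by linarith [hy.2]⟩, hin y hy, hexp, add_comm, (hΦ.2 _ hx).2.2.1, ← hexp,
      hτ y hy]

end FlowsOnArcs

/-! ### Density of the available times -/

/-- The numbers `n + m√2` with `n` an integer and `m` a natural number are dense. -/
theorem exists_int_add_nat_mul_sqrt_two (y : ℝ) {ε : ℝ} (hε : 0 < ε) :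
    ∃ (n : ℤ) (m : ℕ), |y - (n + m * √2)| < ε := by
  obtain ⟨N, hN⟩ := exists_nat_one_div_lt hε
  -- Dirichlet approximation provides a step δ = k√2 − j of size below ε, nonzero by irrationality.
  obtain ⟨j, k, hk, -, hjk⟩ := Real.exists_int_int_abs_mul_sub_le (√2) N.succ_pos
  lift k to ℕ using hk.le
  have hk' : (k : ℤ) ≠ 0 := hk.ne'
  set δ : ℝ := (k : ℝ) * √2 - j with hδ
  have hδ0 : δ ≠ 0 := fun h => by
    have hirr : Irrational ((k : ℕ) * √2) := irrational_sqrt_two.natCast_mul (by exact_mod_cast hk')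
    exact hirr ⟨j, by push_cast; linarith⟩
  have hδε : |δ| < ε := by
    refine lt_of_le_of_lt ?_ hN
    have e : |δ| ≤ 1 / ((N.succ : ℝ) + 1) := by simpa [hδ] using hjk
    refine e.trans (one_div_le_one_div_of_le (by positivity) ?_)
    push_cast
    linarith
  have key : ∀ (M : ℤ) (i : ℕ), (M : ℝ) + i * δ = ((M - i * j : ℤ) : ℝ) + ((i * k : ℕ) : ℝ) * √2 :=
    fun M i => by rw [hδ]; push_cast; ring
  -- Only natural multiples of δ are allowed and its sign is unknown, so the walk starts at the
  -- integer above y if δ is negative and below y if it is positive.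
  rcases hδ0.lt_or_gt with h | h
  · have h0 : 0 ≤ ((⌈y⌉ : ℝ) - y) / (-δ) := div_nonneg (by linarith [Int.le_ceil y]) (by linarith)
    refine ⟨_, _, (congrArg (fun w => |y - w| < ε) (key ⌈y⌉ ⌊((⌈y⌉ : ℝ) - y) / (-δ)⌋₊)).mp ?_⟩
    have e1 := Nat.floor_le h0
    have e2 := Nat.lt_floor_add_one (((⌈y⌉ : ℝ) - y) / (-δ))
    rw [le_div_iff₀ (by linarith)] at e1
    rw [div_lt_iff₀ (by linarith)] at e2
    rw [abs_of_neg h] at hδε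
    rw [abs_lt]
    constructor <;> nlinarith
  · have h0 : 0 ≤ (y - (⌊y⌋ : ℝ)) / δ := div_nonneg (by linarith [Int.floor_le y]) h.le
    refine ⟨_, _, (congrArg (fun w => |y - w| < ε) (key ⌊y⌋ ⌊(y - (⌊y⌋ : ℝ)) / δ⌋₊)).mp ?_⟩
    have e1 := Nat.floor_le h0
    have e2 := Nat.lt_floor_add_one ((y - (⌊y⌋ : ℝ)) / δ)
    rw [le_div_iff₀ h] at e1
    rw [div_lt_iff₀ h] at e2
    rw [abs_of_pos h] at hδε
    rw [abs_lt]
    constructor <;> nlinarith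

/-! ### An explicit Schottky pair -/

section Existence

/-- The right-hand side of the hypothesis is the cosine of the angle between z and the centre of the
arc. -/
theorem mem_circleArc_of_le_re {m ρ : ℝ} (hρ0 : 0 ≤ ρ) (hρ : ρ ≤ Real.pi) {z : Circle}
    (h : Real.cos ρ ≤ (z : ℂ).re * Real.cos m + (z : ℂ).im * Real.sin m) :
    z ∈ circleArc (m - ρ) (m + ρ) := by
  obtain ⟨y, hy⟩ : ∃ y, y = Complex.arg ((z / Circle.exp m : Circle) : ℂ) := ⟨_, rfl⟩
  have hexp : Circle.exp y = z / Circle.exp m := by rw [hy, Circle.exp_arg]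
  have hz : Circle.exp (m + y) = z := by rw [Circle.exp_add, hexp, mul_div_cancel]
  have hcos : Real.cos ρ ≤ Real.cos |y| := by
    have e : Real.cos y = (z : ℂ).re * Real.cos m + (z : ℂ).im * Real.sin m := by
      have h1 : (z : ℂ).re = Real.cos (m + y) := by
        rw [← hz, Circle.coe_exp, Complex.exp_ofReal_mul_I_re]
      have h2 : (z : ℂ).im = Real.sin (m + y) := by
        rw [← hz, Circle.coe_exp, Complex.exp_ofReal_mul_I_im]
      rw [h1, h2, ← Real.cos_sub, add_sub_cancel_left]
    rwa [Real.cos_abs, e]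
  have hyπ : |y| ≤ Real.pi := hy ▸ Complex.abs_arg_le_pi _
  have hle : |y| ≤ ρ := (Real.strictAntiOn_cos.le_iff_ge ⟨hρ0, hρ⟩ ⟨abs_nonneg y, hyπ⟩).1 hcos
  rw [abs_le] at hle
  exact ⟨m + y, ⟨by linarith, by linarith⟩, hz⟩

/-- For z ↦ (5z + 4)/(4z + 5) the image has real part at least 4/5 exactly when Re z ≥ −4/5. The
second map is its conjugate by a quarter turn. Arcs of half-width arccos(4/5) about the four axis
points are disjoint because 4/5 > √2/2. -/
theorem exists_isPuncturedTorusSchottky :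
    ∃ f₁ f₂ : Circle ≃ₜ Circle, IsPuncturedTorusSchottky f₁ f₂ := by
  have n1 : ‖(4 : ℂ)‖ < ‖(5 : ℂ)‖ := by norm_num
  have n2 : ‖(4 * Complex.I : ℂ)‖ < ‖(5 : ℂ)‖ := by norm_num
  have hsq : ∀ z : Circle, (z : ℂ).re * (z : ℂ).re + (z : ℂ).im * (z : ℂ).im = 1 := fun z => by
    rw [← Complex.normSq_apply, Circle.normSq_coe]
  set ρ := Real.arccos (4 / 5) with hρ
  have hcos : Real.cos ρ = 4 / 5 := Real.cos_arccos (by norm_num) (by norm_num)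
  have hpi := Real.pi_pos
  have hρ0 : 0 < ρ := Real.arccos_pos.2 (by norm_num)
  have hρ4 : ρ < Real.pi / 4 := by
    rw [hρ, ← Real.arccos_cos (x := Real.pi / 4) (by positivity) (by linarith),
      Real.cos_pi_div_four]
    have h2 : √2 ^ 2 = 2 := Real.sq_sqrt (by norm_num)
    have h0 : 0 ≤ √2 := Real.sqrt_nonneg 2
    exact Real.strictAntiOn_arccos ⟨by linarith, by nlinarith⟩ ⟨by norm_num, by norm_num⟩
      (by nlinarith)
  refine ⟨mobiusCircle 5 4 n1, mobiusCircle 5 (4 * Complex.I) n2,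
    ⟨_, _, isMobiusWith_mobiusCircle _ _ n1⟩, ⟨_, _, isMobiusWith_mobiusCircle _ _ n2⟩,
    ![0 - ρ, 0 + ρ, Real.pi / 2 - ρ, Real.pi / 2 + ρ, Real.pi - ρ, Real.pi + ρ,
      (Real.pi / 2 + Real.pi) - ρ, (Real.pi / 2 + Real.pi) + ρ], ?_, ?_, ?_, Or.inl ?_⟩
  · rw [Fin.strictMono_iff_lt_succ]
    intro i
    fin_cases i <;> simp <;> linarith
  · show (Real.pi / 2 + Real.pi) + ρ < 0 - ρ + 2 * Real.pi
    linarith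
  · show _ '' (circleArc (Real.pi - ρ) (Real.pi + ρ))ᶜ ⊆ circleArc (0 - ρ) (0 + ρ)
    rintro _ ⟨z, hz, rfl⟩
    have hz' := fun h => hz (mem_circleArc_of_le_re (m := Real.pi) hρ0.le (by linarith) h)
    refine mem_circleArc_of_le_re hρ0.le (by linarith) ?_
    have hs := hsq z
    rw [hcos, Real.cos_pi, Real.sin_pi, imp_false, not_le] at hz'
    rw [hcos, Real.cos_zero, Real.sin_zero, (isMobiusWith_mobiusCircle 5 4 n1).2, discMobius,
      mul_zero, add_zero, mul_one, Complex.div_re]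
    have hd : Complex.normSq (conj (4 : ℂ) * z + conj 5) = 41 + 40 * (z : ℂ).re := by
      simp [Complex.normSq_apply, Complex.conj_ofNat]
      linear_combination 16 * hs
    rw [hd, ← add_div, le_div_iff₀ (by linarith)]
    simp [Complex.conj_ofNat]
    nlinarith
  · show _ '' (circleArc (Real.pi / 2 + Real.pi - ρ) (Real.pi / 2 + Real.pi + ρ))ᶜ ⊆
      circleArc (Real.pi / 2 - ρ) (Real.pi / 2 + ρ)
    rintro _ ⟨z, hz, rfl⟩
    have hz' := fun h => hz (mem_circleArc_of_le_re (m := Real.pi / 2 + Real.pi) hρ0.le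
      (by linarith) h)
    refine mem_circleArc_of_le_re hρ0.le (by linarith) ?_
    have hs := hsq z
    rw [hcos, Real.cos_add_pi, Real.sin_add_pi, Real.cos_pi_div_two, Real.sin_pi_div_two,
      imp_false, not_le] at hz'
    rw [hcos, Real.cos_pi_div_two, Real.sin_pi_div_two,
      (isMobiusWith_mobiusCircle 5 (4 * Complex.I) n2).2, discMobius,
      mul_zero, zero_add, mul_one, Complex.div_im]
    have hd : Complex.normSq (conj (4 * Complex.I : ℂ) * z + conj 5) =
        41 + 40 * (z : ℂ).im := by
      simp [Complex.normSq_apply, Complex.conj_ofNat]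
      linear_combination 16 * hs
    rw [hd, ← sub_div, le_div_iff₀ (by linarith)]
    simp [Complex.conj_ofNat]
    nlinarith

end Existence

/-! ### Properties of every commutator interval -/

namespace IsCommutatorInterval

variable {f₁ f₂ : Circle ≃ₜ Circle} {I₀ : Set Circle}

/-- Every complementary interval is a translate of the one constructed from the gaps, so the
covering property passes to it. -/
theorem exists_apply_mem (hI : IsCommutatorInterval f₁ f₂ I₀)
    (h : IsPuncturedTorusSchottky f₁ f₂) {x : Circle} (hx : x ∉ schottkyLimitSet f₁ f₂) :
    ∃ g ∈ Subgroup.closure {f₁, f₂}, g x ∈ I₀ := by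
  obtain ⟨J, ⟨⟨y, hy, hJ⟩, -⟩, hcov⟩ := h.exists_isCommutatorInterval
  obtain ⟨⟨z, hz, rfl⟩, -⟩ := hI
  obtain ⟨k, hk, hkz⟩ := hcov z hz
  obtain ⟨g, hg, hgx⟩ := hcov x hx
  have himg : k '' connectedComponentIn (schottkyLimitSet f₁ f₂)ᶜ z = J := by
    refine (image_connectedComponentIn_compl_limitSet h.closure_le hk hz).trans ?_
    rw [hJ] at hkz ⊢
    exact (connectedComponentIn_eq hkz).symm
  rw [← himg] at hgx
  obtain ⟨w, hw, hwx⟩ := hgx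
  refine ⟨k⁻¹ * g, mul_mem (inv_mem hk) hg, ?_⟩
  rw [Homeomorph.mul_apply, ← hwx]
  simpa using hw

/-- The commutator fixes both ends of the arc; a further fixed point inside would make it trivial,
which ping-pong excludes. -/
theorem exists_arc (hI : IsCommutatorInterval f₁ f₂ I₀) (h : IsPuncturedTorusSchottky f₁ f₂) :
    ∃ (α β : ℝ) (F : ℝ → ℝ), α < β ∧ β < α + 2 * Real.pi ∧ I₀ = Circle.exp '' Set.Ioo α β ∧
      IsCircleLift (f₁ * f₂ * f₁⁻¹ * f₂⁻¹) F ∧ F α = α ∧ F β = β ∧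
      IsMobius (f₁ * f₂ * f₁⁻¹ * f₂⁻¹) ∧
      ∀ x ∈ Circle.exp '' Set.Ioo α β, (f₁ * f₂ * f₁⁻¹ * f₂⁻¹) x ≠ x := by
  have hm : IsMobius (f₁ * f₂ * f₁⁻¹ * f₂⁻¹) :=
    mobiusSubgroup.mul_mem (mobiusSubgroup.mul_mem (mobiusSubgroup.mul_mem h.1 h.2.1) h.1.inv)
      h.2.1.inv
  obtain ⟨α, β, hαβ, hβ, -, -, rfl⟩ := hI.1.exists_arc isClosed_limitSet h.limitSet_nontrivial
  obtain ⟨a, b, hab⟩ := hm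
  obtain ⟨F, hF⟩ := hab.exists_lift
  obtain ⟨G, hG, hGα, hGβ⟩ := hF.exists_fixing hαβ hβ hI.2
  refine ⟨α, β, G, hαβ, hβ, rfl, hG, hGα, hGβ, ⟨a, b, hab⟩, fun x hx hfx => ?_⟩
  refine h.commutator_ne_one (IsMobius.eq_one_of_apply_eq ⟨a, b, hab⟩ (p := Circle.exp α)
    (q := Circle.exp β) (fun hc => ?_) (by rw [hG.exp_apply, hGα]) (by rw [hG.exp_apply, hGβ])
    (fun hc => exp_left_notMem_arc hβ (hc ▸ hx)) (fun hc => exp_right_notMem_arc hβ (hc ▸ hx)) hfx)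
  have := Circle.eq_of_exp_eq_exp hc (by linarith [Real.pi_pos]) (by linarith)
  linarith

theorem exists_isCommutatorFlow (hI : IsCommutatorInterval f₁ f₂ I₀)
    (h : IsPuncturedTorusSchottky f₁ f₂) : ∃ (v : Circle → ℝ) (Φ : ℝ → Circle → Circle),
      ContDiff ℝ ∞ (fun θ : ℝ => v (Circle.exp θ)) ∧ IsCommutatorFlow f₁ f₂ I₀ v Φ := by
  obtain ⟨α, β, F, hαβ, hβ, rfl, hF, hFα, hFβ, hm, -⟩ := hI.exists_arc h
  obtain ⟨v, Φ, hv, hΦ, h1⟩ := hm.exists_isFlowOn hαβ hβ (by rw [hF.exp_apply, hFα])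
    (by rw [hF.exp_apply, hFβ])
  exact ⟨v, Φ, hv, hΦ, h1⟩

theorem exists_isTimeMinusSqrtTwo (hI : IsCommutatorInterval f₁ f₂ I₀)
    (h : IsPuncturedTorusSchottky f₁ f₂) {v : Circle → ℝ} {Φ : ℝ → Circle → Circle}
    (hΦ : IsCommutatorFlow f₁ f₂ I₀ v Φ) : ∃ f₃ : Circle ≃ₜ Circle, IsTimeMinusSqrtTwo I₀ Φ f₃ := by
  obtain ⟨α, β, F, hαβ, hβ, rfl, hF, hFα, hFβ, -, hfix⟩ := hI.exists_arc h
  exact hΦ.1.exists_homeomorph hβ hαβ hF hFα hFβ hfix hΦ.2 _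

theorem disjoint_limitSet (hI : IsCommutatorInterval f₁ f₂ I₀) {x : Circle} (hx : x ∈ I₀) :
    x ∉ schottkyLimitSet f₁ f₂ := by
  obtain ⟨⟨y, -, rfl⟩, -⟩ := hI
  exact connectedComponentIn_subset _ _ hx

end IsCommutatorInterval

theorem IsFlowOn.pow_apply {J : Set Circle} {v : Circle → ℝ} {Φ : ℝ → Circle → Circle}
    (hΦ : IsFlowOn v J Φ) {g : Circle ≃ₜ Circle} {r : ℝ} (hg : ∀ x ∈ J, g x = Φ r x) {x : Circle}
    (hx : x ∈ J) (n : ℕ) : (g ^ n) x = Φ (n * r) x := by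
  induction n with
  | zero => simp [(hΦ.2 x hx).1]
  | succ n ih =>
    rw [pow_succ', Homeomorph.mul_apply, ih, hg _ ((hΦ.2 x hx).2.1 _), ← (hΦ.2 x hx).2.2.1]
    congr 1
    push_cast
    ring

theorem IsFlowOn.inv_apply {J : Set Circle} {v : Circle → ℝ} {Φ : ℝ → Circle → Circle}
    (hΦ : IsFlowOn v J Φ) {g : Circle ≃ₜ Circle} {r : ℝ} (hg : ∀ x ∈ J, g x = Φ r x) {x : Circle}
    (hx : x ∈ J) : g⁻¹ x = Φ (-r) x := by
  rw [Homeomorph.inv_apply, Homeomorph.symm_apply_eq, hg _ ((hΦ.2 x hx).2.1 _),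
    ← (hΦ.2 x hx).2.2.1, add_neg_cancel, (hΦ.2 x hx).1]

/-- Sets of homeomorphisms with all orbits dense have the circle as their only minimal set. -/
theorem isMinimalSetOf_iff_eq_univ {S : Set (Circle ≃ₜ Circle)} (hS : HasDenseOrbits S)
    (M : Set Circle) : IsMinimalSetOf S M ↔ M = Set.univ := by
  have key : ∀ K : Set Circle, K.Nonempty ∧ IsClosed K ∧ (∀ g ∈ S, g '' K ⊆ K) →
      K = Set.univ := by
    rintro K ⟨⟨x, hx⟩, hcl, hinv⟩
    refine hcl.closure_eq.symm.trans ((hS x).mono ?_).closure_eq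
    rintro _ ⟨g, hg, rfl⟩
    exact hinv g hg ⟨x, hx, rfl⟩
  constructor
  · exact fun h => key M h.1
  · rintro rfl
    exact ⟨⟨⟨1, trivial⟩, isClosed_univ, fun _ _ => Set.subset_univ _⟩,
      fun K hK _ => (key K hK).ge⟩

/-! ### Dynamics of the semigroup -/

section Semigroup

variable {f₁ f₂ f₃ f₄ : Circle ≃ₜ Circle}

theorem mem_semigroupG₁_of_mem_closure {g : Circle ≃ₜ Circle}
    (hg : g ∈ Subgroup.closure {f₁, f₂}) : g ∈ semigroupG₁ f₁ f₂ f₃ f₄ := by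
  have m1 : f₁ ∈ semigroupG₁ f₁ f₂ f₃ f₄ := Subsemigroup.subset_closure (by simp)
  have m1' : f₁⁻¹ ∈ semigroupG₁ f₁ f₂ f₃ f₄ := Subsemigroup.subset_closure (by simp)
  have m2 : f₂ ∈ semigroupG₁ f₁ f₂ f₃ f₄ := Subsemigroup.subset_closure (by simp)
  have m2' : f₂⁻¹ ∈ semigroupG₁ f₁ f₂ f₃ f₄ := Subsemigroup.subset_closure (by simp)
  induction hg using Subgroup.closure_induction_left with
  -- A subsemigroup need not contain the identity; here it arises as the product of a generator and
  -- its inverse.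
  | one => rw [← mul_inv_cancel f₁]; exact mul_mem m1 m1'
  | mul_left x hx y _ ih =>
    rcases hx with rfl | rfl
    · exact mul_mem m1 ih
    · exact mul_mem m2 ih
  | inv_mul_cancel x hx y _ ih =>
    rcases hx with rfl | rfl
    · exact mul_mem m1' ih
    · exact mul_mem m2' ih

theorem apply_mem_limitSet_of_mem_semigroupG₁ (h : IsPuncturedTorusSchottky f₁ f₂)
    (h₃ : ∀ x ∈ schottkyLimitSet f₁ f₂, f₃ x = x)
    (h₄ : f₄ '' schottkyLimitSet f₁ f₂ ⊂ schottkyLimitSet f₁ f₂) {g : Circle ≃ₜ Circle}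
    (hg : g ∈ semigroupG₁ f₁ f₂ f₃ f₄) :
    ∀ x ∈ schottkyLimitSet f₁ f₂, g x ∈ schottkyLimitSet f₁ f₂ := by
  have hΓ : ∀ g ∈ Subgroup.closure {f₁, f₂}, ∀ x ∈ schottkyLimitSet f₁ f₂,
      g x ∈ schottkyLimitSet f₁ f₂ := fun g hg x hx => apply_mem_limitSet h.closure_le hg hx
  have m1 : f₁ ∈ Subgroup.closure {f₁, f₂} := Subgroup.subset_closure (by simp)
  have m2 : f₂ ∈ Subgroup.closure {f₁, f₂} := Subgroup.subset_closure (by simp)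
  induction hg using Subsemigroup.closure_induction with
  | mem g hg =>
    rcases hg with rfl | rfl | rfl | rfl | rfl | rfl
    · exact hΓ _ m1
    · exact hΓ _ (inv_mem m1)
    · exact hΓ _ m2
    · exact hΓ _ (inv_mem m2)
    · exact fun x hx => by rwa [h₃ x hx]
    · exact fun x hx => h₄.1 ⟨x, hx, rfl⟩
  | mul a b _ _ ha hb => exact fun x hx => ha _ (hb x hx)

/-- Invariance under the semigroup includes invariance under the whole Schottky group, so Λ sits
inside every competitor and is itself one. -/
theorem isForwardMinimalSet_iff (h : IsPuncturedTorusSchottky f₁ f₂)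
    (h₃ : ∀ x ∈ schottkyLimitSet f₁ f₂, f₃ x = x)
    (h₄ : f₄ '' schottkyLimitSet f₁ f₂ ⊂ schottkyLimitSet f₁ f₂) (M : Set Circle) :
    IsForwardMinimalSet (semigroupG₁ f₁ f₂ f₃ f₄) M ↔ M = schottkyLimitSet f₁ f₂ := by
  have hL : (schottkyLimitSet f₁ f₂).Nonempty ∧ IsClosed (schottkyLimitSet f₁ f₂) ∧
      ∀ g ∈ (semigroupG₁ f₁ f₂ f₃ f₄ : Set (Circle ≃ₜ Circle)),
        g '' schottkyLimitSet f₁ f₂ ⊆ schottkyLimitSet f₁ f₂ := by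
    refine ⟨h.isCantorSet.1, isClosed_limitSet, ?_⟩
    rintro g hg _ ⟨x, hx, rfl⟩
    exact apply_mem_limitSet_of_mem_semigroupG₁ h h₃ h₄ hg x hx
  have hmin : ∀ K : Set Circle, K.Nonempty ∧ IsClosed K ∧
      (∀ g ∈ (semigroupG₁ f₁ f₂ f₃ f₄ : Set (Circle ≃ₜ Circle)), g '' K ⊆ K) →
      schottkyLimitSet f₁ f₂ ⊆ K := fun K ⟨hn, hcl, hinv⟩ =>
    h.limitSet_subset_of_invariant hcl hn fun g hg x hx =>
      hinv g (mem_semigroupG₁_of_mem_closure hg) ⟨x, hx, rfl⟩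
  constructor
  · exact fun hM => Set.Subset.antisymm (hM.2 hL (hmin M hM.1)) (hmin M hM.1)
  · rintro rfl
    exact ⟨hL, fun K hK _ => hmin K hK⟩

theorem IsPuncturedTorusSchottky.limitSet_ne_univ (h : IsPuncturedTorusSchottky f₁ f₂) :
    schottkyLimitSet f₁ f₂ ≠ Set.univ := fun hu => by
  have := h.interior_limitSet
  rw [hu, interior_univ] at this
  exact Set.univ_nonempty.ne_empty this

theorem not_isForwardMinimal (h : IsPuncturedTorusSchottky f₁ f₂)
    (h₃ : ∀ x ∈ schottkyLimitSet f₁ f₂, f₃ x = x)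
    (h₄ : f₄ '' schottkyLimitSet f₁ f₂ ⊂ schottkyLimitSet f₁ f₂) :
    ¬ IsForwardMinimal (semigroupG₁ f₁ f₂ f₃ f₄) := fun hf => by
  have h1 := (isMinimalSetOf_iff_eq_univ hf (schottkyLimitSet f₁ f₂)).1
    ((isForwardMinimalSet_iff h h₃ h₄ _).2 rfl)
  exact h.limitSet_ne_univ h1

/-- Points of the invariant interval have dense orbits in it under the commutator and the inverse
of the time `-√2` map. -/
theorem exists_dist_apply_lt {I₀ : Set Circle} {v : Circle → ℝ} {Φ : ℝ → Circle → Circle}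
    (h : IsPuncturedTorusSchottky f₁ f₂) (hI : IsCommutatorInterval f₁ f₂ I₀)
    (hΦ : IsCommutatorFlow f₁ f₂ I₀ v Φ) (h₃ : IsTimeMinusSqrtTwo I₀ Φ f₃) {x y : Circle}
    (hx : x ∈ I₀) (hy : y ∈ I₀) {ε : ℝ} (hε : 0 < ε) :
    ∃ g ∈ Subgroup.closure {f₁, f₂}, ∃ m : ℕ, dist y (g ((f₃⁻¹ ^ m) x)) < ε := by
  obtain ⟨α, β, F, hαβ, hβ, rfl, hF, hFα, hFβ, -, hfix⟩ := hI.exists_arc h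
  obtain ⟨θ, hθ, -, hrange, hexp⟩ := hΦ.1.exists_strict_angle hβ hF hFα hFβ hfix hΦ.2 hx
  obtain ⟨z, hz, rfl⟩ := hy
  rw [← hrange] at hz
  obtain ⟨t, rfl⟩ := hz
  rw [hexp]
  obtain ⟨δ, hδ, hclose⟩ := Metric.continuousAt_iff.1 (hΦ.1.continuous hx).continuousAt ε hε
  -- The integer n is realized by powers of the commutator, available in both directions; m must be
  -- natural because only `f₃⁻¹` acts backward.
  obtain ⟨n, m, hnm⟩ := exists_int_add_nat_mul_sqrt_two t hδ
  have hd := @hclose (n + m * √2) (by rwa [Real.dist_eq, abs_sub_comm])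
  have m1 : f₁ ∈ Subgroup.closure {f₁, f₂} := Subgroup.subset_closure (by simp)
  have m2 : f₂ ∈ Subgroup.closure {f₁, f₂} := Subgroup.subset_closure (by simp)
  have mf : f₁ * f₂ * f₁⁻¹ * f₂⁻¹ ∈ Subgroup.closure {f₁, f₂} :=
    mul_mem (mul_mem (mul_mem m1 m2) (inv_mem m1)) (inv_mem m2)
  have h3 : (f₃⁻¹ ^ m) x = Φ (m * √2) x := by
    refine hΦ.1.pow_apply (fun z hz => ?_) hx m
    rw [hΦ.1.inv_apply h₃.2 hz, neg_neg]
  have hmem := (hΦ.1.2 x hx).2.1 (m * √2)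
  have key : ∃ g ∈ Subgroup.closure {f₁, f₂},
      g (Φ (m * √2) x) = Φ (n + m * √2) x := by
    rw [(hΦ.1.2 x hx).2.2.1]
    have hf : ∀ z ∈ Circle.exp '' Set.Ioo α β, (f₁ * f₂ * f₁⁻¹ * f₂⁻¹) z = Φ 1 z :=
      fun z hz => (hΦ.2 z hz).symm
    obtain ⟨k, rfl | rfl⟩ := n.eq_nat_or_neg
    · refine ⟨_, pow_mem mf k, ?_⟩
      rw [hΦ.1.pow_apply hf hmem]
      simp
    · refine ⟨_, pow_mem (inv_mem mf) k, ?_⟩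
      rw [hΦ.1.pow_apply (fun z hz => hΦ.1.inv_apply hf hz) hmem]
      simp
  obtain ⟨g, hg, hgx⟩ := key
  refine ⟨g, hg, m, ?_⟩
  rw [h3, hgx, dist_comm]
  exact hd

/-- An orbit is first expelled from Λ by `f₄⁻¹`, then brought into I₀ by the Schottky group, and
spread there by the two incommensurable times. -/
theorem isBackwardMinimal {I₀ : Set Circle} {v : Circle → ℝ} {Φ : ℝ → Circle → Circle}
    (h : IsPuncturedTorusSchottky f₁ f₂) (hI : IsCommutatorInterval f₁ f₂ I₀)
    (hΦ : IsCommutatorFlow f₁ f₂ I₀ v Φ) (h₃ : IsTimeMinusSqrtTwo I₀ Φ f₃)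
    (h₄ : f₄ '' schottkyLimitSet f₁ f₂ ⊂ schottkyLimitSet f₁ f₂) :
    IsBackwardMinimal (semigroupG₁ f₁ f₂ f₃ f₄) := by
  set S : Set (Circle ≃ₜ Circle) := (semigroupG₁ f₁ f₂ f₃ f₄ : Set (Circle ≃ₜ Circle))⁻¹ with hS
  have hmul : ∀ a ∈ S, ∀ b ∈ S, a * b ∈ S := fun a ha b hb => by
    rw [hS, Set.mem_inv, mul_inv_rev]
    exact (semigroupG₁ f₁ f₂ f₃ f₄).mul_mem hb ha
  have hΓ : ∀ g ∈ Subgroup.closure {f₁, f₂}, g ∈ S := fun g hg =>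
    mem_semigroupG₁_of_mem_closure (inv_mem hg)
  have hf₃ : f₃⁻¹ ∈ S := by
    rw [hS, Set.mem_inv, inv_inv]; exact Subsemigroup.subset_closure (by simp)
  have hf₄ : f₄⁻¹ ∈ S := by
    rw [hS, Set.mem_inv, inv_inv]; exact Subsemigroup.subset_closure (by simp)
  have hpow : ∀ m : ℕ, f₃⁻¹ ^ m ∈ S := fun m => by
    induction m with
    | zero => exact hΓ _ (one_mem _)
    | succ m ih => rw [pow_succ]; exact hmul _ ih _ hf₃
  intro x
  -- For x in Λ, its Schottky orbit accumulates at a limit point outside the closed set `f₄ '' Λ`.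
  -- An orbit point outside that set is moved off Λ by `f₄⁻¹`.
  have step1 : ∃ g ∈ S, g x ∉ schottkyLimitSet f₁ f₂ := by
    by_cases hx : x ∈ schottkyLimitSet f₁ f₂
    · obtain ⟨z, hz, hz4⟩ := Set.not_subset.1 h₄.2
      have hcl : IsClosed (f₄ '' schottkyLimitSet f₁ f₂) :=
        f₄.isClosedMap _ isClosed_limitSet
      have horb : schottkyLimitSet f₁ f₂ ⊆
          closure {y | ∃ g ∈ Subgroup.closure {f₁, f₂}, y = g x} := by
        refine h.limitSet_subset_of_invariant isClosed_closure
          ⟨x, subset_closure ⟨1, one_mem _, rfl⟩⟩ fun g hg y hy => ?_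
        refine map_mem_closure g.continuous hy ?_
        rintro _ ⟨k, hk, rfl⟩
        exact ⟨g * k, mul_mem hg hk, rfl⟩
      obtain ⟨_, hy4, g, hg, rfl⟩ := mem_closure_iff.1 (horb hz) _ hcl.isOpen_compl hz4
      refine ⟨f₄⁻¹ * g, hmul _ hf₄ _ (hΓ g hg), fun hc => hy4 ⟨_, hc, ?_⟩⟩
      rw [← Homeomorph.mul_apply, mul_inv_cancel_left]
    · exact ⟨1, hΓ _ (one_mem _), hx⟩
  obtain ⟨a, ha, hax⟩ := step1
  obtain ⟨b, hb, hbx⟩ := hI.exists_apply_mem h hax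
  have hd : Dense (schottkyLimitSet f₁ f₂)ᶜ := interior_eq_empty_iff_dense_compl.1 h.interior_limitSet
  -- The complement of Λ is dense, so it is enough to approximate z outside Λ: its translate `k z`
  -- in I₀ is approximated first, and the result is pulled back by `k⁻¹`.
  refine dense_closure.1 (hd.mono fun z hz => ?_)
  obtain ⟨k, hk, hkz⟩ := hI.exists_apply_mem h hz
  have hmem : k z ∈ closure {y | ∃ g ∈ S, y = g x} := by
    refine Metric.mem_closure_iff.2 fun ε hε => ?_
    obtain ⟨g, hg, m, hlt⟩ := exists_dist_apply_lt h hI hΦ h₃ hbx hkz hε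
    exact ⟨_, ⟨g * (f₃⁻¹ ^ m * (b * a)), hmul _ (hΓ g hg) _
      (hmul _ (hpow m) _ (hmul _ (hΓ b hb) _ ha)), rfl⟩, hlt⟩
  have := map_mem_closure (k⁻¹).continuous hmem (t := {y | ∃ g ∈ S, y = g x}) (by
    rintro _ ⟨g, hg, rfl⟩
    exact ⟨k⁻¹ * g, hmul _ (hΓ _ (inv_mem hk)) _ hg, rfl⟩)
  rwa [← Homeomorph.mul_apply, inv_mul_cancel, Homeomorph.one_apply] at this

end Semigroup

end

theorem mainTheorem1 :
    -- Schottky pairs of a torus with a hole exist, and for each of them: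
    (∃ f₁ f₂ : Circle ≃ₜ Circle, IsPuncturedTorusSchottky f₁ f₂) ∧
    ∀ f₁ f₂ : Circle ≃ₜ Circle, IsPuncturedTorusSchottky f₁ f₂ →
      IsCantorSet (schottkyLimitSet f₁ f₂) ∧
      -- the construction can be carried out
      (∃ I₀ : Set Circle, IsCommutatorInterval f₁ f₂ I₀) ∧
      (∀ I₀ : Set Circle, IsCommutatorInterval f₁ f₂ I₀ →
        (∃ (v : Circle → ℝ) (Φ : ℝ → Circle → Circle),
          ContDiff ℝ ∞ (fun θ : ℝ => v (Circle.exp θ)) ∧ IsCommutatorFlow f₁ f₂ I₀ v Φ) ∧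
        ∀ (v : Circle → ℝ) (Φ : ℝ → Circle → Circle), IsCommutatorFlow f₁ f₂ I₀ v Φ →
          ∃ f₃ : Circle ≃ₜ Circle, IsTimeMinusSqrtTwo I₀ Φ f₃) ∧
      (∃ f₄ : Circle ≃ₜ Circle, IsOrientationPreserving f₄ ∧
        f₄ '' schottkyLimitSet f₁ f₂ ⊂ schottkyLimitSet f₁ f₂) ∧
      -- and however it is carried out, the resulting semigroup has the claimed properties
      ∀ (I₀ : Set Circle) (v : Circle → ℝ) (Φ : ℝ → Circle → Circle) (f₃ f₄ : Circle ≃ₜ Circle),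
        IsCommutatorInterval f₁ f₂ I₀ → IsCommutatorFlow f₁ f₂ I₀ v Φ →
        IsTimeMinusSqrtTwo I₀ Φ f₃ →
        f₄ '' schottkyLimitSet f₁ f₂ ⊂ schottkyLimitSet f₁ f₂ →
          IsBackwardMinimal (semigroupG₁ f₁ f₂ f₃ f₄) ∧
          ¬ IsForwardMinimal (semigroupG₁ f₁ f₂ f₃ f₄) ∧
          (∀ M : Set Circle, IsForwardMinimalSet (semigroupG₁ f₁ f₂ f₃ f₄) M ↔
            M = schottkyLimitSet f₁ f₂) ∧
          (∀ M : Set Circle, IsBackwardMinimalSet (semigroupG₁ f₁ f₂ f₃ f₄) M ↔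
            M = Set.univ) ∧
          schottkyLimitSet f₁ f₂ ⊂ Set.univ := by
  refine ⟨exists_isPuncturedTorusSchottky, fun f₁ f₂ h => ⟨h.isCantorSet, ?_, fun I₀ hI =>
    ⟨hI.exists_isCommutatorFlow h, fun v Φ hΦ => hI.exists_isTimeMinusSqrtTwo h hΦ⟩,
    h.exists_homeomorph_ssubset, fun I₀ v Φ f₃ f₄ hI hΦ h₃ h₄ => ?_⟩⟩
  · obtain ⟨J, hJ, -⟩ := h.exists_isCommutatorInterval
    exact ⟨J, hJ⟩
  · have h3 : ∀ x ∈ schottkyLimitSet f₁ f₂, f₃ x = x := fun x hx =>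
      h₃.1 x fun hxI => hI.disjoint_limitSet hxI hx
    have hb := isBackwardMinimal h hI hΦ h₃ h₄
    exact ⟨hb, not_isForwardMinimal h h3 h₄, isForwardMinimalSet_iff h h3 h₄,
      isMinimalSetOf_iff_eq_univ hb, Set.ssubset_univ_iff.2 h.limitSet_ne_univ⟩
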